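/- Let $\omega_0>0$, $\mu_0\le-\omega_0$, $0<\delta<\omega_0$, $d\in\mathbb C$ with $\operatorname{Re}d>0$, and let $I_a:\mathbb R\to\mathbb R$ be smooth with all derivatives (including $I_a$ itself) bounded on $\mathbb R$. For $x\in\mathbb R$, $s>0$ put $$g(x,s)=\frac1{\sqrt{4\pi ds}}\int_{\mathbb R}e^{-\frac{(x-y)^2}{4ds}}I_a(y)\,dy .$$ Let $Q$ be the closed quadrilateral in $\mathbb C$ with vertices $0,\ \delta+i\omega_0,\ \omega_0+i\omega_0,\ 2\omega_0$. Assume that there is an open set $U\supseteq Q\setminus\{0\}$ to which every $g(x,\cdot)$ continues analytically, with a bound on $U$ that is uniform in $x$; denote the continuation again by $g$. For $\varepsilon>0$ consider the linear complex Ginzburg--Landau equation $$\varepsilon A_\mu=(\mu+i\omega_0)A+\sqrt\varepsilon\,I_a(x)+\varepsilon d\,A_{xx},\qquad x\in\mathbb R,\ \mu>\mu_0, \tag{1}$$ and set $$A_p(x,\mu)=\frac{e^{\frac{(\mu+i\omega_0)^2}{2\varepsilon}}}{\sqrt\varepsilon}\int_{\mu_0}^{\mu}g(x,\mu-\tilde\mu)\,e^{-\frac{(\tilde\mu+i\omega_0)^2}{2\varepsilon}}d\tilde\mu,\qquad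 A_h(x,\mu)=\frac{e^{\frac{(\mu+i\omega_0)^2-(\mu_0+i\omega_0)^2}{2\varepsilon}}}{\sqrt{4\pi d(\mu-\mu_0)}}\int_{\mathbb R}e^{-\frac{(x-y)^2}{4d(\mu-\mu_0)}}A_0(y)\,dy,$$ $$A_Q(x,\mu)=-\sqrt\varepsilon\,\frac{I_a(x)}{\mu+i\omega_0}+\varepsilon^{3/2}\,\frac{I_a(x)+d(\mu+i\omega_0)I_a''(x)}{(\mu+i\omega_0)^3}$$ (the first two terms of the quasi-steady state (QSS) of (1), attracting for $\mu<0$ and repelling for $\mu>0$). Then the following hold. 1. For every $\varepsilon>0$, $A_p$ is a classical solution of (1), bounded on $\mathbb R\times(\mu_0,\mu_1]$ for every $\mu_1$, with zero initial data at $\mu_0$; and for every bounded continuous $A_0:\mathbb R\to\mathbb C$, $A_h+A_p$ is such a solution with initial data $A_0$ at $\mu_0$ (attained as a limit as $\mu\downarrow\mu_0$). 2. (Attracting QSS.) For every $m>\mu_0$, as $\varepsilon\to0^+$, uniformly in $x\in\mathbb R$ and $\mu\in[m,-\delta]$, $$A_p(x,\mu)=A_Q(x,\mu)+O\!\left(\frac{\varepsilon^{5/2}}{|\mu+i\omega_0|^5}\right).$$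 In particular this holds uniformly on $(-\omega_0,-\delta]$ if $\mu_0<-\omega_0$, and at each fixed $\mu\in(-\omega_0,-\delta]$ if $\mu_0=-\omega_0$. 3. (Repelling QSS and Stokes term.) As $\varepsilon\to0^+$, uniformly in $x\in\mathbb R$ and $\mu\in[\delta,\omega_0]$, $$A_p(x,\mu)=A_Q(x,\mu)+O\!\left(\frac{\varepsilon^{5/2}}{|\mu+i\omega_0|^5}\right)+\Sigma(x,\mu),\qquad \Sigma(x,\mu)=\Big(\sqrt{2\pi}\,g(x,\mu+i\omega_0)+O(\sqrt\varepsilon)\Big)e^{\frac{(\mu+i\omega_0)^2}{2\varepsilon}},$$ where $|\Sigma(x,\mu)|\le C e^{-(\omega_0^2-\mu^2)/(2\varepsilon)}$. For all $K>0$ and $0<r<1$ the Stokes term $\Sigma$ is exponentially small on $[\delta,\omega_0-K\varepsilon^r]$: there are $c>0$ and $C'$ with $|\Sigma(x,\mu)|\le C'e^{-c/\varepsilon^{1-r}}$ for all $x$, all $\mu$ in this interval and all small $\varepsilon$. 4. (Solutions stay near the QSS at all $x$ until $\mu=\omega_0$ to leading order.) For all $m>\mu_0$, $K>0$, $0<r<1$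 and $M$ there are $C$ and $\varepsilon_0>0$ such that for all $0<\varepsilon\le\varepsilon_0$, all continuous $A_0$ with $\sup|A_0|\le M$, all $x\in\mathbb R$ and all $\mu\in[m,\omega_0-K\varepsilon^r]$, $$|A_h(x,\mu)+A_p(x,\mu)-A_Q(x,\mu)|\le C\varepsilon^{5/2}.$$ -/

import Mathlib

open scoped Topology

noncomputable section

namespace LinCGL

/-- The complex time variable `μ + i ω₀`. -/
def cz (ω₀ μ : ℝ) : ℂ := (μ : ℂ) + (ω₀ : ℂ) * Complex.I

/-- The solution at time `s > 0` and position `x` of the heat equation `u_s = d u_xx` on the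
line with initial data `f`, where `0 < Re d`; the square root is the principal one:
`(4 π d s)^(-1/2) ∫ exp (-(x - y)² / (4 d s)) f y dy`. -/
def heatFlow (d : ℂ) (f : ℝ → ℂ) (x s : ℝ) : ℂ :=
  (4 * (Real.pi : ℂ) * d * (s : ℂ)) ^ (-(1 / 2) : ℂ) *
    ∫ y : ℝ, Complex.exp (-((x : ℂ) - (y : ℂ)) ^ 2 / (4 * d * (s : ℂ))) * f y

/-- `I_a` is smooth and each of its derivatives (itself included) is bounded on the line. -/
def HasBoundedDerivs (Ia : ℝ → ℝ) : Prop :=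
  ContDiff ℝ ((⊤ : ℕ∞) : WithTop ℕ∞) Ia ∧
    ∀ n : ℕ, ∃ M : ℝ, ∀ x : ℝ, |iteratedDeriv n Ia x| ≤ M

/-- The closed quadrilateral with vertices `0`, `δ + i ω₀`, `ω₀ + i ω₀`, `2 ω₀`, without the
vertex `0`. It is the union over `δ ≤ μ ≤ ω₀` of the triangles with vertices `0`, `μ + i ω₀`,
`μ + ω₀`. -/
def trackingRegion (ω₀ δ : ℝ) : Set ℂ :=
  {s : ℂ | s ≠ 0 ∧ 0 ≤ s.im ∧ s.im ≤ ω₀ ∧ δ * s.im ≤ ω₀ * s.re ∧ s.re + s.im ≤ 2 * ω₀}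

/-- `g x` is, for every `x`, an analytic continuation of the heat flow `s ↦ g(x, s)`, `s > 0`, of
the source `I_a` to a common open neighbourhood of the tracking region, bounded there uniformly
in `x`. -/
def IsHeatContinuation (ω₀ δ : ℝ) (d : ℂ) (Ia : ℝ → ℝ) (g : ℝ → ℂ → ℂ) : Prop :=
  (∀ x s : ℝ, 0 < s → g x (s : ℂ) = heatFlow d (fun y => (Ia y : ℂ)) x s) ∧
    ∃ U : Set ℂ, IsOpen U ∧ trackingRegion ω₀ δ ⊆ U ∧
      (∀ x : ℝ, AnalyticOnNhd ℂ (g x) U) ∧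
      ∃ M : ℝ, ∀ x : ℝ, ∀ s ∈ U, ‖g x s‖ ≤ M

/-- The particular solution `B_p(x, μ)`, in the variable `B = A exp (-(μ + i ω₀)² / (2 ε))`. -/
def Bp (ε ω₀ : ℝ) (d : ℂ) (Ia : ℝ → ℝ) (μ₀ x μ : ℝ) : ℂ :=
  (1 / (Real.sqrt ε : ℂ)) * ∫ m in μ₀..μ,
    heatFlow d (fun y => (Ia y : ℂ)) x (μ - m) * Complex.exp (-(cz ω₀ m) ^ 2 / (2 * (ε : ℂ)))

/-- The particular solution `A_p(x, μ) = B_p(x, μ) exp ((μ + i ω₀)² / (2 ε))`. -/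
def Ap (ε ω₀ : ℝ) (d : ℂ) (Ia : ℝ → ℝ) (μ₀ x μ : ℝ) : ℂ :=
  Bp ε ω₀ d Ia μ₀ x μ * Complex.exp ((cz ω₀ μ) ^ 2 / (2 * (ε : ℂ)))

/-- The homogeneous solution `B_h(x, μ)` with data `A₀` (for `A`) at `μ₀`. -/
def Bh (ε ω₀ : ℝ) (d : ℂ) (A₀ : ℝ → ℂ) (μ₀ x μ : ℝ) : ℂ :=
  Complex.exp (-(cz ω₀ μ₀) ^ 2 / (2 * (ε : ℂ))) * heatFlow d A₀ x (μ - μ₀)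

/-- The homogeneous solution `A_h(x, μ) = B_h(x, μ) exp ((μ + i ω₀)² / (2 ε))`. -/
def Ah (ε ω₀ : ℝ) (d : ℂ) (A₀ : ℝ → ℂ) (μ₀ x μ : ℝ) : ℂ :=
  Bh ε ω₀ d A₀ μ₀ x μ * Complex.exp ((cz ω₀ μ) ^ 2 / (2 * (ε : ℂ)))

/-- `A` is a classical solution, for `μ > μ₀`, of
`ε A_μ = (μ + i ω₀) A + √ε I_a(x) + ε d A_xx`, bounded on bounded `μ`-intervals, with initial
data `A₀` at `μ₀` (attained as a limit from `μ > μ₀`). -/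
def IsSolution (ε ω₀ : ℝ) (d : ℂ) (Ia : ℝ → ℝ) (μ₀ : ℝ) (A₀ : ℝ → ℂ) (A : ℝ → ℝ → ℂ) : Prop :=
  (∀ μ : ℝ, μ₀ < μ → ContDiff ℝ 2 (fun x => A x μ)) ∧
  (∀ x μ : ℝ, μ₀ < μ → DifferentiableAt ℝ (fun m => A x m) μ) ∧
  (∀ x μ : ℝ, μ₀ < μ →
    (ε : ℂ) * deriv (fun m => A x m) μ =
      cz ω₀ μ * A x μ + (Real.sqrt ε : ℂ) * (Ia x : ℂ) +
        (ε : ℂ) * d * iteratedDeriv 2 (fun y => A y μ) x) ∧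
  (∀ μ₁ : ℝ, ∃ M : ℝ, ∀ x μ : ℝ, μ₀ < μ → μ ≤ μ₁ → ‖A x μ‖ ≤ M) ∧
  (∀ x : ℝ, Filter.Tendsto (fun p : ℝ × ℝ => A p.1 p.2) (𝓝 x ×ˢ 𝓝[>] μ₀) (𝓝 (A₀ x)))

/-- The first two terms of the asymptotic expansion of the quasi-steady state (attracting for
`μ < 0`, repelling for `μ > 0`) of the linear equation. -/
def qss (ε ω₀ : ℝ) (d : ℂ) (Ia : ℝ → ℝ) (x μ : ℝ) : ℂ :=
  -(Real.sqrt ε : ℂ) * ((Ia x : ℂ) / cz ω₀ μ) +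
    ((ε ^ (3 / 2 : ℝ) : ℝ) : ℂ) *
      (((Ia x : ℂ) + d * cz ω₀ μ * ((iteratedDeriv 2 Ia x : ℝ) : ℂ)) / (cz ω₀ μ) ^ 3)

end LinCGL

end

/-!
After the substitution `s = μ - μ'` the particular solution is a Laplace integral,
`A_p(x, μ) = ε ^ (-1/2) ∫ g(x, s) exp ((2 z s - s²) / (2 ε)) ds` over `0 < s < μ - μ₀`, with
`z = μ + i ω₀`. The exponent vanishes at the endpoint `s = 0` and has its only saddle point at
`s = z`, with real part `(μ² - ω₀²) / (2 ε)` there. The endpoint contributes the quasi-steady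
state, and the saddle point the Stokes term.

*The equation.* The heat flow of a bounded continuous function solves the heat equation because its
space and time derivatives are Gaussian moments (`heatFlow_heat_equation`). For the smooth source
all derivatives commute with the flow, and the Duhamel integral can be differentiated under the
integral sign (`hasDerivAt_duhamel_left`, `hasDerivAt_duhamel_right`); multiplication by the weight
`exp (z² / (2 ε))` gives the two classical solutions.

*The endpoint.* Along a ray on which the real part of the exponent decreases at a linear rate, an
amplitude with an expansion `a₀ + a₂ s + O(s²)` can be replaced by an explicitly integrable model,
with an error `O(ε³)` (`exists_ray_expansion`). For `μ ≤ -δ` the positive axis is such a ray, and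
there the expansion of `g` is Taylor's formula for the heat flow (`IsDerivTower.heatAvg_taylor`).
For larger `μ` the ray has to turn into the sector at the vertex `0` of the region of analyticity,
where nothing but boundedness of `g` is given. However, the Taylor remainder of `g` is `O(sⁿ)` on the
axis for every `n`, and bounded in the sector; the theorem of Phragmén and Lindelöf interpolates
between the two edges, and for large `n` the remainder is still `O(s²)` on any given interior ray
(`norm_mobius_le_of_sector`, `IsHeatContinuation.exists_taylor_on_ray`).

*The contour.* The path of integration is deformed into a polygon that leaves `0` along this ray,
rises to height `ω₀` and eventually returns to the axis. Cauchy's theorem with a vertex at `0` is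
`segInt_zero_add`. For `|μ| ≤ δ` the integrand is exponentially small on everything after the first
leg (`exists_middle_bound`). For `δ ≤ μ ≤ ω₀` the path crosses the saddle point horizontally; that leg
is a Gaussian integral (`norm_gauss_integral_sub_le`) whose value, relative to `exp (z² / (2 ε))`, is
`√(2π) g(x, z) + O(√ε)`, and the legs after it are smaller by a factor `√ε`
(`exists_stokes_decomposition`).

*The homogeneous solution* is at most a constant times `exp ((μ² - μ₀²) / (2 ε))`. Since
`|μ₀| ≥ ω₀`, it is as small as the Stokes term for `0 ≤ μ`, and for `μ < 0` it is exponentially small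
as soon as `μ` stays away from `μ₀` (`exists_norm_Ah_le`).
-/

open scoped Topology

noncomputable section

namespace LinCGL

open MeasureTheory Filter Set

/-! ### The heat kernel -/

/-- The heat kernel `(4 π d)^(-1/2) exp (-w² / (4 d))` at time one. -/
def heatKernel (d : ℂ) (w : ℝ) : ℂ :=
  (4 * (Real.pi : ℂ) * d) ^ (-(1 / 2) : ℂ) * Complex.exp (-(1 / (4 * d)) * (w : ℂ) ^ 2)

/-- The heat flow in self-similar variables, `∫ heatKernel d w * f (x + √s w) dw`. In contrast to
`heatFlow` it is meaningful, and continuous, up to `s = 0`. -/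
def heatAvg (d : ℂ) (f : ℝ → ℂ) (x s : ℝ) : ℂ :=
  ∫ w : ℝ, heatKernel d w * f (x + Real.sqrt s * w)

section Kernel

variable {d : ℂ}

lemma re_inv_four_mul_pos (hd : 0 < d.re) : 0 < (1 / (4 * d)).re := by
  have h0 : d ≠ 0 := by rintro rfl; simp at hd
  have : (1 / (4 * d)).re = d.re / (4 * Complex.normSq d) := by
    have hn : Complex.normSq d ≠ 0 := by simpa using h0
    rw [one_div, Complex.inv_re]
    simp only [Complex.normSq_mul, Complex.mul_re, Complex.re_ofNat, Complex.im_ofNat, zero_mul,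
      sub_zero, Complex.normSq_ofNat]
    field_simp
  rw [this]
  have := Complex.normSq_pos.2 h0
  positivity

lemma integrable_heatKernel (hd : 0 < d.re) : Integrable (heatKernel d) :=
  (integrable_cexp_neg_mul_sq (re_inv_four_mul_pos hd)).const_mul _

lemma integral_heatKernel (hd : 0 < d.re) : ∫ w, heatKernel d w = 1 := by
  have h0 : d ≠ 0 := by rintro rfl; simp at hd
  unfold heatKernel
  rw [integral_const_mul, integral_gaussian_complex (re_inv_four_mul_pos hd)]
  have : (Real.pi : ℂ) / (1 / (4 * d)) = 4 * Real.pi * d := by field_simp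
  rw [this, ← Complex.cpow_add _ _ (by simp [h0, Real.pi_ne_zero])]
  simp

/-- The constant in the maximum estimate `|heatAvg d f| ≤ kernelMass d * sup |f|`. -/
def kernelMass (d : ℂ) : ℝ := ∫ w, ‖heatKernel d w‖

lemma kernelMass_nonneg : 0 ≤ kernelMass d := integral_nonneg fun _ => norm_nonneg _

end Kernel

section Avg

variable {d : ℂ} {f : ℝ → ℂ} {M : ℝ}

lemma heatFlow_eq_heatAvg (hd : 0 < d.re) (f : ℝ → ℂ) (x : ℝ) {s : ℝ} (hs : 0 < s) :
    heatFlow d f x s = heatAvg d f x s := by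
  have hr : 0 < Real.sqrt s := Real.sqrt_pos.2 hs
  have hd0 : d ≠ 0 := by rintro rfl; simp at hd
  have hpow : (4 * (Real.pi : ℂ) * d * (s : ℂ)) ^ (-(1 / 2) : ℂ)
      = (4 * (Real.pi : ℂ) * d) ^ (-(1 / 2) : ℂ) * (((Real.sqrt s)⁻¹ : ℝ) : ℂ) := by
    have hb : 4 * (Real.pi : ℂ) * d ≠ 0 := by simp [hd0, Real.pi_ne_zero]
    have hs0 : (s : ℂ) ≠ 0 := by exact_mod_cast hs.ne'
    have hinv : (Real.sqrt s)⁻¹ = Real.exp (-(1 / 2) * Real.log s) := by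
      rw [← Real.exp_log (inv_pos.2 hr), Real.log_inv, Real.log_sqrt hs.le]
      ring_nf
    rw [Complex.cpow_def_of_ne_zero (mul_ne_zero hb hs0), Complex.cpow_def_of_ne_zero hb,
      mul_comm _ (s : ℂ), Complex.log_ofReal_mul hs hb, hinv, Complex.ofReal_exp, ← Complex.exp_add]
    congr 1
    push_cast
    ring
  unfold heatFlow heatAvg heatKernel
  have h1 := integral_add_left_eq_self (μ := volume)
    (fun y : ℝ => Complex.exp (-((x : ℂ) - (y : ℂ)) ^ 2 / (4 * d * (s : ℂ))) * f y) x
  have h2 := Measure.integral_comp_mul_left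
    (fun y : ℝ => Complex.exp (-((x : ℂ) - ((x + y : ℝ) : ℂ)) ^ 2 / (4 * d * (s : ℂ))) * f (x + y))
    (Real.sqrt s)
  rw [hpow, ← h1, mul_assoc]
  rw [abs_of_pos (inv_pos.2 hr), Complex.real_smul] at h2
  rw [← h2, ← integral_const_mul]
  congr 1
  ext w
  have hss : (s : ℂ) = (Real.sqrt s : ℂ) ^ 2 := by
    rw [← Complex.ofReal_pow, Real.sq_sqrt hs.le]
  have hr' : (Real.sqrt s : ℂ) ≠ 0 := by exact_mod_cast hr.ne'
  have hexp : -((x : ℂ) - ((x + Real.sqrt s * w : ℝ) : ℂ)) ^ 2 / (4 * d * (s : ℂ))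
      = -(1 / (4 * d)) * (w : ℂ) ^ 2 := by
    rw [hss]
    push_cast
    field_simp
    ring
  rw [hexp]
  ring

lemma integrable_heatKernel_mul (hd : 0 < d.re) (hf : Continuous f) (hM : ∀ x, ‖f x‖ ≤ M)
    (x s : ℝ) : Integrable fun w : ℝ => heatKernel d w * f (x + Real.sqrt s * w) := by
  refine (integrable_heatKernel hd).mul_bdd (c := M) ?_ (ae_of_all _ fun w => hM _)
  exact (by fun_prop : Continuous fun w : ℝ => f (x + Real.sqrt s * w)).aestronglyMeasurable

lemma norm_heatAvg_le (hd : 0 < d.re) (hM : ∀ x, ‖f x‖ ≤ M) (x s : ℝ) :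
    ‖heatAvg d f x s‖ ≤ kernelMass d * M := by
  unfold heatAvg kernelMass
  rw [← integral_mul_const]
  refine norm_integral_le_of_norm_le ((integrable_heatKernel hd).norm.mul_const M)
    (ae_of_all _ fun w => ?_)
  rw [norm_mul]
  gcongr
  exact hM _

lemma heatAvg_zero (hd : 0 < d.re) (f : ℝ → ℂ) (x : ℝ) : heatAvg d f x 0 = f x := by
  simp [heatAvg, integral_mul_const, integral_heatKernel hd]

lemma continuous_heatAvg (hd : 0 < d.re) (hf : Continuous f) (hM : ∀ x, ‖f x‖ ≤ M) :
    Continuous fun p : ℝ × ℝ => heatAvg d f p.1 p.2 := by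
  refine continuous_of_dominated (bound := fun w => ‖heatKernel d w‖ * M)
    (fun p => (integrable_heatKernel_mul hd hf hM p.1 p.2).aestronglyMeasurable)
    (fun p => ae_of_all _ fun w => ?_) ((integrable_heatKernel hd).norm.mul_const M)
    (ae_of_all _ fun w => by fun_prop)
  rw [norm_mul]
  gcongr
  exact hM _

lemma hasDerivAt_heatAvg {f' : ℝ → ℂ} {M' : ℝ} (hd : 0 < d.re) (hM : ∀ x, ‖f x‖ ≤ M)
    (hf : ∀ x, HasDerivAt f (f' x) x) (hf' : Continuous f') (hM' : ∀ x, ‖f' x‖ ≤ M') (x s : ℝ) :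
    HasDerivAt (fun y => heatAvg d f y s) (heatAvg d f' x s) x := by
  have hfc : Continuous f := continuous_iff_continuousAt.2 fun x => (hf x).continuousAt
  refine (hasDerivAt_integral_of_dominated_loc_of_deriv_le (bound := fun w => ‖heatKernel d w‖ * M')
    (F' := fun y w => heatKernel d w * f' (y + Real.sqrt s * w)) univ_mem
    (Eventually.of_forall fun y => (integrable_heatKernel_mul hd hfc hM y s).aestronglyMeasurable)
    (integrable_heatKernel_mul hd hfc hM x s)
    (integrable_heatKernel_mul hd hf' hM' x s).aestronglyMeasurable
    (ae_of_all _ fun w y _ => ?_) ((integrable_heatKernel hd).norm.mul_const M')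
    (ae_of_all _ fun w y _ => ?_)).2
  · rw [norm_mul]
    gcongr
    exact hM' _
  · exact ((hf _).comp_add_const y (Real.sqrt s * w)).const_mul _

end Avg

/-! ### The heat equation -/

lemma contDiff_two_of_hasDerivAt {u u₁ u₂ : ℝ → ℂ} (h₁ : ∀ x, HasDerivAt u (u₁ x) x)
    (h₂ : ∀ x, HasDerivAt u₁ (u₂ x) x) (hc : Continuous u₂) :
    ContDiff ℝ 2 u ∧ iteratedDeriv 2 u = u₂ := by
  have e₁ : deriv u = u₁ := funext fun x => (h₁ x).deriv
  have e₂ : deriv u₁ = u₂ := funext fun x => (h₂ x).deriv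
  constructor
  · rw [show (2 : WithTop ℕ∞) = 1 + 1 by norm_num, contDiff_succ_iff_deriv]
    refine ⟨fun x => (h₁ x).differentiableAt, by simp, ?_⟩
    rw [e₁, contDiff_one_iff_deriv, e₂]
    exact ⟨fun x => (h₂ x).differentiableAt, hc⟩
  · rw [iteratedDeriv_succ, iteratedDeriv_one, e₁, e₂]

/-- The `n`-th Gaussian moment `∫ (x - y)^n exp (-a (x - y)²) f y dy` of `f` about `x`. -/
def gaussMoment (f : ℝ → ℂ) (n : ℕ) (a : ℂ) (x : ℝ) : ℂ :=
  ∫ y : ℝ, ((x - y : ℝ) : ℂ) ^ n * Complex.exp (-a * ((x - y : ℝ) : ℂ) ^ 2) * f y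

/-- A Gaussian bound, locally uniform in the position and in the parameter, that dominates the
derivatives of the heat kernel. -/
lemma norm_pow_mul_cexp_le {b : ℝ} (hb : 0 < b) (n : ℕ) : ∃ C : ℝ, 0 ≤ C ∧
    ∀ (a : ℂ) (x₀ x y : ℝ), b ≤ a.re → |x - x₀| ≤ 1 →
      ‖((x - y : ℝ) : ℂ) ^ n * Complex.exp (-a * ((x - y : ℝ) : ℂ) ^ 2)‖
        ≤ C * Real.exp (-(b / 4) * (y - x₀) ^ 2) := by
  refine ⟨(1 + (2 / b) ^ n * n.factorial) * Real.exp (b / 2), by positivity, ?_⟩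
  intro a x₀ x y ha hx
  set u := x - y with hu
  have h1 : ‖Complex.exp (-a * (u : ℂ) ^ 2)‖ ≤ Real.exp (-b * u ^ 2) := by
    rw [norm_cexp_neg_mul_sq]
    gcongr
  have h2 : |u| ^ n ≤ (1 + (2 / b) ^ n * n.factorial) * Real.exp (b / 2 * u ^ 2) := by
    have h3 := Real.pow_div_factorial_le_exp (b / 2 * u ^ 2) (by positivity) n
    have h4 : (u ^ 2) ^ n ≤ (2 / b) ^ n * n.factorial * Real.exp (b / 2 * u ^ 2) := by
      rw [div_le_iff₀ (by positivity)] at h3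
      calc (u ^ 2) ^ n = (2 / b) ^ n * (b / 2 * u ^ 2) ^ n := by
            rw [← mul_pow]; congr 1; field_simp
        _ ≤ (2 / b) ^ n * (Real.exp (b / 2 * u ^ 2) * n.factorial) := by gcongr
        _ = _ := by ring
    have h5 : |u| ^ n ≤ 1 + (u ^ 2) ^ n := by
      rw [← sq_abs, ← pow_mul, mul_comm 2 n, pow_mul]
      nlinarith [sq_nonneg (|u| ^ n - 1), sq_nonneg (|u| ^ n)]
    have h6 : 1 ≤ Real.exp (b / 2 * u ^ 2) := Real.one_le_exp (by positivity)
    nlinarith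
  have h7 : Real.exp (b / 2 * u ^ 2) * Real.exp (-b * u ^ 2)
      ≤ Real.exp (b / 2) * Real.exp (-(b / 4) * (y - x₀) ^ 2) := by
    rw [← Real.exp_add, ← Real.exp_add, Real.exp_le_exp]
    have h8 : (x - x₀) ^ 2 ≤ 1 := by rw [← sq_abs]; nlinarith [abs_nonneg (x - x₀)]
    have h9 : (y - x₀) ^ 2 ≤ 2 * u ^ 2 + 2 := by
      nlinarith [sq_nonneg ((x - x₀) + u)]
    nlinarith
  rw [norm_mul, norm_pow, Complex.norm_real, Real.norm_eq_abs]
  calc |u| ^ n * ‖Complex.exp (-a * (u : ℂ) ^ 2)‖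
      ≤ ((1 + (2 / b) ^ n * n.factorial) * Real.exp (b / 2 * u ^ 2)) * Real.exp (-b * u ^ 2) := by
        gcongr
    _ = (1 + (2 / b) ^ n * n.factorial) * (Real.exp (b / 2 * u ^ 2) * Real.exp (-b * u ^ 2)) := by
        ring
    _ ≤ (1 + (2 / b) ^ n * n.factorial) *
          (Real.exp (b / 2) * Real.exp (-(b / 4) * (y - x₀) ^ 2)) := by gcongr
    _ = _ := by ring

section Moments

variable {d : ℂ} {f : ℝ → ℂ} {M : ℝ}

lemma integrable_gauss_sub {b : ℝ} (hb : 0 < b) (x₀ : ℝ) :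
    Integrable fun y : ℝ => Real.exp (-b * (y - x₀) ^ 2) :=
  (integrable_exp_neg_mul_sq hb).comp_sub_right x₀

lemma integrable_gaussMoment (hf : Continuous f) (hM : ∀ x, ‖f x‖ ≤ M) (n : ℕ) {a : ℂ}
    (ha : 0 < a.re) (x : ℝ) : Integrable fun y : ℝ =>
      ((x - y : ℝ) : ℂ) ^ n * Complex.exp (-a * ((x - y : ℝ) : ℂ) ^ 2) * f y := by
  obtain ⟨C, hC, h⟩ := norm_pow_mul_cexp_le ha n
  refine Integrable.mul_bdd (c := M) ?_ hf.aestronglyMeasurable (ae_of_all _ hM)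
  refine Integrable.mono' ((integrable_gauss_sub (b := a.re / 4) (by positivity) x).const_mul C)
    (by fun_prop) (ae_of_all _ fun y => h a x x y le_rfl (by simp))

lemma hasDerivAt_gaussMoment (hf : Continuous f) (hM : ∀ x, ‖f x‖ ≤ M) (n : ℕ) {a : ℂ}
    (ha : 0 < a.re) (x : ℝ) :
    HasDerivAt (gaussMoment f n a)
      (n * gaussMoment f (n - 1) a x - 2 * a * gaussMoment f (n + 1) a x) x := by
  obtain ⟨C₁, hC₁, h₁⟩ := norm_pow_mul_cexp_le ha (n - 1)
  obtain ⟨C₂, hC₂, h₂⟩ := norm_pow_mul_cexp_le ha (n + 1)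
  have hM0 : 0 ≤ M := (norm_nonneg _).trans (hM 0)
  have hi := fun k => integrable_gaussMoment hf hM k ha x
  have key := hasDerivAt_integral_of_dominated_loc_of_deriv_le (μ := volume) (x₀ := x)
    (F := fun (x : ℝ) (y : ℝ) =>
      ((x - y : ℝ) : ℂ) ^ n * Complex.exp (-a * ((x - y : ℝ) : ℂ) ^ 2) * f y)
    (F' := fun (x : ℝ) (y : ℝ) =>
      (n : ℂ) * (((x - y : ℝ) : ℂ) ^ (n - 1) * Complex.exp (-a * ((x - y : ℝ) : ℂ) ^ 2) * f y)
      - 2 * a * (((x - y : ℝ) : ℂ) ^ (n + 1) * Complex.exp (-a * ((x - y : ℝ) : ℂ) ^ 2) * f y))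
    (bound := fun y => (n * (C₁ * M) + ‖2 * a‖ * (C₂ * M)) * Real.exp (-(a.re / 4) * (y - x) ^ 2))
    (Metric.closedBall_mem_nhds x one_pos)
    (Eventually.of_forall fun y => (integrable_gaussMoment hf hM n ha y).aestronglyMeasurable)
    (hi n) (by fun_prop) (ae_of_all _ fun y z hz => ?_)
    ((integrable_gauss_sub (by positivity) x).const_mul _) (ae_of_all _ fun y z _ => ?_)
  · have := key.2
    rw [integral_sub ((hi _).const_mul _) ((hi _).const_mul _), integral_const_mul,
      integral_const_mul] at this
    exact this
  · have hz' : |z - x| ≤ 1 := by simpa [Real.dist_eq] using hz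
    have e1 := h₁ a x z y le_rfl hz'
    have e2 := h₂ a x z y le_rfl hz'
    set E := Real.exp (-(a.re / 4) * (y - x) ^ 2)
    refine (norm_sub_le _ _).trans ?_
    rw [norm_mul, norm_mul (2 * a), norm_mul (_ * _) (f y), norm_mul (_ * _) (f y),
      Complex.norm_natCast]
    calc _ ≤ n * ((C₁ * E) * M) + ‖2 * a‖ * ((C₂ * E) * M) := by
          gcongr
          · exact hM y
          · exact hM y
      _ = _ := by ring
  · have hg : HasDerivAt (fun z : ℝ => ((z - y : ℝ) : ℂ)) 1 z := by
      have := ((hasDerivAt_id z).sub_const y).ofReal_comp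
      simpa using this
    convert! ((hg.fun_pow n).mul (((hg.fun_pow 2).const_mul (-a)).cexp)).mul_const (f y) using 1
    simp only [Nat.cast_ofNat]
    ring

lemma hasDerivAt_gaussMoment_param (hf : Continuous f) (hM : ∀ x, ‖f x‖ ≤ M) (n : ℕ) {a : ℂ}
    (ha : 0 < a.re) (x : ℝ) :
    HasDerivAt (fun a => gaussMoment f n a x) (-gaussMoment f (n + 2) a x) a := by
  obtain ⟨C, hC, h⟩ := norm_pow_mul_cexp_le (half_pos ha) (n + 2)
  have hM0 : 0 ≤ M := (norm_nonneg _).trans (hM 0)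
  have hnb : {c : ℂ | a.re / 2 < c.re} ∈ 𝓝 a :=
    (isOpen_lt continuous_const Complex.continuous_re).mem_nhds (by simpa using ha)
  have key := hasDerivAt_integral_of_dominated_loc_of_deriv_le (μ := volume) (x₀ := a)
    (F := fun (a : ℂ) (y : ℝ) =>
      ((x - y : ℝ) : ℂ) ^ n * Complex.exp (-a * ((x - y : ℝ) : ℂ) ^ 2) * f y)
    (F' := fun (a : ℂ) (y : ℝ) =>
      -(((x - y : ℝ) : ℂ) ^ (n + 2) * Complex.exp (-a * ((x - y : ℝ) : ℂ) ^ 2) * f y))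
    (bound := fun y => (C * M) * Real.exp (-(a.re / 2 / 4) * (y - x) ^ 2))
    hnb
    (Filter.mem_of_superset hnb fun c hc => (integrable_gaussMoment hf hM n
      (by have : a.re / 2 < c.re := hc
          linarith) x).aestronglyMeasurable)
    (integrable_gaussMoment hf hM n ha x) (by fun_prop) (ae_of_all _ fun y c hc => ?_)
    ((integrable_gauss_sub (by positivity) x).const_mul _) (ae_of_all _ fun y c _ => ?_)
  · have := key.2
    rw [integral_neg] at this
    exact this
  · have e := h c x x y (le_of_lt hc) (by simp)
    rw [norm_neg, norm_mul]
    calc _ ≤ (C * Real.exp (-(a.re / 2 / 4) * (y - x) ^ 2)) * M := by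
          gcongr
          exact hM y
      _ = _ := by ring
  · convert! ((((hasDerivAt_id c).neg.mul_const (((x - y : ℝ) : ℂ) ^ 2)).cexp).const_mul
      (((x - y : ℝ) : ℂ) ^ n)).mul_const (f y) using 1
    simp only [Pi.neg_apply, id]
    ring

lemma heatFlow_eq_gaussMoment (f : ℝ → ℂ) (x s : ℝ) :
    heatFlow d f x s =
      (4 * (Real.pi : ℂ) * d * (s : ℂ)) ^ (-(1 / 2) : ℂ) * gaussMoment f 0 (1 / (4 * d * s)) x := by
  unfold heatFlow gaussMoment
  congr 2
  ext y
  rw [pow_zero, one_mul]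
  congr 2
  push_cast
  ring

/-- The heat flow of bounded continuous data is `C²` in space and solves `u_s = d u_xx`. -/
lemma heatFlow_heat_equation (hd : 0 < d.re) (hf : Continuous f) (hM : ∀ x, ‖f x‖ ≤ M) {s : ℝ}
    (hs : 0 < s) :
    ContDiff ℝ 2 (fun x => heatFlow d f x s) ∧
    ∀ x, HasDerivAt (fun s => heatFlow d f x s)
      (d * iteratedDeriv 2 (fun y => heatFlow d f y s) x) s := by
  have hd0 : d ≠ 0 := by rintro rfl; simp at hd
  have hs0 : (s : ℂ) ≠ 0 := by exact_mod_cast hs.ne'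
  have ha : 0 < (1 / (4 * d * s)).re := by
    rw [mul_assoc]
    exact re_inv_four_mul_pos (by simpa using mul_pos hd hs)
  set a : ℂ := 1 / (4 * d * s) with hadef
  set c : ℂ := (4 * (Real.pi : ℂ) * d * (s : ℂ)) ^ (-(1 / 2) : ℂ) with hc
  have h0 := fun x => (hasDerivAt_gaussMoment hf hM 0 ha x).const_mul c
  have h1 := fun x => (hasDerivAt_gaussMoment hf hM 1 ha x).const_mul (c * (-2 * a))
  have hcont : ∀ n, Continuous (gaussMoment f n a) := fun n =>
    continuous_iff_continuousAt.2 fun x => (hasDerivAt_gaussMoment hf hM n ha x).continuousAt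
  have hu : (fun x => heatFlow d f x s) = fun x => c * gaussMoment f 0 a x :=
    funext fun x => heatFlow_eq_gaussMoment f x s
  obtain ⟨r1, r2⟩ := contDiff_two_of_hasDerivAt
    (u := fun x => c * gaussMoment f 0 a x)
    (u₁ := fun x => c * (-2 * a) * gaussMoment f 1 a x)
    (u₂ := fun x => c * (-2 * a) * (gaussMoment f 0 a x - 2 * a * gaussMoment f 2 a x))
    (fun x => by convert! h0 x using 1; push_cast; ring)
    (fun x => by convert! h1 x using 1; push_cast; ring)
    (((hcont 0).sub ((hcont 2).const_mul _)).const_mul _)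
  rw [hu, r2]
  refine ⟨r1, fun x => ?_⟩
  have hp : HasDerivAt (fun s : ℝ => (4 * (Real.pi : ℂ) * d * (s : ℂ)) ^ (-(1 / 2) : ℂ))
      (-c / (2 * s)) s := by
    have hre : 0 < (4 * (Real.pi : ℂ) * d * (s : ℂ)).re := by
      have : (4 * (Real.pi : ℂ) * d * (s : ℂ)).re = 4 * Real.pi * d.re * s := by
        simp
      rw [this]
      positivity
    have hne : 4 * (Real.pi : ℂ) * d * (s : ℂ) ≠ 0 := fun h => by simp [h] at hre
    have hlin : HasDerivAt (fun s : ℂ => 4 * (Real.pi : ℂ) * d * s) (4 * (Real.pi : ℂ) * d) s := by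
      simpa using (hasDerivAt_id (s : ℂ)).const_mul (4 * (Real.pi : ℂ) * d)
    have := (hlin.cpow_const (c := (-(1 / 2) : ℂ)) (Or.inl hre)).comp_ofReal
    convert! this using 1
    rw [Complex.cpow_sub _ _ hne, Complex.cpow_one, ← hc]
    field_simp
  have hq : HasDerivAt (fun s : ℝ => (1 : ℂ) / (4 * d * s)) (-a / s) s := by
    have hlin : HasDerivAt (fun s : ℝ => 4 * d * (s : ℂ)) (4 * d) s := by
      simpa using (Complex.ofRealCLM.hasDerivAt (x := s)).const_mul (4 * d)
    have := (hasDerivAt_const s (1 : ℂ)).div hlin (by simp [hd0, hs0])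
    convert! this using 1
    rw [hadef]
    field_simp
    ring
  have hm := (hasDerivAt_gaussMoment_param hf hM 0 ha x).scomp s hq
  have := hp.mul hm
  convert! this using 1
  · ext s; exact heatFlow_eq_gaussMoment f x s
  · simp only [Function.comp, smul_eq_mul, ← hadef, ← hc]
    have : a * d = 1 / (4 * s) := by rw [hadef]; field_simp
    have h4 : d * (c * (-2 * a) * (gaussMoment f 0 a x - 2 * a * gaussMoment f 2 a x))
       = c * (-2 * (a * d)) * (gaussMoment f 0 a x - 2 * a * gaussMoment f 2 a x) := by ring
    rw [h4, this]
    field_simp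
    ring

end Moments

/-! ### Derivative towers, Taylor expansion of the heat flow, Duhamel integrals -/

/-- `φ k` is the `k`-th derivative of `φ 0`, and it is bounded by `M k`. -/
structure IsDerivTower (φ : ℕ → ℝ → ℂ) (M : ℕ → ℝ) : Prop where
  hasDerivAt : ∀ k x, HasDerivAt (φ k) (φ (k + 1) x) x
  bound : ∀ k x, ‖φ k x‖ ≤ M k

namespace IsDerivTower

variable {φ : ℕ → ℝ → ℂ} {M : ℕ → ℝ} {d : ℂ}

lemma continuous (h : IsDerivTower φ M) (k : ℕ) : Continuous (φ k) :=
  continuous_iff_continuousAt.2 fun x => (h.hasDerivAt k x).continuousAt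

lemma nonneg (h : IsDerivTower φ M) (k : ℕ) : 0 ≤ M k :=
  (norm_nonneg _).trans (h.bound k 0)

lemma continuous_heatAvg (h : IsDerivTower φ M) (hd : 0 < d.re) (k : ℕ) :
    Continuous fun p : ℝ × ℝ => heatAvg d (φ k) p.1 p.2 :=
  LinCGL.continuous_heatAvg hd (h.continuous k) (h.bound k)

lemma continuous_heatAvg_right (h : IsDerivTower φ M) (hd : 0 < d.re) (k : ℕ) (x : ℝ) :
    Continuous fun s : ℝ => heatAvg d (φ k) x s :=
  (h.continuous_heatAvg hd k).comp (by fun_prop : Continuous fun s : ℝ => (x, s))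

lemma hasDerivAt_heatAvg_left (h : IsDerivTower φ M) (hd : 0 < d.re) (k : ℕ) (x s : ℝ) :
    HasDerivAt (fun y => heatAvg d (φ k) y s) (heatAvg d (φ (k + 1)) x s) x :=
  LinCGL.hasDerivAt_heatAvg hd (h.bound k) (h.hasDerivAt k) (h.continuous (k + 1))
    (h.bound (k + 1)) x s

lemma hasDerivAt_heatAvg_right (h : IsDerivTower φ M) (hd : 0 < d.re) (k : ℕ) (x : ℝ) {s : ℝ}
    (hs : 0 < s) :
    HasDerivAt (fun s => heatAvg d (φ k) x s) (d * heatAvg d (φ (k + 2)) x s) s := by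
  have h1 := (heatFlow_heat_equation hd (h.continuous k) (h.bound k) hs).2 x
  have h2 : (fun y => heatFlow d (φ k) y s) = fun y => heatAvg d (φ k) y s :=
    funext fun y => heatFlow_eq_heatAvg hd _ y hs
  rw [h2, (contDiff_two_of_hasDerivAt (fun y => h.hasDerivAt_heatAvg_left hd k y s)
    (fun y => h.hasDerivAt_heatAvg_left hd (k + 1) y s)
    ((h.continuous_heatAvg hd (k + 2)).comp (by fun_prop : Continuous fun y : ℝ => (y, s)))).2] at h1
  refine h1.congr_of_eventuallyEq ?_
  filter_upwards [lt_mem_nhds hs] with r hr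
  exact (heatFlow_eq_heatAvg hd _ x hr).symm

lemma heatAvg_sub_heatAvg_le (h : IsDerivTower φ M) (hd : 0 < d.re) (k : ℕ) (x : ℝ) {s t : ℝ}
    (hs : 0 ≤ s) (ht : 0 ≤ t) :
    ‖heatAvg d (φ k) x t - heatAvg d (φ k) x s‖
      ≤ ‖d‖ * (kernelMass d * M (k + 2)) * |t - s| := by
  wlog hst : s ≤ t generalizing s t
  · rw [norm_sub_rev, abs_sub_comm]
    exact this ht hs (le_of_not_ge hst)
  have h1 := intervalIntegral.integral_eq_sub_of_hasDerivAt_of_le hst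
    (h.continuous_heatAvg_right hd k x).continuousOn
    (fun r hr => h.hasDerivAt_heatAvg_right hd k x (hs.trans_lt hr.1))
    (((h.continuous_heatAvg_right hd (k + 2) x).const_mul d).intervalIntegrable _ _)
  rw [← h1]
  refine intervalIntegral.norm_integral_le_of_norm_le_const fun r _ => ?_
  rw [norm_mul]
  gcongr
  exact norm_heatAvg_le hd (h.bound _) x r

/-- Taylor's formula in time for the heat flow, with a remainder uniform in space. -/
lemma heatAvg_taylor (h : IsDerivTower φ M) (hd : 0 < d.re) (n k : ℕ) (x : ℝ) {s : ℝ}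
    (hs : 0 ≤ s) :
    ‖heatAvg d (φ k) x s - ∑ j ∈ Finset.range n, (d * s) ^ j / (j.factorial : ℂ) * φ (k + 2 * j) x‖
      ≤ kernelMass d * M (k + 2 * n) * (‖d‖ * s) ^ n := by
  induction n generalizing k s with
  | zero => simpa using norm_heatAvg_le hd (h.bound k) x s
  | succ n ih =>
    have hpoly : ∀ r : ℝ, HasDerivAt (fun r : ℝ => ∑ j ∈ Finset.range (n + 1),
        (d * r) ^ j / (j.factorial : ℂ) * φ (k + 2 * j) x)
        (d * ∑ j ∈ Finset.range n, (d * r) ^ j / (j.factorial : ℂ) * φ (k + 2 + 2 * j) x) r := by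
      intro r
      have hlin : HasDerivAt (fun r : ℝ => d * (r : ℂ)) d r := by
        simpa using (Complex.ofRealCLM.hasDerivAt (x := r)).const_mul d
      have := HasDerivAt.fun_sum (u := Finset.range (n + 1)) fun j _ =>
        (((hlin.fun_pow j).div_const (j.factorial : ℂ)).mul_const (φ (k + 2 * j) x))
      convert! this using 1
      rw [Finset.sum_range_succ', Finset.mul_sum]
      simp only [Nat.cast_zero, zero_mul, zero_div, add_zero]
      refine Finset.sum_congr rfl fun j _ => ?_
      have hj : (j.factorial : ℂ) ≠ 0 := by exact_mod_cast j.factorial_ne_zero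
      have hj1 : ((j : ℂ) + 1) ≠ 0 := by exact_mod_cast j.succ_ne_zero
      rw [Nat.factorial_succ, show k + 2 * (j + 1) = k + 2 + 2 * j by ring, Nat.add_sub_cancel]
      push_cast
      field_simp
    have h1 := intervalIntegral.integral_eq_sub_of_hasDerivAt_of_le hs
      (f := fun r : ℝ => heatAvg d (φ k) x r -
        ∑ j ∈ Finset.range (n + 1), (d * r) ^ j / (j.factorial : ℂ) * φ (k + 2 * j) x)
      (f' := fun r : ℝ => d * heatAvg d (φ (k + 2)) x r -
        d * ∑ j ∈ Finset.range n, (d * r) ^ j / (j.factorial : ℂ) * φ (k + 2 + 2 * j) x)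
      ((h.continuous_heatAvg_right hd k x).sub (by fun_prop)).continuousOn
      (fun r hr => (h.hasDerivAt_heatAvg_right hd k x hr.1).sub (hpoly r))
      ((((h.continuous_heatAvg_right hd (k + 2) x).const_mul d).sub
        (by fun_prop)).intervalIntegrable _ _)
    have h0 : heatAvg d (φ k) x 0 - ∑ j ∈ Finset.range (n + 1),
        (d * ((0 : ℝ) : ℂ)) ^ j / (j.factorial : ℂ) * φ (k + 2 * j) x = 0 := by
      rw [heatAvg_zero hd, Finset.sum_range_succ']
      simp
    simp only [h0, sub_zero] at h1
    rw [← h1]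
    have h2 := intervalIntegral.norm_integral_le_of_norm_le_const (a := 0) (b := s)
      (f := fun r : ℝ => d * heatAvg d (φ (k + 2)) x r -
        d * ∑ j ∈ Finset.range n, (d * r) ^ j / (j.factorial : ℂ) * φ (k + 2 + 2 * j) x)
      (C := ‖d‖ * (kernelMass d * M (k + 2 + 2 * n) * (‖d‖ * s) ^ n)) (fun r hr => ?_)
    · refine h2.trans (le_of_eq ?_)
      rw [sub_zero, abs_of_nonneg hs, show k + 2 * (n + 1) = k + 2 + 2 * n by ring]
      ring
    · rw [uIoc_of_le hs] at hr
      rw [← mul_sub, norm_mul]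
      have h3 := ih (k + 2) hr.1.le
      have h4 : kernelMass d * M (k + 2 + 2 * n) * (‖d‖ * r) ^ n
          ≤ kernelMass d * M (k + 2 + 2 * n) * (‖d‖ * s) ^ n := by
        have := h.nonneg (k + 2 + 2 * n)
        have := kernelMass_nonneg (d := d)
        have := hr.1.le
        have := hr.2
        gcongr
      gcongr
      exact h3.trans h4

end IsDerivTower

/-- The Duhamel integral `∫_{μ₀}^μ (heat flow of f at time μ - m) E(m) dm`. -/
def duhamel (d : ℂ) (E : ℝ → ℂ) (μ₀ : ℝ) (f : ℝ → ℂ) (x μ : ℝ) : ℂ :=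
  ∫ m in μ₀..μ, heatAvg d f x (μ - m) * E m

section Duhamel

variable {φ : ℕ → ℝ → ℂ} {M : ℕ → ℝ} {d : ℂ} {E : ℝ → ℂ} {μ₀ : ℝ}

lemma norm_duhamel_le {f : ℝ → ℂ} {K C : ℝ} (hd : 0 < d.re) (hf : ∀ x, ‖f x‖ ≤ K) {μ : ℝ}
    (hμ : μ₀ ≤ μ) (hC : ∀ m ∈ Icc μ₀ μ, ‖E m‖ ≤ C) (x : ℝ) :
    ‖duhamel d E μ₀ f x μ‖ ≤ kernelMass d * K * C * (μ - μ₀) := by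
  have h := intervalIntegral.norm_integral_le_of_norm_le_const (a := μ₀) (b := μ)
    (f := fun m => heatAvg d f x (μ - m) * E m) (C := kernelMass d * K * C) (fun m hm => ?_)
  · rwa [abs_of_nonneg (sub_nonneg.2 hμ)] at h
  · rw [uIoc_of_le hμ] at hm
    rw [norm_mul]
    have h1 := norm_heatAvg_le hd hf x (μ - m)
    have h2 := hC m ⟨hm.1.le, hm.2⟩
    gcongr
    exact (norm_nonneg _).trans h1

lemma hasDerivAt_duhamel_left (h : IsDerivTower φ M) (hd : 0 < d.re) (hE : Continuous E) (k : ℕ)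
    (x μ : ℝ) :
    HasDerivAt (fun y => duhamel d E μ₀ (φ k) y μ) (duhamel d E μ₀ (φ (k + 1)) x μ) x := by
  have hc : ∀ k x, Continuous fun m : ℝ => heatAvg d (φ k) x (μ - m) * E m := fun k x =>
    ((h.continuous_heatAvg_right hd k x).comp (by fun_prop : Continuous fun m => μ - m)).mul hE
  refine (intervalIntegral.hasDerivAt_integral_of_dominated_loc_of_deriv_le
    (F := fun y m => heatAvg d (φ k) y (μ - m) * E m)
    (F' := fun y m => heatAvg d (φ (k + 1)) y (μ - m) * E m)
    (bound := fun m => kernelMass d * M (k + 1) * ‖E m‖) univ_mem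
    (Eventually.of_forall fun y => (hc k y).aestronglyMeasurable)
    ((hc k x).intervalIntegrable _ _) (hc (k + 1) x).aestronglyMeasurable
    (ae_of_all _ fun m _ y _ => ?_) ((by fun_prop : Continuous _).intervalIntegrable _ _)
    (ae_of_all _ fun m _ y _ => (h.hasDerivAt_heatAvg_left hd k y _).mul_const _)).2
  rw [norm_mul]
  gcongr
  exact norm_heatAvg_le hd (h.bound _) y _

/-- Differentiation of the Duhamel integral in its upper limit. Subtracting the value at time zero
makes the heat flow, extended by a constant to negative times, Lipschitz, so that the limit of
integration can be fixed beyond the point of differentiation. -/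
lemma hasDerivAt_duhamel_right (h : IsDerivTower φ M) (hd : 0 < d.re) (hE : Continuous E) (k : ℕ)
    (x : ℝ) {μ : ℝ} (hμ : μ₀ < μ) :
    HasDerivAt (fun μ => duhamel d E μ₀ (φ k) x μ)
      (φ k x * E μ + d * duhamel d E μ₀ (φ (k + 2)) x μ) μ := by
  set B := μ + 1 with hB
  set G : ℝ → ℂ := fun s => heatAvg d (φ k) x (max s 0) - φ k x with hG
  have hGc : Continuous G := ((h.continuous_heatAvg_right hd k x).comp
    (by fun_prop : Continuous fun s : ℝ => max s 0)).sub continuous_const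
  have hG0 : ∀ s ≤ 0, G s = 0 := fun s hs => by
    simp only [hG, max_eq_right hs, heatAvg_zero hd, sub_self]
  set Lp := ‖d‖ * (kernelMass d * M (k + 2)) with hLp
  have hLp0 : 0 ≤ Lp := by
    have := h.nonneg (k + 2)
    have := kernelMass_nonneg (d := d)
    positivity
  have hGlip : ∀ s t, ‖G t - G s‖ ≤ Lp * |t - s| := fun s t => by
    have h1 := h.heatAvg_sub_heatAvg_le hd k x (le_max_right s 0) (le_max_right t 0)
    simp only [hG, sub_sub_sub_cancel_right]
    exact h1.trans (mul_le_mul_of_nonneg_left (abs_max_sub_max_le_abs t s 0) hLp0)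
  -- the integral with a fixed upper limit
  set F' : ℝ → ℂ := fun m => (if m ≤ μ then d * heatAvg d (φ (k + 2)) x (μ - m) else 0) * E m
    with hF'
  have hc2 : Continuous fun m : ℝ => d * heatAvg d (φ (k + 2)) x (μ - m) :=
    ((h.continuous_heatAvg_right hd (k + 2) x).comp
      (by fun_prop : Continuous fun m => μ - m)).const_mul d
  have hF'm : Measurable F' :=
    (Measurable.ite measurableSet_Iic hc2.measurable measurable_const).mul hE.measurable
  have key := intervalIntegral.hasDerivAt_integral_of_dominated_loc_of_lip (μ := volume)
    (a := μ₀) (b := B) (x₀ := μ) (F := fun ν m => G (ν - m) * E m) (F' := F')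
    (bound := fun m => Lp * ‖E m‖) univ_mem
    (Eventually.of_forall fun ν =>
      (by fun_prop : Continuous fun m => G (ν - m) * E m).aestronglyMeasurable)
    ((by fun_prop : Continuous fun m => G (μ - m) * E m).intervalIntegrable _ _)
    hF'm.aestronglyMeasurable
    (ae_of_all _ fun m _ => LipschitzOnWith.of_dist_le_mul fun s _ t _ => ?_)
    ((by fun_prop : Continuous fun m => Lp * ‖E m‖).intervalIntegrable _ _) ?_
  · have h1 : HasDerivAt (fun ν => φ k x * ∫ m in μ₀..ν, E m) (φ k x * E μ) μ :=
      (intervalIntegral.integral_hasDerivAt_right (hE.intervalIntegrable _ _)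
        (hE.stronglyMeasurableAtFilter _ _) hE.continuousAt).const_mul _
    have h2 := h1.add key.2
    have h3 : ∫ m in μ₀..B, F' m = d * duhamel d E μ₀ (φ (k + 2)) x μ := by
      have hi : ∀ a b, IntervalIntegrable F' volume a b := fun a b => by
        have : IntervalIntegrable (fun m => Lp * ‖E m‖) volume a b :=
          (by fun_prop : Continuous fun m => Lp * ‖E m‖).intervalIntegrable _ _
        refine this.mono_fun hF'm.aestronglyMeasurable (ae_of_all _ fun m => ?_)
        simp only [hF', norm_mul, Real.norm_eq_abs, abs_of_nonneg hLp0, abs_norm]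
        gcongr
        split_ifs
        · rw [norm_mul, hLp]
          gcongr
          exact norm_heatAvg_le hd (h.bound _) x _
        · simpa using hLp0
      rw [← intervalIntegral.integral_add_adjacent_intervals (hi μ₀ μ) (hi μ B)]
      have e1 : ∫ m in μ₀..μ, F' m = d * duhamel d E μ₀ (φ (k + 2)) x μ := by
        rw [duhamel, ← intervalIntegral.integral_const_mul]
        refine intervalIntegral.integral_congr fun m hm => ?_
        rw [uIcc_of_le hμ.le] at hm
        simp only [hF', if_pos hm.2]
        ring
      have e2 : ∫ m in μ..B, F' m = 0 := by
        refine intervalIntegral.integral_zero_ae (ae_of_all _ fun m hm => ?_)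
        rw [uIoc_of_le (by rw [hB]; linarith)] at hm
        simp only [hF', if_neg (not_le.2 hm.1), zero_mul]
      rw [e1, e2, add_zero]
    rw [h3] at h2
    refine h2.congr_of_eventuallyEq ?_
    filter_upwards [Ioo_mem_nhds hμ (by rw [hB]; linarith : μ < B)] with ν hν
    have hi : ∀ a b, IntervalIntegrable (fun m => G (ν - m) * E m) volume a b := fun a b =>
      (by fun_prop : Continuous fun m => G (ν - m) * E m).intervalIntegrable _ _
    have e2 : ∫ m in ν..B, G (ν - m) * E m = 0 := by
      refine intervalIntegral.integral_zero_ae (ae_of_all _ fun m hm => ?_)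
      rw [uIoc_of_le hν.2.le] at hm
      rw [hG0 _ (by linarith [hm.1]), zero_mul]
    simp only [Pi.add_apply]
    rw [← intervalIntegral.integral_add_adjacent_intervals (hi μ₀ ν) (hi ν B), e2, add_zero,
      ← intervalIntegral.integral_const_mul, ← intervalIntegral.integral_add
        ((hE.const_mul _).intervalIntegrable _ _) (hi _ _), duhamel]
    refine intervalIntegral.integral_congr fun m hm => ?_
    rw [uIcc_of_le hν.1.le] at hm
    simp only [hG, max_eq_left (sub_nonneg.2 hm.2)]
    ring
  · rw [Real.coe_nnabs, abs_of_nonneg (by positivity), dist_eq_norm, ← sub_mul, norm_mul,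
      Real.dist_eq]
    have := hGlip (t - m) (s - m)
    rw [show s - m - (t - m) = s - t by ring] at this
    calc _ ≤ Lp * |s - t| * ‖E m‖ := by gcongr
      _ = _ := by ring
  · filter_upwards [Measure.ae_ne volume μ] with m hm _
    refine HasDerivAt.mul_const ?_ (E m)
    rcases lt_or_gt_of_ne hm with hlt | hgt
    · simp only [if_pos hlt.le]
      have h1 := (h.hasDerivAt_heatAvg_right hd k x (sub_pos.2 hlt)).comp_sub_const μ m
      refine (h1.sub_const (φ k x)).congr_of_eventuallyEq ?_
      filter_upwards [lt_mem_nhds hlt] with ν hν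
      simp only [hG, max_eq_left (sub_pos.2 hν).le]
    · rw [if_neg (not_le.2 hgt)]
      refine (hasDerivAt_const μ (0 : ℂ)).congr_of_eventuallyEq ?_
      filter_upwards [gt_mem_nhds hgt] with ν hν
      exact hG0 _ (by linarith)

end Duhamel

/-! ### The classical solutions -/

/-- The derivatives of the source, as complex valued functions. -/
def sourceDeriv (Ia : ℝ → ℝ) (k : ℕ) (y : ℝ) : ℂ := ((iteratedDeriv k Ia y : ℝ) : ℂ)

lemma HasBoundedDerivs.exists_isDerivTower {Ia : ℝ → ℝ} (h : HasBoundedDerivs Ia) :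
    ∃ M : ℕ → ℝ, IsDerivTower (sourceDeriv Ia) M := by
  obtain ⟨h1, h2⟩ := h
  choose M hM using h2
  refine ⟨M, ⟨fun k x => ?_, fun k x => ?_⟩⟩
  · have hd : DifferentiableAt ℝ (iteratedDeriv k Ia) x :=
      (h1.differentiable_iteratedDeriv k (by exact_mod_cast ENat.natCast_lt_top k)).differentiableAt
    have := hd.hasDerivAt.ofReal_comp
    rwa [← iteratedDeriv_succ] at this
  · simpa [sourceDeriv] using hM k x

lemma sourceDeriv_zero (Ia : ℝ → ℝ) : sourceDeriv Ia 0 = fun y => (Ia y : ℂ) := by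
  ext y; simp [sourceDeriv]

/-- The exponential weight `exp ((μ + i ω₀)² / (2 ε))`. -/
def weight (ε ω₀ μ : ℝ) : ℂ := Complex.exp ((cz ω₀ μ) ^ 2 / (2 * (ε : ℂ)))

lemma continuous_cz (ω₀ : ℝ) : Continuous (cz ω₀) := by unfold cz; fun_prop

lemma hasDerivAt_cz (ω₀ μ : ℝ) : HasDerivAt (cz ω₀) 1 μ := by
  have h := (hasDerivAt_id μ).ofReal_comp.add_const ((ω₀ : ℂ) * Complex.I)
  rw [Complex.ofReal_one] at h
  exact h

lemma continuous_weight (ε ω₀ : ℝ) : Continuous (weight ε ω₀) := by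
  have := continuous_cz ω₀
  unfold weight; fun_prop

lemma weight_ne_zero (ε ω₀ μ : ℝ) : weight ε ω₀ μ ≠ 0 := Complex.exp_ne_zero _

lemma exp_neg_cz_sq (ε ω₀ μ : ℝ) :
    Complex.exp (-(cz ω₀ μ) ^ 2 / (2 * (ε : ℂ))) = (weight ε ω₀ μ)⁻¹ := by
  rw [weight, ← Complex.exp_neg, neg_div]

lemma continuous_weight_inv (ε ω₀ : ℝ) : Continuous fun μ => (weight ε ω₀ μ)⁻¹ :=
  (continuous_weight ε ω₀).inv₀ fun μ => weight_ne_zero ε ω₀ μ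

lemma hasDerivAt_weight {ε : ℝ} (hε : 0 < ε) (ω₀ μ : ℝ) :
    HasDerivAt (weight ε ω₀) (cz ω₀ μ / ε * weight ε ω₀ μ) μ := by
  have hε' : (ε : ℂ) ≠ 0 := by exact_mod_cast hε.ne'
  have := ((((hasDerivAt_cz ω₀ μ).fun_pow 2).div_const (2 * (ε : ℂ))).cexp)
  convert! this using 1
  rw [weight]
  field_simp
  push_cast
  ring

lemma intervalIntegral_heatFlow_eq {d : ℂ} (hd : 0 < d.re) (f : ℝ → ℂ) (E : ℝ → ℂ) (x : ℝ)
    {μ₀ μ : ℝ} (hμ : μ₀ ≤ μ) :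
    ∫ m in μ₀..μ, heatFlow d f x (μ - m) * E m = duhamel d E μ₀ f x μ := by
  refine intervalIntegral.integral_congr_ae ?_
  filter_upwards [Measure.ae_ne volume μ] with m hm hmem
  rw [uIoc_of_le hμ] at hmem
  rw [heatFlow_eq_heatAvg hd f x (sub_pos.2 (lt_of_le_of_ne hmem.2 hm))]

lemma Ap_eq_duhamel {d : ℂ} (hd : 0 < d.re) (ε ω₀ : ℝ) (Ia : ℝ → ℝ) (x : ℝ) {μ₀ μ : ℝ}
    (hμ : μ₀ ≤ μ) :
    Ap ε ω₀ d Ia μ₀ x μ = (1 / (Real.sqrt ε : ℂ)) *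
      duhamel d (fun m => (weight ε ω₀ m)⁻¹) μ₀ (sourceDeriv Ia 0) x μ * weight ε ω₀ μ := by
  unfold Ap Bp
  simp_rw [exp_neg_cz_sq]
  rw [intervalIntegral_heatFlow_eq hd _ _ x hμ, sourceDeriv_zero, weight]

lemma Ah_eq_heatAvg {d : ℂ} (hd : 0 < d.re) (ε ω₀ : ℝ) (A₀ : ℝ → ℂ) (x : ℝ) {μ₀ μ : ℝ}
    (hμ : μ₀ < μ) :
    Ah ε ω₀ d A₀ μ₀ x μ =
      (weight ε ω₀ μ₀)⁻¹ * heatAvg d A₀ x (μ - μ₀) * weight ε ω₀ μ := by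
  unfold Ah Bh
  rw [exp_neg_cz_sq, heatFlow_eq_heatAvg hd _ x (sub_pos.2 hμ)]
  rfl

section Solutions

variable {ε ω₀ μ₀ : ℝ} {d : ℂ} {Ia : ℝ → ℝ}

lemma IsSolution.add {Ia Ja : ℝ → ℝ} {A₀ B₀ : ℝ → ℂ} {A B : ℝ → ℝ → ℂ}
    (hA : IsSolution ε ω₀ d Ia μ₀ A₀ A) (hB : IsSolution ε ω₀ d Ja μ₀ B₀ B) :
    IsSolution ε ω₀ d (fun x => Ia x + Ja x) μ₀ (fun x => A₀ x + B₀ x)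
      (fun x μ => A x μ + B x μ) := by
  obtain ⟨a1, a2, a3, a4, a5⟩ := hA
  obtain ⟨b1, b2, b3, b4, b5⟩ := hB
  refine ⟨fun μ hμ => (a1 μ hμ).add (b1 μ hμ), fun x μ hμ => (a2 x μ hμ).add (b2 x μ hμ),
    fun x μ hμ => ?_, fun μ₁ => ?_, fun x => (a5 x).add (b5 x)⟩
  · rw [deriv_fun_add (a2 x μ hμ) (b2 x μ hμ), mul_add, a3 x μ hμ, b3 x μ hμ,
      iteratedDeriv_fun_add (a1 μ hμ).contDiffAt (b1 μ hμ).contDiffAt]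
    push_cast
    ring
  · obtain ⟨M, hM⟩ := a4 μ₁
    obtain ⟨N, hN⟩ := b4 μ₁
    exact ⟨M + N, fun x μ h1 h2 => (norm_add_le _ _).trans (add_le_add (hM x μ h1 h2) (hN x μ h1 h2))⟩

lemma isSolution_Ap (hε : 0 < ε) (hd : 0 < d.re) (hIa : HasBoundedDerivs Ia) :
    IsSolution ε ω₀ d Ia μ₀ (fun _ => 0) (Ap ε ω₀ d Ia μ₀) := by
  obtain ⟨M, hT⟩ := hIa.exists_isDerivTower
  have hε' : (ε : ℂ) ≠ 0 := by exact_mod_cast hε.ne'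
  have hs : (Real.sqrt ε : ℂ) ≠ 0 := by exact_mod_cast (Real.sqrt_pos.2 hε).ne'
  have hss : (ε : ℂ) = (Real.sqrt ε : ℂ) ^ 2 := by
    rw [← Complex.ofReal_pow, Real.sq_sqrt hε.le]
  set E : ℝ → ℂ := fun m => (weight ε ω₀ m)⁻¹ with hE
  have hEc : Continuous E := continuous_weight_inv ε ω₀
  have hxfun : ∀ μ, μ₀ < μ → (fun x => Ap ε ω₀ d Ia μ₀ x μ) = fun x =>
      1 / (Real.sqrt ε : ℂ) * duhamel d E μ₀ (sourceDeriv Ia 0) x μ * weight ε ω₀ μ :=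
    fun μ hμ => funext fun x => Ap_eq_duhamel hd ε ω₀ Ia x hμ.le
  have hspace : ∀ μ, μ₀ < μ → ContDiff ℝ 2 (fun x => Ap ε ω₀ d Ia μ₀ x μ) ∧
      iteratedDeriv 2 (fun x => Ap ε ω₀ d Ia μ₀ x μ) = fun x =>
        1 / (Real.sqrt ε : ℂ) * duhamel d E μ₀ (sourceDeriv Ia 2) x μ * weight ε ω₀ μ := by
    intro μ hμ
    rw [hxfun μ hμ]
    have hD := fun k x => ((hasDerivAt_duhamel_left (μ₀ := μ₀) hT hd hEc k x μ).const_mul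
      (1 / (Real.sqrt ε : ℂ))).mul_const (weight ε ω₀ μ)
    exact contDiff_two_of_hasDerivAt (hD 0) (hD 1)
      (continuous_iff_continuousAt.2 fun x => (hD 2 x).continuousAt)
  have htime : ∀ x μ, μ₀ < μ → HasDerivAt (fun m => Ap ε ω₀ d Ia μ₀ x m)
      (1 / (Real.sqrt ε : ℂ) * (sourceDeriv Ia 0 x * E μ +
        d * duhamel d E μ₀ (sourceDeriv Ia 2) x μ) * weight ε ω₀ μ +
        1 / (Real.sqrt ε : ℂ) * duhamel d E μ₀ (sourceDeriv Ia 0) x μ *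
          (cz ω₀ μ / ε * weight ε ω₀ μ)) μ := by
    intro x μ hμ
    refine (((hasDerivAt_duhamel_right hT hd hEc 0 x hμ).const_mul _).mul
      (hasDerivAt_weight hε ω₀ μ)).congr_of_eventuallyEq ?_
    filter_upwards [lt_mem_nhds hμ] with ν hν
    exact Ap_eq_duhamel hd ε ω₀ Ia x hν.le
  have hbound : ∀ μ₁, ∃ C, 0 ≤ C ∧ ∀ x μ, μ₀ < μ → μ ≤ μ₁ →
      ‖Ap ε ω₀ d Ia μ₀ x μ‖ ≤ C * (μ - μ₀) := by
    intro μ₁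
    obtain ⟨C₁, h1⟩ := (isCompact_Icc (a := μ₀) (b := μ₁)).exists_bound_of_continuousOn
      hEc.continuousOn
    obtain ⟨C₂, h2⟩ := (isCompact_Icc (a := μ₀) (b := μ₁)).exists_bound_of_continuousOn
      (continuous_weight ε ω₀).continuousOn
    refine ⟨|1 / Real.sqrt ε * (kernelMass d * M 0 * C₁) * C₂|, abs_nonneg _, fun x μ hμ hμ₁ => ?_⟩
    have hpos : 0 ≤ μ - μ₀ := by linarith
    have h3 := norm_duhamel_le hd (hT.bound 0) hμ.le (fun m hm => h1 m ⟨hm.1, hm.2.trans hμ₁⟩) x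
    have h4 := h2 μ ⟨hμ.le, hμ₁⟩
    rw [Ap_eq_duhamel hd ε ω₀ Ia x hμ.le, norm_mul, norm_mul, norm_div, norm_one,
      Complex.norm_real, Real.norm_eq_abs, abs_of_pos (Real.sqrt_pos.2 hε)]
    calc _ ≤ 1 / Real.sqrt ε * (kernelMass d * M 0 * C₁ * (μ - μ₀)) * C₂ := by
          have := (norm_nonneg _).trans h3
          gcongr
      _ = (1 / Real.sqrt ε * (kernelMass d * M 0 * C₁) * C₂) * (μ - μ₀) := by ring
      _ ≤ _ := by gcongr; exact le_abs_self _
  refine ⟨fun μ hμ => (hspace μ hμ).1, fun x μ hμ => (htime x μ hμ).differentiableAt,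
    fun x μ hμ => ?_, fun μ₁ => ?_, fun x => ?_⟩
  · have hw : E μ * weight ε ω₀ μ = 1 := inv_mul_cancel₀ (weight_ne_zero ε ω₀ μ)
    rw [(htime x μ hμ).deriv, (hspace μ hμ).2, Ap_eq_duhamel hd ε ω₀ Ia x hμ.le]
    have h0 : sourceDeriv Ia 0 x = (Ia x : ℂ) := by simp [sourceDeriv]
    rw [← h0]
    have : (ε : ℂ) * (1 / (Real.sqrt ε : ℂ)) = Real.sqrt ε := by
      rw [hss]; field_simp
    rw [mul_add]
    set W₀ := duhamel d E μ₀ (sourceDeriv Ia 0) x μ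
    set W₂ := duhamel d E μ₀ (sourceDeriv Ia 2) x μ
    set w := weight ε ω₀ μ
    have e1 : (ε : ℂ) * (1 / (Real.sqrt ε : ℂ) * (sourceDeriv Ia 0 x * E μ + d * W₂) * w)
        = (ε : ℂ) * (1 / (Real.sqrt ε : ℂ)) * sourceDeriv Ia 0 x * (E μ * w)
          + (ε : ℂ) * d * (1 / (Real.sqrt ε : ℂ) * W₂ * w) := by ring
    have e2 : (ε : ℂ) * (1 / (Real.sqrt ε : ℂ) * W₀ * (cz ω₀ μ / ε * w))
        = cz ω₀ μ * (1 / (Real.sqrt ε : ℂ) * W₀ * w) := by field_simp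
    rw [e1, e2, this, hw]
    ring
  · obtain ⟨C, hC, h⟩ := hbound μ₁
    refine ⟨C * (μ₁ - μ₀), fun x μ h1 h2 => (h x μ h1 h2).trans ?_⟩
    gcongr
  · obtain ⟨C, hC, h⟩ := hbound (μ₀ + 1)
    have hlim : Tendsto (fun p : ℝ × ℝ => C * (p.2 - μ₀)) (𝓝 x ×ˢ 𝓝[>] μ₀) (𝓝 0) := by
      have h1 : Tendsto (fun μ : ℝ => C * (μ - μ₀)) (𝓝[>] μ₀) (𝓝 0) := by
        have : Tendsto (fun μ : ℝ => C * (μ - μ₀)) (𝓝 μ₀) (𝓝 (C * (μ₀ - μ₀))) :=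
          (by fun_prop : Continuous fun μ : ℝ => C * (μ - μ₀)).tendsto _
        rw [sub_self, mul_zero] at this
        exact this.mono_left nhdsWithin_le_nhds
      exact h1.comp tendsto_snd
    refine squeeze_zero_norm' ?_ hlim
    have hev : ∀ᶠ μ in 𝓝[>] μ₀, μ₀ < μ ∧ μ ≤ μ₀ + 1 := by
      filter_upwards [Ioo_mem_nhdsGT (show μ₀ < μ₀ + 1 by linarith)] with μ hμ
      exact ⟨hμ.1, hμ.2.le⟩
    filter_upwards [tendsto_snd.eventually hev] with p hp
    exact h p.1 p.2 hp.1 hp.2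

lemma isSolution_Ah (hε : 0 < ε) (hd : 0 < d.re) {A₀ : ℝ → ℂ} (hA₀ : Continuous A₀) {M : ℝ}
    (hM : ∀ x, ‖A₀ x‖ ≤ M) :
    IsSolution ε ω₀ d (fun _ => 0) μ₀ A₀ (Ah ε ω₀ d A₀ μ₀) := by
  have hε' : (ε : ℂ) ≠ 0 := by exact_mod_cast hε.ne'
  set c : ℂ := (weight ε ω₀ μ₀)⁻¹ with hc
  have hAh : ∀ x μ, Ah ε ω₀ d A₀ μ₀ x μ = c * weight ε ω₀ μ * heatFlow d A₀ x (μ - μ₀) := by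
    intro x μ
    unfold Ah Bh
    rw [exp_neg_cz_sq, hc, weight, weight]
    ring
  have hsmooth := fun μ (hμ : μ₀ < μ) => heatFlow_heat_equation hd hA₀ hM (sub_pos.2 hμ)
  have htime : ∀ x μ, μ₀ < μ → HasDerivAt (fun m => Ah ε ω₀ d A₀ μ₀ x m)
      (c * (cz ω₀ μ / ε * weight ε ω₀ μ) * heatFlow d A₀ x (μ - μ₀) + c * weight ε ω₀ μ *
        (d * iteratedDeriv 2 (fun y => heatFlow d A₀ y (μ - μ₀)) x)) μ := by
    intro x μ hμ
    simp_rw [hAh]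
    exact ((hasDerivAt_weight hε ω₀ μ).const_mul c).mul
      (((hsmooth μ hμ).2 x).comp_sub_const μ μ₀)
  refine ⟨fun μ hμ => ?_, fun x μ hμ => (htime x μ hμ).differentiableAt,
    fun x μ hμ => ?_, fun μ₁ => ?_, fun x => ?_⟩
  · simp_rw [hAh]
    exact contDiff_const.mul (hsmooth μ hμ).1
  · rw [(htime x μ hμ).deriv]
    simp_rw [hAh]
    rw [iteratedDeriv_const_mul_field]
    push_cast
    field_simp
    ring
  · obtain ⟨C, h2⟩ := (isCompact_Icc (a := μ₀) (b := μ₁)).exists_bound_of_continuousOn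
      (continuous_weight ε ω₀).continuousOn
    refine ⟨‖c‖ * (kernelMass d * M) * C, fun x μ h1 h3 => ?_⟩
    rw [Ah_eq_heatAvg hd ε ω₀ A₀ x h1, norm_mul, norm_mul]
    have h4 := norm_heatAvg_le hd hM x (μ - μ₀)
    have h5 := h2 μ ⟨h1.le, h3⟩
    have := (norm_nonneg _).trans h4
    gcongr
  · have h1 : Continuous fun p : ℝ × ℝ =>
        c * heatAvg d A₀ p.1 (p.2 - μ₀) * weight ε ω₀ p.2 := by
      have h2 := (continuous_heatAvg hd hA₀ hM).comp
        (by fun_prop : Continuous fun p : ℝ × ℝ => (p.1, p.2 - μ₀))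
      have h3 := (continuous_weight ε ω₀).comp (continuous_snd : Continuous (Prod.snd : ℝ × ℝ → ℝ))
      exact (h2.const_mul c).mul h3
    have h2 : Tendsto (fun p : ℝ × ℝ => c * heatAvg d A₀ p.1 (p.2 - μ₀) * weight ε ω₀ p.2)
        (𝓝 x ×ˢ 𝓝[>] μ₀) (𝓝 (A₀ x)) := by
      have h3 := (h1.tendsto (x, μ₀)).mono_left
        (show 𝓝 x ×ˢ 𝓝[>] μ₀ ≤ 𝓝 (x, μ₀) by
          rw [nhds_prod_eq]
          exact Filter.prod_mono le_rfl nhdsWithin_le_nhds)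
      simp only [sub_self, heatAvg_zero hd] at h3
      rwa [hc, mul_right_comm, inv_mul_cancel₀ (weight_ne_zero ε ω₀ μ₀), one_mul] at h3
    refine h2.congr' ?_
    filter_upwards [tendsto_snd.eventually (self_mem_nhdsWithin (a := μ₀) (s := Ioi μ₀))] with p hp
    exact (Ah_eq_heatAvg hd ε ω₀ A₀ p.1 hp).symm

end Solutions

/-! ### Möbius maps between sectors and the tracking region -/

section Sector

variable {ω₀ δ : ℝ}

/-- The Möbius map `u ↦ ω₀ u / (1 + u)` sends an infinite sector into the tracking region. -/
lemma mobius_mem_trackingRegion (hω₀ : 0 < ω₀) (hδ : 0 < δ) {u : ℂ} (hu : u ≠ 0) (h1 : 0 ≤ u.im)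
    (h2 : δ * u.im ≤ ω₀ * u.re) :
    1 + u ≠ 0 ∧ (ω₀ : ℂ) * u / (1 + u) ∈ trackingRegion ω₀ δ := by
  have hre : 0 ≤ u.re := by
    by_contra hneg
    push Not at hneg
    nlinarith [mul_nonneg hδ.le h1]
  have hne : 1 + u ≠ 0 := by
    intro h
    have := congrArg Complex.re h
    simp at this
    linarith
  have hω₀' : (ω₀ : ℂ) ≠ 0 := by exact_mod_cast hω₀.ne'
  set N := (1 + u.re) ^ 2 + u.im ^ 2 with hN
  have hNpos : 0 < N := by positivity
  have hnsq : Complex.normSq (1 + u) = N := by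
    rw [Complex.normSq_apply]; simp [hN, sq]
  have e1 : ((ω₀ : ℂ) * u / (1 + u)).re = ω₀ * (u.re + u.re ^ 2 + u.im ^ 2) / N := by
    rw [Complex.div_re, hnsq]; simp; field_simp
  have e2 : ((ω₀ : ℂ) * u / (1 + u)).im = ω₀ * u.im / N := by
    rw [Complex.div_im, hnsq]; simp; field_simp; ring
  refine ⟨hne, div_ne_zero (mul_ne_zero hω₀' hu) hne, ?_, ?_, ?_, ?_⟩
  · rw [e2]; positivity
  · rw [e2, div_le_iff₀ hNpos]
    gcongr
    rw [hN]
    nlinarith [sq_nonneg (u.im - 1)]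
  · rw [e1, e2, mul_div_assoc', mul_div_assoc']
    refine div_le_div_of_nonneg_right ?_ hNpos.le
    nlinarith [mul_pos hω₀ hω₀, sq_nonneg u.re, sq_nonneg u.im, mul_nonneg hω₀.le
      (mul_nonneg hω₀.le (add_nonneg (sq_nonneg u.re) (sq_nonneg u.im))),
      mul_le_mul_of_nonneg_left h2 hω₀.le]
  · rw [e1, e2, ← add_div, div_le_iff₀ hNpos, ← mul_add, mul_comm 2 ω₀, mul_assoc]
    gcongr
    rw [hN]
    nlinarith [sq_nonneg (u.im - 1)]

/-- Interpolation in a sector: a bounded holomorphic function which is `O(s ^ n)` on one edge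
is, on the rays in between, of an order that falls linearly in the angle to `0` on the other edge.
The Möbius map and the logarithm carry the sector to a strip, where the theorem of
Phragmén and Lindelöf applies to the product with the exponential of a quadratic polynomial. -/
lemma norm_mobius_le_of_sector (hω₀ : 0 < ω₀) (hδ : 0 < δ) {h : ℂ → ℂ} {A B : ℝ} {n : ℕ}
    (hA : 0 ≤ A) (hdiff : ∀ s ∈ trackingRegion ω₀ δ, DifferentiableAt ℂ h s)
    (hB : ∀ s ∈ trackingRegion ω₀ δ, ‖h s‖ ≤ B)
    (hreal : ∀ s : ℝ, 0 < s → ‖h s‖ ≤ A * s ^ n) {u : ℂ} (hu : u ≠ 0) (h0 : 0 ≤ u.arg)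
    (h1 : u.arg ≤ (⟨δ, ω₀⟩ : ℂ).arg) :
    ‖h ((ω₀ : ℂ) * u / (1 + u))‖
      ≤ max (A * ω₀ ^ n) B * ‖u‖ ^ (n * (1 - u.arg / (⟨δ, ω₀⟩ : ℂ).arg) : ℝ) := by
  set v : ℂ := ⟨δ, ω₀⟩ with hv
  set α := v.arg with hα
  have hvne : v ≠ 0 := fun h => hω₀.ne' (congrArg Complex.im h)
  have hvn : 0 < ‖v‖ := norm_pos_iff.2 hvne
  have hcos : ‖v‖ * Real.cos α = δ := Complex.norm_mul_cos_arg v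
  have hsin : ‖v‖ * Real.sin α = ω₀ := Complex.norm_mul_sin_arg v
  have hα0 : 0 < α := by
    rcases (Complex.arg_nonneg_iff.2 (show 0 ≤ v.im from hω₀.le)).lt_or_eq with h | h
    · exact h
    · rw [hα, ← h] at hsin
      simp at hsin
      linarith
  have hαpi : α ≤ Real.pi := Complex.arg_le_pi v
  -- the exponential map from the strip to the sector
  set w : ℂ → ℂ := fun ζ => Complex.exp (Complex.I * α * ζ) with hw
  have hwre : ∀ ζ, (w ζ).re = Real.exp (-(α * ζ.im)) * Real.cos (α * ζ.re) := by
    intro ζ; simp [hw, Complex.exp_re]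
  have hwim : ∀ ζ, (w ζ).im = Real.exp (-(α * ζ.im)) * Real.sin (α * ζ.re) := by
    intro ζ; simp [hw, Complex.exp_im]
  have hwmem : ∀ ζ : ℂ, 0 ≤ ζ.re → ζ.re ≤ 1 →
      1 + w ζ ≠ 0 ∧ (ω₀ : ℂ) * w ζ / (1 + w ζ) ∈ trackingRegion ω₀ δ := by
    intro ζ hζ0 hζ1
    refine mobius_mem_trackingRegion hω₀ hδ (Complex.exp_ne_zero _) ?_ ?_
    · rw [hwim]
      exact mul_nonneg (Real.exp_pos _).le
        (Real.sin_nonneg_of_nonneg_of_le_pi (by positivity) (by nlinarith))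
    · rw [hwim, hwre]
      have hs : 0 ≤ Real.sin (α - α * ζ.re) :=
        Real.sin_nonneg_of_nonneg_of_le_pi (by nlinarith) (by nlinarith)
      rw [Real.sin_sub] at hs
      have : 0 ≤ ω₀ * Real.cos (α * ζ.re) - δ * Real.sin (α * ζ.re) := by
        rw [← hcos, ← hsin]
        nlinarith
      nlinarith [Real.exp_pos (-(α * ζ.im))]
  set F : ℂ → ℂ := fun ζ => h ((ω₀ : ℂ) * w ζ / (1 + w ζ)) *
    Complex.exp (-(Complex.I * (n * α : ℝ)) * (ζ - ζ ^ 2 / 2)) with hF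
  have hG : ∀ ζ : ℂ, ‖Complex.exp (-(Complex.I * (n * α : ℝ)) * (ζ - ζ ^ 2 / 2))‖
      = Real.exp (n * α * (ζ.im * (1 - ζ.re))) := by
    intro ζ
    have e1 : ∀ (c : ℝ) (z : ℂ), (-(Complex.I * (c : ℂ)) * z).re = c * z.im := by
      intro c z; simp
    have e2 : (ζ - ζ ^ 2 / 2).im = ζ.im * (1 - ζ.re) := by
      simp [sq]; ring
    rw [Complex.norm_exp, e1, e2]
  have hB0 : 0 ≤ B := (norm_nonneg _).trans (hB _ (hwmem 0 (by simp) (by simp)).2)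
  have key : ∀ ζ : ℂ, 0 ≤ ζ.re → ζ.re ≤ 1 → ‖F ζ‖ ≤ max (A * ω₀ ^ n) B := by
    intro ζ hζ0 hζ1
    refine PhragmenLindelof.vertical_strip (a := 0) (b := 1) ?_ ?_ ?_ ?_ hζ0 hζ1
    · refine DifferentiableOn.diffContOnCl fun ζ hζ => ?_
      have hζ' : ζ ∈ Complex.re ⁻¹' Icc (0 : ℝ) 1 :=
        closure_minimal (preimage_mono Ioo_subset_Icc_self)
          (isClosed_Icc.preimage Complex.continuous_re) hζ
      obtain ⟨hne, hm⟩ := hwmem ζ hζ'.1 hζ'.2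
      have hwd : DifferentiableAt ℂ w ζ := by fun_prop
      have h2 : DifferentiableAt ℂ (fun ζ => (ω₀ : ℂ) * w ζ / (1 + w ζ)) ζ :=
        (hwd.const_mul _).div (hwd.const_add _) hne
      refine (((hdiff _ hm).comp ζ h2).mul ?_).differentiableWithinAt
      fun_prop
    · refine ⟨1, by linarith [Real.pi_gt_three], n * α, ?_⟩
      refine Asymptotics.IsBigO.of_bound B ?_
      rw [eventually_inf_principal]
      refine Eventually.of_forall fun ζ hζ => ?_
      have hm := hwmem ζ (le_of_lt hζ.1) (le_of_lt hζ.2)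
      rw [hF, norm_mul, hG, Real.norm_eq_abs, abs_of_pos (Real.exp_pos _)]
      have h3 : ζ.im * (1 - ζ.re) ≤ Real.exp (1 * |ζ.im|) := by
        have h4 : |ζ.im| ≤ Real.exp (1 * |ζ.im|) := by
          rw [one_mul]; linarith [Real.add_one_le_exp |ζ.im|]
        have h5 : ζ.im * (1 - ζ.re) ≤ |ζ.im| := by
          have := hζ.1
          have := hζ.2
          nlinarith [le_abs_self ζ.im, neg_abs_le ζ.im, abs_nonneg ζ.im]
        exact h5.trans h4
      gcongr
      exact hB _ hm.2
    · intro ζ hζ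
      have hm := hwmem ζ hζ.ge (by rw [hζ]; exact zero_le_one)
      set r := Real.exp (-(α * ζ.im)) with hr
      have hrpos : 0 < r := Real.exp_pos _
      have hwr : w ζ = (r : ℂ) := by
        apply Complex.ext
        · rw [hwre, hζ, mul_zero, Real.cos_zero, mul_one, Complex.ofReal_re]
        · rw [hwim, hζ]; simp
      have hs : (ω₀ : ℂ) * w ζ / (1 + w ζ) = ((ω₀ * r / (1 + r) : ℝ) : ℂ) := by
        rw [hwr]; push_cast; rfl
      rw [hF, norm_mul, hG, hs, hζ]
      have h2 : ω₀ * r / (1 + r) ≤ ω₀ * r := div_le_self (by positivity) (by linarith)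
      have h3 := hreal (ω₀ * r / (1 + r)) (by positivity)
      have h4 : Real.exp (n * α * (ζ.im * (1 - 0))) * r ^ n = 1 := by
        rw [hr, ← Real.exp_nat_mul, ← Real.exp_add, Real.exp_eq_one_iff]
        ring
      refine le_max_of_le_left ?_
      calc _ ≤ A * (ω₀ * r) ^ n * Real.exp (n * α * (ζ.im * (1 - 0))) := by
            gcongr
            exact h3.trans (by gcongr)
        _ = A * ω₀ ^ n * (Real.exp (n * α * (ζ.im * (1 - 0))) * r ^ n) := by rw [mul_pow]; ring
        _ = A * ω₀ ^ n := by rw [h4, mul_one]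
    · intro ζ hζ
      have hm := hwmem ζ (by rw [hζ]; exact zero_le_one) hζ.le
      rw [hF, norm_mul, hG, hζ]
      refine le_max_of_le_right ?_
      simpa using hB _ hm.2
  -- the point of the strip over `u`
  set ζ : ℂ := -Complex.I * Complex.log u / α with hζ
  have hα' : (α : ℂ) ≠ 0 := by exact_mod_cast hα0.ne'
  have hwζ : w ζ = u := by
    rw [hw]
    simp only
    rw [show Complex.I * α * ζ = Complex.log u by
      rw [hζ]; field_simp; rw [Complex.I_sq]; ring, Complex.exp_log hu]
  have hζre : ζ.re = u.arg / α := by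
    rw [hζ, Complex.div_ofReal_re]; simp [Complex.log_im]
  have hζim : ζ.im = -Real.log ‖u‖ / α := by
    rw [hζ, Complex.div_ofReal_im]; simp [Complex.log_re]
  have hk := key ζ (by rw [hζre]; positivity) (by rw [hζre]; exact div_le_one_of_le₀ h1 hα0.le)
  rw [hF] at hk
  simp only [norm_mul, hG, hwζ] at hk
  have hpow : ‖u‖ ^ (n * (1 - u.arg / α) : ℝ) * Real.exp (n * α * (ζ.im * (1 - ζ.re))) = 1 := by
    rw [Real.rpow_def_of_pos (norm_pos_iff.2 hu), ← Real.exp_add, Real.exp_eq_one_iff, hζre, hζim]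
    field_simp
    ring
  calc ‖h ((ω₀ : ℂ) * u / (1 + u))‖
      = (‖h ((ω₀ : ℂ) * u / (1 + u))‖ * Real.exp (n * α * (ζ.im * (1 - ζ.re)))) *
          ‖u‖ ^ (n * (1 - u.arg / α) : ℝ) := by
        rw [mul_assoc, mul_comm (Real.exp _), hpow, mul_one]
    _ ≤ _ := by gcongr

end Sector

/-! ### Taylor expansion of the continued heat flow at the vertex -/

section Ray

variable {ω₀ δ : ℝ} {d : ℂ} {Ia : ℝ → ℝ} {g : ℝ → ℂ → ℂ}

lemma arg_lt_arg_of_slope_lt {p v : ℂ} (hp : 0 < p.re) (hv : 0 < v.re)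
    (h : p.im / p.re < v.im / v.re) : p.arg < v.arg := by
  by_contra hcon
  push Not at hcon
  have h1 := abs_lt.1 (Complex.abs_arg_lt_pi_div_two_iff.2 (Or.inl hp))
  have h2 := abs_lt.1 (Complex.abs_arg_lt_pi_div_two_iff.2 (Or.inl hv))
  have h3 := Real.strictMonoOn_tan.monotoneOn (show v.arg ∈ Ioo _ _ from h2)
    (show p.arg ∈ Ioo _ _ from h1) hcon
  rw [Complex.tan_arg, Complex.tan_arg] at h3
  linarith

lemma norm_le_of_mem_trackingRegion (hω₀ : 0 < ω₀) (hδ : 0 < δ) {s : ℂ}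
    (hs : s ∈ trackingRegion ω₀ δ) : ‖s‖ ≤ 2 * ω₀ := by
  obtain ⟨-, h1, h2, h3, h4⟩ := hs
  have hre : 0 ≤ s.re := by
    by_contra hneg
    push Not at hneg
    nlinarith [mul_nonneg hδ.le h1]
  refine (Complex.norm_le_abs_re_add_abs_im s).trans ?_
  rwa [abs_of_nonneg hre, abs_of_nonneg h1]

/-- Along a ray strictly inside the sector at the corner, the continued heat flow has the same
second order Taylor expansion as on the positive axis, uniformly in `x`. On the edge of the sector
this may fail: the expansion on the axis, of high order, is traded for the angle. -/
lemma IsHeatContinuation.exists_taylor_on_ray (hω₀ : 0 < ω₀) (hδ : 0 < δ) (hd : 0 < d.re)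
    (hIa : HasBoundedDerivs Ia) (hg : IsHeatContinuation ω₀ δ d Ia g) {p : ℂ}
    (hpi : 0 < p.im) (hslope : δ * p.im < ω₀ * p.re)
    (hp : ∀ t : ℝ, 0 < t → t ≤ 1 → (t : ℂ) * p ∈ trackingRegion ω₀ δ) :
    ∃ C : ℝ, 0 ≤ C ∧ ∀ x t : ℝ, 0 < t → t ≤ 1 →
      ‖g x ((t : ℂ) * p) - (sourceDeriv Ia 0 x + d * sourceDeriv Ia 2 x * ((t : ℂ) * p))‖
        ≤ C * t ^ 2 := by
  obtain ⟨M, hT⟩ := hIa.exists_isDerivTower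
  obtain ⟨hgr, U, hU, hQU, hgU, B, hB⟩ := hg
  have hpr : 0 < p.re := by
    by_contra hneg
    push Not at hneg
    nlinarith [mul_pos hδ hpi]
  have hp0 : p ≠ 0 := fun h => by simp [h] at hpr
  have hpn : 0 < ‖p‖ := norm_pos_iff.2 hp0
  set v : ℂ := ⟨δ, ω₀⟩ with hv
  set α := v.arg with hα
  have hargp : p.arg < α := by
    refine arg_lt_arg_of_slope_lt hpr hδ ?_
    rw [div_lt_div_iff₀ hpr hδ]
    change p.im * δ < ω₀ * p.re
    linarith
  have hargp0 : 0 ≤ p.arg := Complex.arg_nonneg_iff.2 hpi.le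
  have hα0 : 0 < α := hargp0.trans_lt hargp
  -- an angle strictly between the ray and the edge, and the order of the expansion it requires
  set β := (p.arg + α) / 2 with hβ
  have hβα : β < α := by rw [hβ]; linarith
  obtain ⟨m, hm⟩ := exists_nat_ge (2 / (1 - β / α))
  have hβ1 : 0 < 1 - β / α := by
    rw [sub_pos, div_lt_one hα0]; exact hβα
  set n := m + 2 with hn
  have hnβ : 2 ≤ (n : ℝ) * (1 - β / α) := by
    rw [div_le_iff₀ hβ1] at hm
    rw [hn]
    push_cast
    nlinarith
  -- the Taylor remainder of order `n`
  set T : ℝ → ℂ → ℂ := fun x s =>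
    ∑ j ∈ Finset.range n, (d * s) ^ j / (j.factorial : ℂ) * sourceDeriv Ia (2 * j) x with hTdef
  set h : ℝ → ℂ → ℂ := fun x s => g x s - T x s with hh
  set A : ℝ := kernelMass d * M (2 * n) * ‖d‖ ^ n with hA
  have hM0 : 0 ≤ M (2 * n) := hT.nonneg _
  have hκ := kernelMass_nonneg (d := d)
  have hA0 : 0 ≤ A := by positivity
  set R : ℝ := ∑ j ∈ Finset.range n, (‖d‖ * (2 * ω₀)) ^ j / (j.factorial : ℝ) * M (2 * j) with hR
  have hTb : ∀ x, ∀ s ∈ trackingRegion ω₀ δ, ‖T x s‖ ≤ R := by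
    intro x s hs
    refine (norm_sum_le _ _).trans (Finset.sum_le_sum fun j _ => ?_)
    rw [norm_mul, norm_div, norm_pow, norm_mul, Complex.norm_natCast]
    have := norm_le_of_mem_trackingRegion hω₀ hδ hs
    gcongr
    exact hT.bound _ _
  have hhb : ∀ x, ∀ s ∈ trackingRegion ω₀ δ, ‖h x s‖ ≤ B + R := fun x s hs =>
    (norm_sub_le _ _).trans (add_le_add (hB x s (hQU hs)) (hTb x s hs))
  have hhd : ∀ x, ∀ s ∈ trackingRegion ω₀ δ, DifferentiableAt ℂ (h x) s := fun x s hs =>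
    (hgU x s (hQU hs)).differentiableAt.sub (by fun_prop)
  have hhr : ∀ x s : ℝ, 0 < s → ‖h x s‖ ≤ A * s ^ n := by
    intro x s hs
    have := hT.heatAvg_taylor hd n 0 x hs.le
    simp only [zero_add] at this
    simp only [hh, hTdef]
    rw [hgr x s hs, ← sourceDeriv_zero, heatFlow_eq_heatAvg hd _ x hs]
    refine this.trans (le_of_eq ?_)
    rw [mul_pow]; ring
  set K := max (A * ω₀ ^ n) (B + R) with hK
  have hK0 : 0 ≤ K := le_max_of_le_left (by positivity)
  -- near the corner the Möbius image of the ray stays below the intermediate angle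
  have hωc : (ω₀ : ℂ) ≠ 0 := by exact_mod_cast hω₀.ne'
  have hcont : ContinuousAt (fun t : ℝ => p / ((ω₀ : ℂ) - t * p)) 0 := by
    refine ContinuousAt.div (by fun_prop) (by fun_prop) ?_
    simpa using hωc
  have hval : p / ((ω₀ : ℂ) - ((0 : ℝ) : ℂ) * p) = ((ω₀⁻¹ : ℝ) : ℂ) * p := by
    push_cast; field_simp; simpa using hω₀.ne'
  have hargc : ContinuousAt (fun t : ℝ => (p / ((ω₀ : ℂ) - t * p)).arg) 0 := by
    refine ContinuousAt.comp (g := Complex.arg) ?_ hcont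
    refine Complex.continuousAt_arg ?_
    rw [hval]
    left
    simp only [Complex.re_ofReal_mul]
    positivity
  have himc : ContinuousAt (fun t : ℝ => (p / ((ω₀ : ℂ) - t * p)).im) 0 :=
    Complex.continuous_im.continuousAt.comp hcont
  have hev1 : ∀ᶠ t : ℝ in 𝓝 0, (p / ((ω₀ : ℂ) - t * p)).arg < β := by
    refine hargc.eventually_lt continuousAt_const ?_
    rw [hval, Complex.arg_real_mul _ (by positivity), hβ]
    linarith
  have hev2 : ∀ᶠ t : ℝ in 𝓝 0, 0 < (p / ((ω₀ : ℂ) - t * p)).im := by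
    refine continuousAt_const.eventually_lt himc ?_
    rw [hval, Complex.im_ofReal_mul]
    positivity
  obtain ⟨t₀, ht₀, hball⟩ := Metric.eventually_nhds_iff.1 (hev1.and hev2)
  set t₁ := min (t₀ / 2) (ω₀ / (2 * ‖p‖)) with ht₁
  have ht₁pos : 0 < t₁ := by positivity
  have hnear : ∀ x t : ℝ, 0 < t → t < t₁ → ‖h x (t * p)‖ ≤ K * (2 * ‖p‖ / ω₀) ^ 2 * t ^ 2 := by
    intro x t ht htt
    have htt₀ : t < t₀ := by
      have := min_le_left (t₀ / 2) (ω₀ / (2 * ‖p‖)); linarith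
    have htp : t * ‖p‖ ≤ ω₀ / 2 := by
      have h1 : t ≤ ω₀ / (2 * ‖p‖) := htt.le.trans (min_le_right _ _)
      rw [le_div_iff₀ (by positivity)] at h1
      linarith
    obtain ⟨ha, hi⟩ := hball (show dist t 0 < t₀ by rwa [Real.dist_eq, sub_zero, abs_of_pos ht])
    set q := p / ((ω₀ : ℂ) - t * p) with hq
    set u : ℂ := (t : ℂ) * q with hu
    have hden : ω₀ / 2 ≤ ‖(ω₀ : ℂ) - t * p‖ := by
      have h1 := norm_sub_norm_le (ω₀ : ℂ) (t * p)
      rw [norm_mul, Complex.norm_real, Complex.norm_real, Real.norm_eq_abs, Real.norm_eq_abs,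
        abs_of_pos ht, abs_of_pos hω₀] at h1
      linarith
    have hden0 : (ω₀ : ℂ) - t * p ≠ 0 := norm_pos_iff.1 (by linarith)
    have hargu : u.arg = q.arg := Complex.arg_real_mul _ ht
    have hq0 : q ≠ 0 := div_ne_zero hp0 hden0
    have hu0 : u ≠ 0 := mul_ne_zero (by exact_mod_cast ht.ne') hq0
    have hun : ‖u‖ ≤ 2 * ‖p‖ / ω₀ * t := by
      rw [hu, hq, norm_mul, norm_div, Complex.norm_real, Real.norm_eq_abs, abs_of_pos ht]
      calc t * (‖p‖ / ‖(ω₀ : ℂ) - t * p‖) ≤ t * (‖p‖ / (ω₀ / 2)) := by gcongr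
        _ = _ := by field_simp
    have hun1 : ‖u‖ ≤ 1 := by
      refine hun.trans ?_
      rw [div_mul_eq_mul_div, div_le_one hω₀]
      linarith
    have hs : (ω₀ : ℂ) * u / (1 + u) = t * p := by
      have h1 : 1 + u = ω₀ / ((ω₀ : ℂ) - t * p) := by
        rw [hu, hq]; field_simp; ring
      rw [h1, hu, hq]
      field_simp
    have h2 := norm_mobius_le_of_sector hω₀ hδ hA0 (hhd x) (hhb x) (hhr x) hu0
      (hargu ▸ Complex.arg_nonneg_iff.2 hi.le) (hargu ▸ (ha.le.trans hβα.le))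
    rw [hs, hargu] at h2
    have hexp : (2 : ℝ) ≤ n * (1 - q.arg / α) := by
      refine hnβ.trans ?_
      gcongr
    calc ‖h x (t * p)‖ ≤ K * ‖u‖ ^ (n * (1 - q.arg / α) : ℝ) := h2
      _ ≤ K * ‖u‖ ^ (2 : ℝ) := by
        gcongr ?_ * ?_
        exact Real.rpow_le_rpow_of_exponent_ge (norm_pos_iff.2 hu0) hun1 hexp
      _ ≤ K * (2 * ‖p‖ / ω₀ * t) ^ 2 := by
        rw [Real.rpow_two]; gcongr
      _ = _ := by ring
  -- the terms of order two and higher of the polynomial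
  set S : ℝ := ∑ j ∈ Finset.range m, (‖d‖ * ‖p‖) ^ (j + 2) / ((j + 2).factorial : ℝ)
    * M (2 * (j + 2)) with hS
  have hS0 : 0 ≤ S := Finset.sum_nonneg fun j _ => by
    have := hT.nonneg (2 * (j + 2)); positivity
  have hhigh : ∀ x t : ℝ, 0 < t → t ≤ 1 → ‖T x (t * p) - (sourceDeriv Ia 0 x +
      d * sourceDeriv Ia 2 x * ((t : ℂ) * p))‖ ≤ S * t ^ 2 := by
    intro x t ht ht1
    have e : T x (t * p) - (sourceDeriv Ia 0 x + d * sourceDeriv Ia 2 x * ((t : ℂ) * p)) =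
        ∑ j ∈ Finset.range m, (d * (t * p)) ^ (j + 2) / ((j + 2).factorial : ℂ) *
          sourceDeriv Ia (2 * (j + 2)) x := by
      simp only [hTdef, hn]
      rw [Finset.sum_range_succ', Finset.sum_range_succ']
      simp
      ring
    rw [e, hS, Finset.sum_mul]
    refine (norm_sum_le _ _).trans (Finset.sum_le_sum fun j _ => ?_)
    rw [norm_mul, norm_div, norm_pow, norm_mul, norm_mul, Complex.norm_natCast, Complex.norm_real,
      Real.norm_eq_abs, abs_of_pos ht]
    have h1 : (‖d‖ * (t * ‖p‖)) ^ (j + 2) ≤ (‖d‖ * ‖p‖) ^ (j + 2) * t ^ 2 := by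
      rw [show ‖d‖ * (t * ‖p‖) = ‖d‖ * ‖p‖ * t by ring, mul_pow]
      exact mul_le_mul_of_nonneg_left (pow_le_pow_of_le_one ht.le ht1 (by omega)) (by positivity)
    have h2 := hT.bound (2 * (j + 2)) x
    have := hT.nonneg (2 * (j + 2))
    calc _ ≤ (‖d‖ * ‖p‖) ^ (j + 2) * t ^ 2 / ((j + 2).factorial : ℝ) * M (2 * (j + 2)) := by gcongr
      _ = _ := by ring
  have hBR : 0 ≤ B + R := (norm_nonneg _).trans (hhb 0 _ (hp 1 one_pos le_rfl))
  refine ⟨K * (2 * ‖p‖ / ω₀) ^ 2 + (B + R) / t₁ ^ 2 + S, by positivity, fun x t ht ht1 => ?_⟩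
  have h1 : ‖h x (t * p)‖ ≤ (K * (2 * ‖p‖ / ω₀) ^ 2 + (B + R) / t₁ ^ 2) * t ^ 2 := by
    rcases lt_or_ge t t₁ with hlt | hge
    · refine (hnear x t ht hlt).trans ?_
      gcongr
      linarith [show 0 ≤ (B + R) / t₁ ^ 2 by positivity]
    · refine (hhb x _ (hp t ht ht1)).trans ?_
      have : B + R ≤ (B + R) / t₁ ^ 2 * t ^ 2 := by
        rw [div_mul_eq_mul_div, le_div_iff₀ (by positivity)]
        gcongr
      have h0 : 0 ≤ K * (2 * ‖p‖ / ω₀) ^ 2 * t ^ 2 := by positivity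
      linarith
  calc _ = ‖h x (t * p) + (T x (t * p) - (sourceDeriv Ia 0 x +
          d * sourceDeriv Ia 2 x * ((t : ℂ) * p)))‖ := by
        simp only [hh]; congr 1; ring
    _ ≤ _ := (norm_add_le _ _).trans (add_le_add h1 (hhigh x t ht ht1))
    _ = _ := by ring

end Ray

/-! ### Integrals along segments -/

/-- The integral of `F` along the segment from `a` to `b`. -/
def segInt (F : ℂ → ℂ) (a b : ℂ) : ℂ := (b - a) * ∫ t in (0 : ℝ)..1, F (a + t * (b - a))

section Segments

variable {F : ℂ → ℂ} {a b : ℂ}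

lemma segInt_ofReal (F : ℂ → ℂ) (a b : ℝ) : segInt F a b = ∫ s in a..b, F s := by
  have h := intervalIntegral.smul_integral_comp_add_mul (a := 0) (b := 1)
    (fun s : ℝ => F s) (b - a) a
  simp only [mul_zero, add_zero, mul_one, add_sub_cancel] at h
  rw [← h, segInt, Complex.real_smul]
  push_cast
  simp_rw [mul_comm ((b : ℂ) - a)]

lemma norm_segInt_le {K : ℝ} (h : ∀ t : ℝ, 0 < t → t ≤ 1 → ‖F (a + t * (b - a))‖ ≤ K) :
    ‖segInt F a b‖ ≤ ‖b - a‖ * K := by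
  rw [segInt, norm_mul]
  gcongr
  have := intervalIntegral.norm_integral_le_of_norm_le_const (a := (0 : ℝ)) (b := 1)
    (f := fun t : ℝ => F (a + t * (b - a))) (C := K) (fun t ht => by
      rw [uIoc_of_le zero_le_one] at ht
      exact h t ht.1 ht.2)
  simpa using this

lemma intervalIntegrable_of_continuousOn_Ioc {f : ℝ → ℂ} {c d K : ℝ} (hcd : c ≤ d)
    (hf : ContinuousOn f (Ioc c d)) (hK : ∀ t ∈ Ioc c d, ‖f t‖ ≤ K) :
    IntervalIntegrable f volume c d := by
  rw [intervalIntegrable_iff_integrableOn_Ioc_of_le hcd]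
  exact IntegrableOn.of_bound measure_Ioc_lt_top (hf.aestronglyMeasurable measurableSet_Ioc) K
    ((ae_restrict_iff' measurableSet_Ioc).2 (ae_of_all _ hK))

/-- A holomorphic function on a convex set, which need not be open, has a primitive that computes
its integrals along segments. -/
lemma exists_primitive_segInt {S : Set ℂ} (hS : Convex ℝ S) (hF : DifferentiableOn ℂ F S) :
    ∃ P : ℂ → ℂ, ∀ a ∈ S, ∀ b ∈ S, segInt F a b = P b - P a := by
  obtain ⟨P, hP⟩ := hS.exists_forall_hasDerivWithinAt hF
  refine ⟨P, fun a ha b hb => ?_⟩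
  have hmem : ∀ t ∈ Icc (0 : ℝ) 1, a + (t : ℂ) * (b - a) ∈ S := fun t ht => by
    have := hS.add_smul_sub_mem ha hb ht
    simpa using this
  have hlin : ∀ t : ℝ, HasDerivAt (fun t : ℝ => a + (t : ℂ) * (b - a)) (b - a) t := fun t => by
    simpa using ((hasDerivAt_id t).ofReal_comp.mul_const (b - a)).const_add a
  have hder : ∀ t ∈ Icc (0 : ℝ) 1, HasDerivWithinAt (fun t : ℝ => P (a + (t : ℂ) * (b - a)))
      ((b - a) * F (a + (t : ℂ) * (b - a))) (Icc 0 1) t := fun t ht => by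
    have := (hP _ (hmem t ht)).scomp t (hlin t).hasDerivWithinAt hmem
    simpa [Function.comp_def] using this
  have hFc : ContinuousOn (fun t : ℝ => (b - a) * F (a + (t : ℂ) * (b - a))) (Icc 0 1) :=
    continuousOn_const.mul (hF.continuousOn.comp (by fun_prop) hmem)
  have h := intervalIntegral.integral_eq_sub_of_hasDerivAt_of_le zero_le_one
    (fun t ht => (hder t ht).continuousWithinAt)
    (fun t ht => (hder t (Ioo_subset_Icc_self ht)).hasDerivAt (Icc_mem_nhds ht.1 ht.2))
    (hFc.intervalIntegrable_of_Icc zero_le_one)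
  rw [intervalIntegral.integral_const_mul] at h
  rw [segInt, h]
  simp

end Segments

section Corner

variable {ω₀ δ : ℝ}

lemma re_pos_of_mem_trackingRegion (hω₀ : 0 < ω₀) (hδ : 0 < δ) {s : ℂ}
    (hs : s ∈ trackingRegion ω₀ δ) : 0 < s.re := by
  obtain ⟨h0, h1, h2, h3, h4⟩ := hs
  by_contra hneg
  push Not at hneg
  have him : s.im = 0 := by nlinarith [mul_nonneg hδ.le h1]
  have hre : s.re = 0 := by
    rw [him] at h3
    nlinarith
  exact h0 (Complex.ext hre him)

lemma convex_trackingRegion (hω₀ : 0 < ω₀) (hδ : 0 < δ) : Convex ℝ (trackingRegion ω₀ δ) := by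
  intro s hs t ht a b ha hb hab
  have h1 := re_pos_of_mem_trackingRegion hω₀ hδ hs
  have h2 := re_pos_of_mem_trackingRegion hω₀ hδ ht
  obtain ⟨-, s1, s2, s3, s4⟩ := hs
  obtain ⟨-, t1, t2, t3, t4⟩ := ht
  have hre : (a • s + b • t).re = a * s.re + b * t.re := by simp
  have him : (a • s + b • t).im = a * s.im + b * t.im := by simp
  have hb' : b = 1 - a := by linarith
  have hpos : 0 < (a • s + b • t).re := by
    rw [hre]
    rcases ha.lt_or_eq with h | h
    · nlinarith [mul_pos h h1, mul_nonneg hb h2.le]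
    · rw [← h] at hb' ⊢
      rw [hb']
      linarith
  refine ⟨fun h => by rw [h] at hpos; simp at hpos, ?_, ?_, ?_, ?_⟩
  · rw [him]; positivity
  · rw [him]; nlinarith
  · rw [him, hre]; nlinarith
  · rw [him, hre]; nlinarith

lemma smul_mem_trackingRegion (hω₀ : 0 < ω₀) (hδ : 0 < δ) {s : ℂ} (hs : s ∈ trackingRegion ω₀ δ)
    {t : ℝ} (ht : 0 < t) (ht1 : t ≤ 1) : (t : ℂ) * s ∈ trackingRegion ω₀ δ := by
  have h1 := re_pos_of_mem_trackingRegion hω₀ hδ hs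
  obtain ⟨s0, s1, s2, s3, s4⟩ := hs
  have hre : ((t : ℂ) * s).re = t * s.re := by simp
  have him : ((t : ℂ) * s).im = t * s.im := by simp
  refine ⟨mul_ne_zero (by exact_mod_cast ht.ne') s0, ?_, ?_, ?_, ?_⟩
  · rw [him]; positivity
  · rw [him]; nlinarith
  · rw [him, hre]; nlinarith
  · rw [him, hre]; nlinarith

/-- Cauchy's theorem for a triangle with one vertex at the excluded corner `0`. -/
lemma segInt_zero_add (hω₀ : 0 < ω₀) (hδ : 0 < δ) {F : ℂ → ℂ} {B : ℝ}
    (hF : DifferentiableOn ℂ F (trackingRegion ω₀ δ))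
    (hB : ∀ s ∈ trackingRegion ω₀ δ, ‖F s‖ ≤ B) {a b : ℂ} (ha : a ∈ trackingRegion ω₀ δ)
    (hb : b ∈ trackingRegion ω₀ δ) :
    segInt F 0 b = segInt F 0 a + segInt F a b := by
  obtain ⟨P, hP⟩ := exists_primitive_segInt (convex_trackingRegion hω₀ hδ) hF
  have hB0 : 0 ≤ B := (norm_nonneg _).trans (hB a ha)
  -- truncation of a segment that starts at the corner
  have htrunc : ∀ c ∈ trackingRegion ω₀ δ, ∀ τ : ℝ, 0 < τ → τ ≤ 1 →
      ‖segInt F 0 c - segInt F (τ * c) c‖ ≤ ‖c‖ * B * τ := by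
    intro c hc τ hτ hτ1
    have hint : ∀ r, 0 ≤ r → r ≤ 1 → IntervalIntegrable (fun t : ℝ => F (t * c)) volume 0 r := by
      intro r hr hr1
      refine intervalIntegrable_of_continuousOn_Ioc (K := B) hr ?_ ?_
      · exact hF.continuousOn.comp (by fun_prop) fun t ht =>
          smul_mem_trackingRegion hω₀ hδ hc ht.1 (ht.2.trans hr1)
      · exact fun t ht => hB _ (smul_mem_trackingRegion hω₀ hδ hc ht.1 (ht.2.trans hr1))
    have e1 : segInt F 0 c = c * ∫ t in (0 : ℝ)..1, F (t * c) := by simp [segInt]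
    have e2 : segInt F (τ * c) c = c * ∫ t in τ..1, F (t * c) := by
      have h := intervalIntegral.smul_integral_comp_add_mul (a := 0) (b := 1)
        (fun t : ℝ => F (t * c)) (1 - τ) τ
      simp only [mul_zero, add_zero, mul_one, add_sub_cancel] at h
      rw [← h, segInt, Complex.real_smul]
      push_cast
      rw [show (c - τ * c) = c * (1 - (τ : ℂ)) by ring, mul_assoc]
      congr 2
      refine intervalIntegral.integral_congr fun t _ => ?_
      congr 1
      ring
    rw [e1, e2, ← mul_sub,
      intervalIntegral.integral_interval_sub_interval_comm (hint 1 zero_le_one le_rfl)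
        (((hint τ hτ.le hτ1).symm).trans (hint 1 zero_le_one le_rfl)) (hint τ hτ.le hτ1),
      intervalIntegral.integral_same, sub_zero, norm_mul, mul_assoc]
    gcongr
    have := intervalIntegral.norm_integral_le_of_norm_le_const (a := (0 : ℝ)) (b := τ)
      (f := fun t : ℝ => F (t * c)) (C := B) (fun t ht => by
        rw [uIoc_of_le hτ.le] at ht
        exact hB _ (smul_mem_trackingRegion hω₀ hδ hc ht.1 (ht.2.trans hτ1)))
    rwa [sub_zero, abs_of_pos hτ] at this
  set D := segInt F 0 b - (segInt F 0 a + segInt F a b) with hD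
  have hbound : ∀ τ : ℝ, 0 < τ → τ ≤ 1 → ‖D‖ ≤ (‖b‖ * B + ‖a‖ * B + ‖b - a‖ * B) * τ := by
    intro τ hτ hτ1
    have ha' := smul_mem_trackingRegion hω₀ hδ ha hτ hτ1
    have hb' := smul_mem_trackingRegion hω₀ hδ hb hτ hτ1
    have h1 := htrunc a ha τ hτ hτ1
    have h2 := htrunc b hb τ hτ hτ1
    have h3 : ‖segInt F (τ * a) (τ * b)‖ ≤ ‖b - a‖ * B * τ := by
      have := norm_segInt_le (F := F) (a := τ * a) (b := τ * b) (K := B) fun t ht ht1 => hB _ (by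
        have := (convex_trackingRegion hω₀ hδ).add_smul_sub_mem ha' hb' ⟨ht.le, ht1⟩
        simpa using this)
      rw [← mul_sub, norm_mul, Complex.norm_real, Real.norm_eq_abs, abs_of_pos hτ] at this
      linarith
    have e : D = (segInt F 0 b - segInt F (τ * b) b) - (segInt F 0 a - segInt F (τ * a) a)
        - segInt F (τ * a) (τ * b) := by
      rw [hD, hP _ hb' _ hb, hP _ ha' _ ha, hP _ ha' _ hb', hP _ ha _ hb]
      ring
    rw [e]
    calc _ ≤ ‖b‖ * B * τ + ‖a‖ * B * τ + ‖b - a‖ * B * τ :=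
          (norm_sub_le _ _).trans (add_le_add ((norm_sub_le _ _).trans (add_le_add h2 h1)) h3)
      _ = _ := by ring
  have hlim : Tendsto (fun τ : ℝ => (‖b‖ * B + ‖a‖ * B + ‖b - a‖ * B) * τ) (𝓝[>] 0) (𝓝 0) := by
    have : Tendsto (fun τ : ℝ => (‖b‖ * B + ‖a‖ * B + ‖b - a‖ * B) * τ) (𝓝 0)
      (𝓝 ((‖b‖ * B + ‖a‖ * B + ‖b - a‖ * B) * 0)) := (continuous_const_mul _).tendsto _
    rw [mul_zero] at this
    exact this.mono_left nhdsWithin_le_nhds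
  have hD0 : ‖D‖ ≤ 0 := by
    refine ge_of_tendsto hlim ?_
    filter_upwards [Ioc_mem_nhdsGT (zero_lt_one (α := ℝ))] with τ hτ
    exact hbound τ hτ.1 hτ.2
  exact sub_eq_zero.1 (norm_le_zero_iff.1 hD0)

end Corner

section Laplace

lemma integral_exp_neg_le {c : ℝ} (hc : 0 < c) :
    ∫ t in (0 : ℝ)..1, Real.exp (-c * t) ≤ 1 / c := by
  have h := integral_exp_mul_complex (a := 0) (b := 1) (c := ((-c : ℝ) : ℂ))
    (by exact_mod_cast (neg_ne_zero.2 hc.ne'))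
  have h2 : ∫ t in (0 : ℝ)..1, Real.exp (-c * t) = (1 - Real.exp (-c)) / c := by
    have hd : ∀ t ∈ uIcc (0 : ℝ) 1, HasDerivAt (fun t => -Real.exp (-c * t) / c)
        (Real.exp (-c * t)) t := by
      intro t _
      have := ((((hasDerivAt_id t).const_mul (-c)).exp).neg).div_const c
      convert! this using 1
      simp only [id]
      field_simp
    rw [intervalIntegral.integral_eq_sub_of_hasDerivAt hd
      ((by fun_prop : Continuous _).intervalIntegrable _ _)]
    simp
    ring
  rw [h2]
  gcongr
  linarith [Real.exp_pos (-c)]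

lemma norm_segInt_le_of_exp {F : ℂ → ℂ} {a b : ℂ} {K c : ℝ} (hK : 0 ≤ K) (hc : 0 < c)
    (h : ∀ t : ℝ, 0 < t → t ≤ 1 → ‖F (a + t * (b - a))‖ ≤ K * Real.exp (-c * t)) :
    ‖segInt F a b‖ ≤ ‖b - a‖ * (K / c) := by
  rw [segInt, norm_mul]
  gcongr
  refine (intervalIntegral.norm_integral_le_of_norm_le zero_le_one (ae_of_all _ fun t ht =>
    h t ht.1 ht.2) ((by fun_prop : Continuous _).intervalIntegrable _ _)).trans ?_
  rw [intervalIntegral.integral_const_mul, div_eq_mul_one_div]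
  gcongr
  exact integral_exp_neg_le hc

lemma norm_exp_sub_one_sub_le (w : ℂ) :
    ‖Complex.exp w - 1 - w‖ ≤ 3 * ‖w‖ ^ 2 * max 1 (Real.exp w.re) := by
  rcases le_or_gt ‖w‖ 1 with h | h
  · have h1 := Complex.norm_exp_sub_one_sub_id_le h
    nlinarith [le_max_left 1 (Real.exp w.re), sq_nonneg ‖w‖]
  · have h1 : ‖Complex.exp w - 1 - w‖ ≤ Real.exp w.re + 1 + ‖w‖ := by
      refine (norm_sub_le _ _).trans (add_le_add ((norm_sub_le _ _).trans ?_) le_rfl)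
      rw [Complex.norm_exp, norm_one]
    have h2 := le_max_left 1 (Real.exp w.re)
    have h3 := le_max_right 1 (Real.exp w.re)
    set m := max 1 (Real.exp w.re)
    have h4 : 1 ≤ ‖w‖ ^ 2 := by nlinarith
    have h5 : ‖w‖ ≤ ‖w‖ ^ 2 := by nlinarith
    nlinarith

lemma pow_mul_exp_le {c : ℝ} (hc : 0 < c) (k : ℕ) {t : ℝ} (ht : 0 ≤ t) :
    t ^ k * Real.exp (-c * t) ≤ k.factorial * (2 / c) ^ k * Real.exp (-(c / 2) * t) := by
  have h := Real.pow_div_factorial_le_exp (c / 2 * t) (by positivity) k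
  rw [div_le_iff₀ (by positivity)] at h
  have e : Real.exp (-c * t) = Real.exp (-(c / 2) * t) * Real.exp (-(c / 2 * t)) := by
    rw [← Real.exp_add]; ring_nf
  have e2 : Real.exp (c / 2 * t) * Real.exp (-(c / 2 * t)) = 1 := by
    rw [← Real.exp_add]; simp
  calc t ^ k * Real.exp (-c * t)
      = (2 / c) ^ k * (c / 2 * t) ^ k * Real.exp (-c * t) := by
        rw [← mul_pow]; congr 2; field_simp
    _ ≤ (2 / c) ^ k * (Real.exp (c / 2 * t) * k.factorial) * Real.exp (-c * t) := by gcongr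
    _ = k.factorial * (2 / c) ^ k * Real.exp (-(c / 2) * t) *
          (Real.exp (c / 2 * t) * Real.exp (-(c / 2 * t))) := by rw [e]; ring
    _ = _ := by rw [e2, mul_one]

end Laplace

/-! ### Expansion of the exponential integral along a ray -/

/-- The exponential `exp ((2 z s - s²) / (2 ε))`, which is the quotient of the weights at the
complex times `z` and `z - s`. -/
def phase (ε : ℝ) (z s : ℂ) : ℂ := Complex.exp ((2 * z * s - s ^ 2) / (2 * (ε : ℂ)))

lemma norm_phase (ε : ℝ) (z s : ℂ) :
    ‖phase ε z s‖ = Real.exp ((2 * z * s - s ^ 2).re / (2 * ε)) := by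
  rw [phase, Complex.norm_exp]
  congr 1
  rw [show (2 * (ε : ℂ)) = ((2 * ε : ℝ) : ℂ) by push_cast; rfl, Complex.div_ofReal_re]

lemma differentiable_phase (ε : ℝ) (z : ℂ) : Differentiable ℂ (phase ε z) := by
  unfold phase; fun_prop

lemma continuous_phase (ε : ℝ) (z : ℂ) : Continuous (phase ε z) :=
  (differentiable_phase ε z).continuous

section Watson

variable {ε : ℝ} {z p a₀ a₂ : ℂ}

/-- The model integrand, in which the amplitude is linear and the Gaussian factor is replaced by
its expansion of first order. -/
def modelIntegrand (ε : ℝ) (z a₀ a₂ s : ℂ) : ℂ :=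
  (a₀ + a₂ * s - a₀ * s ^ 2 / (2 * ε)) * Complex.exp (z * s / ε)

/-- An antiderivative of `modelIntegrand`. -/
def modelPrimitive (ε : ℝ) (z a₀ a₂ s : ℂ) : ℂ :=
  (ε / z * (a₀ + a₂ * s - a₀ * s ^ 2 / (2 * ε)) - (ε / z) ^ 2 * (a₂ - a₀ * s / ε)
    - (ε / z) ^ 3 * (a₀ / ε)) * Complex.exp (z * s / ε)

lemma hasDerivAt_modelPrimitive (hε : 0 < ε) (hz : z ≠ 0) (s : ℂ) :
    HasDerivAt (modelPrimitive ε z a₀ a₂) (modelIntegrand ε z a₀ a₂ s) s := by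
  have hε' : (ε : ℂ) ≠ 0 := by exact_mod_cast hε.ne'
  have hid := hasDerivAt_id s
  have h1 : HasDerivAt (fun s : ℂ => a₀ + a₂ * s - a₀ * s ^ 2 / (2 * ε))
      (a₂ * 1 - a₀ * (2 * s) / (2 * ε)) s := by
    have := ((hid.const_mul a₂).const_add a₀).sub (((hid.fun_pow 2).const_mul a₀).div_const (2 * (ε : ℂ)))
    convert! this using 1
    simp
  have h2 : HasDerivAt (fun s : ℂ => a₂ - a₀ * s / ε) (-(a₀ * 1 / ε)) s :=
    ((hid.const_mul a₀).div_const (ε : ℂ)).const_sub a₂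
  have h3 : HasDerivAt (fun s : ℂ => Complex.exp (z * s / ε)) (Complex.exp (z * s / ε) * (z * 1 / ε)) s :=
    ((hid.const_mul z).div_const (ε : ℂ)).cexp
  have := (((h1.const_mul (ε / z)).sub (h2.const_mul ((ε / z) ^ 2))).sub_const
    ((ε / z) ^ 3 * (a₀ / ε))).mul h3
  convert! this using 1
  simp only [Pi.sub_apply, modelIntegrand]
  field_simp
  ring

lemma segInt_modelIntegrand (hε : 0 < ε) (hz : z ≠ 0) :
    segInt (modelIntegrand ε z a₀ a₂) 0 p = modelPrimitive ε z a₀ a₂ p -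
      (ε * a₀ / z - ε ^ 2 * (a₀ / z ^ 3 + a₂ / z ^ 2)) := by
  have hε' : (ε : ℂ) ≠ 0 := by exact_mod_cast hε.ne'
  have hlin : ∀ t : ℝ, HasDerivAt (fun t : ℝ => (t : ℂ) * p) p t := fun t => by
    simpa using (hasDerivAt_id t).ofReal_comp.mul_const p
  have hd : ∀ t ∈ uIcc (0 : ℝ) 1, HasDerivAt (fun t : ℝ => modelPrimitive ε z a₀ a₂ (t * p))
      (p * modelIntegrand ε z a₀ a₂ (t * p)) t := fun t _ => by
    have := (hasDerivAt_modelPrimitive (a₀ := a₀) (a₂ := a₂) hε hz ((t : ℂ) * p)).scomp t (hlin t)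
    simpa [Function.comp_def] using this
  have hc : Continuous fun t : ℝ => p * modelIntegrand ε z a₀ a₂ (t * p) := by
    unfold modelIntegrand; fun_prop
  have h := intervalIntegral.integral_eq_sub_of_hasDerivAt hd (hc.intervalIntegrable _ _)
  rw [intervalIntegral.integral_const_mul] at h
  simp only [segInt, sub_zero, zero_add]
  rw [h]
  simp only [Complex.ofReal_one, one_mul, Complex.ofReal_zero, zero_mul]
  congr 1
  simp only [modelPrimitive]
  simp
  field_simp
  ring

/-- The difference of the Laplace integrand and the model integrand on a ray of exponential decay:
it is of third order in `ε` after integration. -/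
lemma norm_integrand_sub_model_le {G : ℂ → ℂ} {κ M C : ℝ} (hε : 0 < ε) (hC : 0 ≤ C) {t : ℝ}
    (ht : 0 < t) (ht1 : t ≤ 1) (hM₀ : ‖a₀‖ ≤ M) (hM₂ : ‖a₂‖ ≤ M)
    (hp : (2 * z * p).re ≤ -κ) (hdecay : (2 * z * (t * p) - (t * p) ^ 2).re ≤ -κ * t)
    (hG : ‖G (t * p) - (a₀ + a₂ * (t * p))‖ ≤ C * t ^ 2) :
    ‖G (t * p) * phase ε z (t * p) - modelIntegrand ε z a₀ a₂ (t * p)‖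
      ≤ (C * t ^ 2 + 3 * (M + M * ‖p‖) * ‖p‖ ^ 4 / 4 * t ^ 4 / ε ^ 2
          + M * ‖p‖ ^ 3 / 2 * t ^ 3 / ε) * Real.exp (-(κ / (2 * ε)) * t) := by
  have hε' : (ε : ℂ) ≠ 0 := by exact_mod_cast hε.ne'
  set s : ℂ := t * p with hs
  set w : ℂ := -s ^ 2 / (2 * ε) with hw
  set e := Real.exp (-(κ / (2 * ε)) * t) with he
  have hM : 0 ≤ M := (norm_nonneg _).trans hM₀
  have hsn : ‖s‖ = t * ‖p‖ := by
    rw [hs, norm_mul, Complex.norm_real, Real.norm_eq_abs, abs_of_pos ht]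
  have hphase : phase ε z s = Complex.exp w * Complex.exp (z * s / ε) := by
    rw [phase, ← Complex.exp_add]
    congr 1
    rw [hw]; field_simp; ring
  have hpn : ‖phase ε z s‖ ≤ e := by
    rw [norm_phase, he]
    gcongr
    rw [div_le_iff₀ (by positivity)]
    refine hdecay.trans (le_of_eq ?_)
    field_simp
  have hen : ‖Complex.exp (z * s / ε)‖ ≤ e := by
    rw [Complex.norm_exp, he]
    gcongr
    rw [Complex.div_ofReal_re, div_le_iff₀ hε]
    have h1 : (z * s).re = t * (2 * z * p).re / 2 := by
      rw [hs, show z * (t * p) = ((t / 2 : ℝ) : ℂ) * (2 * z * p) by push_cast; ring,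
        Complex.re_ofReal_mul]
      ring
    rw [h1]
    have h2 : t * (2 * z * p).re ≤ t * (-κ) := by gcongr
    have h3 : -(κ / (2 * ε)) * t * ε = t * (-κ) / 2 := by field_simp
    rw [h3]
    linarith
  have hwn : ‖w‖ = t ^ 2 * ‖p‖ ^ 2 / (2 * ε) := by
    rw [hw, norm_div, norm_neg, norm_pow, hsn, norm_mul, Complex.norm_real, Real.norm_eq_abs,
      abs_of_pos hε]
    simp
    ring
  have hrem : ‖(Complex.exp w - 1 - w) * Complex.exp (z * s / ε)‖ ≤ 3 * ‖w‖ ^ 2 * e := by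
    rw [norm_mul]
    have h1 := norm_exp_sub_one_sub_le w
    have h2 : max 1 (Real.exp w.re) * ‖Complex.exp (z * s / ε)‖ ≤ e := by
      rw [max_mul_of_nonneg _ _ (norm_nonneg _), one_mul, ← Complex.norm_exp, ← norm_mul, ← hphase]
      exact max_le hen hpn
    calc _ ≤ 3 * ‖w‖ ^ 2 * max 1 (Real.exp w.re) * ‖Complex.exp (z * s / ε)‖ := by gcongr
      _ = 3 * ‖w‖ ^ 2 * (max 1 (Real.exp w.re) * ‖Complex.exp (z * s / ε)‖) := by ring
      _ ≤ _ := by gcongr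
  have hT : ‖a₀ + a₂ * s‖ ≤ M + M * ‖p‖ := by
    refine (norm_add_le _ _).trans (add_le_add hM₀ ?_)
    rw [norm_mul, hsn]
    have : t * ‖p‖ ≤ ‖p‖ := mul_le_of_le_one_left (norm_nonneg _) ht1
    gcongr
  have hdec : G s * phase ε z s - modelIntegrand ε z a₀ a₂ s =
      (G s - (a₀ + a₂ * s)) * phase ε z s +
      (a₀ + a₂ * s) * ((Complex.exp w - 1 - w) * Complex.exp (z * s / ε)) +
      a₂ * s * w * Complex.exp (z * s / ε) := by
    rw [hphase, modelIntegrand, show a₀ * s ^ 2 / (2 * (ε : ℂ)) = -(a₀ * w) by rw [hw]; ring]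
    ring
  rw [hdec]
  have t1 : ‖(G s - (a₀ + a₂ * s)) * phase ε z s‖ ≤ C * t ^ 2 * e := by
    rw [norm_mul]; gcongr
  have t2 : ‖(a₀ + a₂ * s) * ((Complex.exp w - 1 - w) * Complex.exp (z * s / ε))‖
      ≤ 3 * (M + M * ‖p‖) * ‖p‖ ^ 4 / 4 * t ^ 4 / ε ^ 2 * e := by
    rw [norm_mul]
    calc _ ≤ (M + M * ‖p‖) * (3 * ‖w‖ ^ 2 * e) := by gcongr
      _ = _ := by rw [hwn]; field_simp; ring
  have t3 : ‖a₂ * s * w * Complex.exp (z * s / ε)‖ ≤ M * ‖p‖ ^ 3 / 2 * t ^ 3 / ε * e := by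
    rw [norm_mul, norm_mul, norm_mul]
    calc _ ≤ M * ‖s‖ * ‖w‖ * e := by gcongr
      _ = _ := by rw [hwn, hsn]; field_simp
  calc _ ≤ C * t ^ 2 * e + 3 * (M + M * ‖p‖) * ‖p‖ ^ 4 / 4 * t ^ 4 / ε ^ 2 * e
        + M * ‖p‖ ^ 3 / 2 * t ^ 3 / ε * e :=
        (norm_add_le _ _).trans (add_le_add ((norm_add_le _ _).trans (add_le_add t1 t2)) t3)
    _ = _ := by ring

lemma exp_neg_div_le {κ : ℝ} (hκ : 0 < κ) (hε : 0 < ε) :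
    Real.exp (-κ / (2 * ε)) ≤ 6 * (2 / κ) ^ 3 * ε ^ 3 := by
  have h := Real.pow_div_factorial_le_exp (κ / (2 * ε)) (by positivity) 3
  rw [neg_div, Real.exp_neg, inv_le_comm₀ (Real.exp_pos _) (by positivity)]
  refine le_trans (le_of_eq ?_) h
  norm_num [Nat.factorial]
  field_simp

lemma norm_modelPrimitive_le {κ M ω₀ : ℝ} (hε : 0 < ε) (hε1 : ε ≤ 1) (hω₀ : 0 < ω₀)
    (hz : ω₀ ≤ ‖z‖) (hM₀ : ‖a₀‖ ≤ M) (hM₂ : ‖a₂‖ ≤ M) (hp : (2 * z * p).re ≤ -κ) :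
    ‖modelPrimitive ε z a₀ a₂ p‖ ≤
      (1 / ω₀ * (M + M * ‖p‖ + M * ‖p‖ ^ 2) + (1 / ω₀) ^ 2 * (M + M * ‖p‖) + (1 / ω₀) ^ 3 * M)
        * Real.exp (-κ / (2 * ε)) := by
  have hM : 0 ≤ M := (norm_nonneg _).trans hM₀
  have hz0 : 0 < ‖z‖ := hω₀.trans_le hz
  have hzc : z ≠ 0 := norm_pos_iff.1 hz0
  have hε' : (ε : ℂ) ≠ 0 := by exact_mod_cast hε.ne'
  have hεn : ‖(ε : ℂ)‖ = ε := by rw [Complex.norm_real, Real.norm_eq_abs, abs_of_pos hε]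
  have hi : ‖z‖⁻¹ ≤ 1 / ω₀ := by rw [one_div]; gcongr
  rw [modelPrimitive, norm_mul]
  have hexp : ‖Complex.exp (z * p / ε)‖ ≤ Real.exp (-κ / (2 * ε)) := by
    rw [Complex.norm_exp]
    gcongr
    rw [Complex.div_ofReal_re, div_le_div_iff₀ hε (by positivity)]
    have : (2 * z * p).re = 2 * (z * p).re := by
      rw [mul_assoc, show (2 : ℂ) = ((2 : ℝ) : ℂ) by norm_num, Complex.re_ofReal_mul]
    nlinarith
  have e : (ε : ℂ) / z * (a₀ + a₂ * p - a₀ * p ^ 2 / (2 * ε)) - (ε / z) ^ 2 * (a₂ - a₀ * p / ε)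
      - (ε / z) ^ 3 * (a₀ / ε) =
      z⁻¹ * (ε * a₀ + ε * a₂ * p - a₀ * p ^ 2 / 2) - z⁻¹ ^ 2 * (ε ^ 2 * a₂ - ε * (a₀ * p))
        - z⁻¹ ^ 3 * (ε ^ 2 * a₀) := by
    field_simp
  have b1 : ‖(ε : ℂ) * a₀ + ε * a₂ * p - a₀ * p ^ 2 / 2‖ ≤ M + M * ‖p‖ + M * ‖p‖ ^ 2 := by
    refine (norm_sub_le _ _).trans (add_le_add ((norm_add_le _ _).trans (add_le_add ?_ ?_)) ?_)
    · rw [norm_mul, hεn]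
      calc ε * ‖a₀‖ ≤ 1 * M := by gcongr
        _ = M := one_mul M
    · rw [norm_mul, norm_mul, hεn]
      calc ε * ‖a₂‖ * ‖p‖ ≤ 1 * M * ‖p‖ := by gcongr
        _ = _ := by rw [one_mul]
    · rw [norm_div, norm_mul, norm_pow, Complex.norm_ofNat]
      calc ‖a₀‖ * ‖p‖ ^ 2 / 2 ≤ ‖a₀‖ * ‖p‖ ^ 2 := half_le_self (by positivity)
        _ ≤ _ := by gcongr
  have hε2 : ε ^ 2 ≤ 1 := pow_le_one₀ hε.le hε1
  have b2 : ‖(ε : ℂ) ^ 2 * a₂ - ε * (a₀ * p)‖ ≤ M + M * ‖p‖ := by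
    refine (norm_sub_le _ _).trans (add_le_add ?_ ?_)
    · rw [norm_mul, norm_pow, hεn]
      calc ε ^ 2 * ‖a₂‖ ≤ 1 * M := by gcongr
        _ = M := one_mul M
    · rw [norm_mul, norm_mul, hεn]
      calc ε * (‖a₀‖ * ‖p‖) ≤ 1 * (M * ‖p‖) := by gcongr
        _ = _ := by rw [one_mul]
  have b3 : ‖(ε : ℂ) ^ 2 * a₀‖ ≤ M := by
    rw [norm_mul, norm_pow, hεn]
    calc ε ^ 2 * ‖a₀‖ ≤ 1 * M := by gcongr
      _ = M := one_mul M
  rw [e]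
  gcongr
  refine (norm_sub_le _ _).trans (add_le_add ((norm_sub_le _ _).trans (add_le_add ?_ ?_)) ?_)
  · rw [norm_mul, norm_inv]; gcongr
  · rw [norm_mul, norm_pow, norm_inv]; gcongr
  · rw [norm_mul, norm_pow, norm_inv]; gcongr

/-- Laplace expansion at the endpoint `0` along a ray on which the exponential decays. -/
lemma exists_ray_expansion (p : ℂ) {κ M C ω₀ : ℝ} (hκ : 0 < κ) (hM : 0 ≤ M) (hC : 0 ≤ C)
    (hω₀ : 0 < ω₀) : ∃ K : ℝ, 0 ≤ K ∧ ∀ (ε : ℝ) (z : ℂ) (G : ℂ → ℂ) (a₀ a₂ : ℂ),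
      0 < ε → ε ≤ 1 → ω₀ ≤ ‖z‖ → (2 * z * p).re ≤ -κ →
      (∀ t : ℝ, 0 < t → t ≤ 1 → (2 * z * (t * p) - (t * p) ^ 2).re ≤ -κ * t) →
      ‖a₀‖ ≤ M → ‖a₂‖ ≤ M → ContinuousOn (fun t : ℝ => G (t * p)) (Ioc 0 1) →
      (∀ t : ℝ, 0 < t → t ≤ 1 → ‖G (t * p) - (a₀ + a₂ * (t * p))‖ ≤ C * t ^ 2) →
      ‖segInt (fun s => G s * phase ε z s) 0 p
        - (-(ε * a₀ / z) + ε ^ 2 * (a₀ / z ^ 3 + a₂ / z ^ 2))‖ ≤ K * ε ^ 3 := by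
  set K₁ := (1 / ω₀ * (M + M * ‖p‖ + M * ‖p‖ ^ 2) + (1 / ω₀) ^ 2 * (M + M * ‖p‖)
    + (1 / ω₀) ^ 3 * M) with hK₁
  set K₄ := 3 * (M + M * ‖p‖) * ‖p‖ ^ 4 / 4 with hK₄
  set K₃ := M * ‖p‖ ^ 3 / 2 with hK₃
  set K₅ := 2 * C * (4 / κ) ^ 2 + 24 * K₄ * (4 / κ) ^ 4 + 6 * K₃ * (4 / κ) ^ 3 with hK₅
  refine ⟨K₁ * (6 * (2 / κ) ^ 3) + ‖p‖ * (K₅ * (4 / κ)), by positivity, ?_⟩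
  intro ε z G a₀ a₂ hε hε1 hz hp hdecay hM₀ hM₂ hGc hG
  have hz0 : z ≠ 0 := norm_pos_iff.1 (hω₀.trans_le hz)
  set F : ℂ → ℂ := fun s => G s * phase ε z s with hF
  have hpoint : ∀ t : ℝ, 0 < t → t ≤ 1 →
      ‖F (t * p) - modelIntegrand ε z a₀ a₂ (t * p)‖
        ≤ ε ^ 2 * K₅ * Real.exp (-(κ / (4 * ε)) * t) := by
    intro t ht ht1
    refine (norm_integrand_sub_model_le hε hC ht ht1 hM₀ hM₂ hp (hdecay t ht ht1)
      (hG t ht ht1)).trans ?_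
    have hc : 0 < κ / (2 * ε) := by positivity
    have q2 := pow_mul_exp_le hc 2 ht.le
    have q3 := pow_mul_exp_le hc 3 ht.le
    have q4 := pow_mul_exp_le hc 4 ht.le
    rw [show κ / (2 * ε) / 2 = κ / (4 * ε) by field_simp; norm_num,
      show 2 / (κ / (2 * ε)) = 4 / κ * ε by field_simp; norm_num] at q2 q3 q4
    set e := Real.exp (-(κ / (2 * ε)) * t)
    set e' := Real.exp (-(κ / (4 * ε)) * t)
    norm_num [Nat.factorial] at q2 q3 q4
    calc (C * t ^ 2 + K₄ * t ^ 4 / ε ^ 2 + K₃ * t ^ 3 / ε) * e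
        = C * (t ^ 2 * e) + K₄ / ε ^ 2 * (t ^ 4 * e) + K₃ / ε * (t ^ 3 * e) := by ring
      _ ≤ C * (2 * (4 / κ * ε) ^ 2 * e') + K₄ / ε ^ 2 * (24 * (4 / κ * ε) ^ 4 * e')
          + K₃ / ε * (6 * (4 / κ * ε) ^ 3 * e') := by gcongr
      _ = _ := by rw [hK₅]; field_simp
  have hint1 : IntervalIntegrable (fun t : ℝ => F (t * p)) volume 0 1 := by
    refine intervalIntegrable_of_continuousOn_Ioc (K := C + (M + M * ‖p‖)) zero_le_one
      (hGc.mul ((continuous_phase ε z).comp (by fun_prop)).continuousOn) fun t ht => ?_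
    have h1 : ‖phase ε z (t * p)‖ ≤ 1 := by
      rw [norm_phase, Real.exp_le_one_iff]
      refine div_nonpos_of_nonpos_of_nonneg ((hdecay t ht.1 ht.2).trans ?_) (by positivity)
      have := mul_pos hκ ht.1
      linarith
    have h2 : ‖G (t * p)‖ ≤ C + (M + M * ‖p‖) := by
      have e : G (t * p) = (G (t * p) - (a₀ + a₂ * (t * p))) + (a₀ + a₂ * (t * p)) := by ring
      rw [e]
      refine (norm_add_le _ _).trans (add_le_add ((hG t ht.1 ht.2).trans ?_)
        ((norm_add_le _ _).trans (add_le_add hM₀ ?_)))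
      · exact mul_le_of_le_one_right hC (pow_le_one₀ ht.1.le ht.2)
      · rw [norm_mul, norm_mul, Complex.norm_real, Real.norm_eq_abs, abs_of_pos ht.1]
        have ht0 := ht.1.le
        have : t * ‖p‖ ≤ ‖p‖ := mul_le_of_le_one_left (norm_nonneg _) ht.2
        gcongr
    simp only [hF]
    rw [norm_mul]
    calc _ ≤ (C + (M + M * ‖p‖)) * 1 := by gcongr
      _ = _ := mul_one _
  have hint2 : IntervalIntegrable (fun t : ℝ => modelIntegrand ε z a₀ a₂ (t * p)) volume 0 1 := by
    refine Continuous.intervalIntegrable ?_ _ _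
    unfold modelIntegrand; fun_prop
  have hsub : segInt F 0 p - segInt (modelIntegrand ε z a₀ a₂) 0 p =
      segInt (fun s => F s - modelIntegrand ε z a₀ a₂ s) 0 p := by
    simp only [segInt, sub_zero, zero_add]
    rw [intervalIntegral.integral_sub hint1 hint2, mul_sub]
  have h1 : ‖segInt (fun s => F s - modelIntegrand ε z a₀ a₂ s) 0 p‖
      ≤ ‖p‖ * (K₅ * (4 / κ)) * ε ^ 3 := by
    have := norm_segInt_le_of_exp (F := fun s => F s - modelIntegrand ε z a₀ a₂ s) (a := 0) (b := p)
      (K := ε ^ 2 * K₅) (c := κ / (4 * ε)) (by positivity) (by positivity) (fun t ht ht1 => by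
        simpa using hpoint t ht ht1)
    refine this.trans (le_of_eq ?_)
    rw [sub_zero]
    field_simp
  have h2 := norm_modelPrimitive_le (p := p) hε hε1 hω₀ hz hM₀ hM₂ hp
  have h3 : ‖modelPrimitive ε z a₀ a₂ p‖ ≤ K₁ * (6 * (2 / κ) ^ 3 * ε ^ 3) := by
    refine h2.trans ?_
    gcongr
    exact exp_neg_div_le hκ hε
  have e : segInt F 0 p - (-(ε * a₀ / z) + ε ^ 2 * (a₀ / z ^ 3 + a₂ / z ^ 2)) =
      segInt (fun s => F s - modelIntegrand ε z a₀ a₂ s) 0 p + modelPrimitive ε z a₀ a₂ p := by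
    rw [← hsub, segInt_modelIntegrand hε hz0]
    ring
  rw [e]
  calc _ ≤ ‖p‖ * (K₅ * (4 / κ)) * ε ^ 3 + K₁ * (6 * (2 / κ) ^ 3 * ε ^ 3) :=
        (norm_add_le _ _).trans (add_le_add h1 h3)
    _ = _ := by ring

end Watson

/-! ### Contour deformation in the tracking region -/

/-- The analytic and metric facts about the continued heat flow that the contour argument uses:
it is holomorphic and bounded by `B` on the tracking region and on a convex set `V`, where it is
also `Λ`-Lipschitz; `V` contains the horizontal `η`-neighbourhood of the part of the tracking region
away from the corner. All constants are uniform in `x`. -/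
structure IsTrackingNhd (ω₀ δ : ℝ) (g : ℝ → ℂ → ℂ) (V : Set ℂ) (η Λ B : ℝ) : Prop where
  η_pos : 0 < η
  η_le : η ≤ δ / 2
  Λ_nonneg : 0 ≤ Λ
  B_nonneg : 0 ≤ B
  convex : Convex ℝ V
  near : ∀ s ∈ trackingRegion ω₀ δ, δ / 2 ≤ s.re → ∀ r : ℝ, |r| ≤ η → s + r ∈ V
  differentiableOn : ∀ x, DifferentiableOn ℂ (g x) V
  bound : ∀ x, ∀ s ∈ V, ‖g x s‖ ≤ B
  lipschitz : ∀ x, ∀ a ∈ V, ∀ b ∈ V, ‖g x a - g x b‖ ≤ Λ * ‖a - b‖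
  differentiableOn_region : ∀ x, DifferentiableOn ℂ (g x) (trackingRegion ω₀ δ)
  bound_region : ∀ x, ∀ s ∈ trackingRegion ω₀ δ, ‖g x s‖ ≤ B
  bound_ofReal : ∀ x s : ℝ, 0 < s → ‖g x s‖ ≤ B
  continuousOn_ofReal : ∀ x, ContinuousOn (fun s : ℝ => g x s) (Ioi 0)

/-- The part of the tracking region with `δ / 2 ≤ Re s` is compact and convex, so that a
thickening of it still lies in the domain of analyticity; Cauchy's estimate gives the Lipschitz
constant. -/
lemma IsHeatContinuation.exists_isTrackingNhd {ω₀ δ : ℝ} {d : ℂ} {Ia : ℝ → ℝ} {g : ℝ → ℂ → ℂ}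
    (hω₀ : 0 < ω₀) (hδ : 0 < δ) (hd : 0 < d.re) (hIa : HasBoundedDerivs Ia)
    (hg : IsHeatContinuation ω₀ δ d Ia g) :
    ∃ V η Λ B, IsTrackingNhd ω₀ δ g V η Λ B := by
  obtain ⟨M, hT⟩ := hIa.exists_isDerivTower
  obtain ⟨hgr, U, hU, hQU, hgU, B, hB⟩ := hg
  set Q : Set ℂ := {s | δ / 2 ≤ s.re ∧ 0 ≤ s.im ∧ s.im ≤ ω₀ ∧ δ * s.im ≤ ω₀ * s.re ∧
    s.re + s.im ≤ 2 * ω₀} with hQ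
  have hQsub : Q ⊆ trackingRegion ω₀ δ := fun s hs =>
    ⟨fun h => by have := hs.1; rw [h] at this; simp at this; linarith, hs.2⟩
  have hQclosed : IsClosed Q := by
    have c1 := Complex.continuous_re
    have c2 := Complex.continuous_im
    refine (isClosed_le continuous_const c1).inter ((isClosed_le continuous_const c2).inter
      ((isClosed_le c2 continuous_const).inter ((isClosed_le (c2.const_mul δ) (c1.const_mul ω₀)).inter
        (isClosed_le (c1.add c2) continuous_const))))
  have hQconv : Convex ℝ Q := by
    have h1 : Q = {s : ℂ | δ / 2 ≤ s.re} ∩ trackingRegion ω₀ δ :=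
      Subset.antisymm (fun s hs => ⟨hs.1, hQsub hs⟩) fun s hs => ⟨hs.1, hs.2.2⟩
    rw [h1]
    exact (convex_halfSpace_re_ge _).inter (convex_trackingRegion hω₀ hδ)
  have hQcomp : IsCompact Q := Metric.isCompact_of_isClosed_isBounded hQclosed
    ((Metric.isBounded_closedBall (x := (0 : ℂ)) (r := 2 * ω₀)).subset fun s hs => by
      simpa using norm_le_of_mem_trackingRegion hω₀ hδ (hQsub hs))
  obtain ⟨r, hr, hrU⟩ := hQcomp.exists_thickening_subset_open hU (hQsub.trans hQU)
  set V := Metric.thickening (r / 2) Q with hV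
  have hVU : V ⊆ U := (Metric.thickening_mono (by linarith) Q).trans hrU
  have hVconv : Convex ℝ V := hQconv.thickening _
  have hB' : 0 ≤ B := by
    refine (norm_nonneg _).trans (hB 0 ((ω₀ : ℝ) : ℂ) (hQU ?_))
    refine ⟨by exact_mod_cast hω₀.ne', by simp, by simpa using hω₀.le, ?_, ?_⟩
    · simp; positivity
    · simp; linarith
  have hball : ∀ s ∈ V, Metric.closedBall s (r / 4) ⊆ U := by
    intro s hs y hy
    apply hrU
    obtain ⟨q, hq, hsq⟩ := Metric.mem_thickening_iff.1 hs
    refine Metric.mem_thickening_iff.2 ⟨q, hq, ?_⟩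
    have := dist_triangle y s q
    have := Metric.mem_closedBall.1 hy
    linarith
  have hder : ∀ x, ∀ s ∈ V, ‖deriv (g x) s‖ ≤ B / (r / 4) := by
    intro x s hs
    refine Complex.norm_deriv_le_of_forall_mem_sphere_norm_le (by positivity) ?_ fun y hy =>
      hB x y (hball s hs (Metric.sphere_subset_closedBall hy))
    refine DifferentiableOn.diffContOnCl fun y hy => ?_
    exact (hgU x y (hball s hs (Metric.closure_ball_subset_closedBall hy))).differentiableAt.differentiableWithinAt
  refine ⟨V, min (r / 4) (δ / 2), B / (r / 4), max B (kernelMass d * M 0), by positivity,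
    min_le_right _ _, by positivity, le_max_of_le_left hB', hVconv, ?_, ?_, ?_, ?_, ?_, ?_, ?_, ?_⟩
  · intro s hs hsre t ht
    refine Metric.mem_thickening_iff.2 ⟨s, ⟨hsre, hs.2⟩, ?_⟩
    rw [dist_eq_norm, add_sub_cancel_left, Complex.norm_real, Real.norm_eq_abs]
    have := ht.trans (min_le_left _ _)
    linarith
  · exact fun x s hs => (hgU x s (hVU hs)).differentiableAt.differentiableWithinAt
  · exact fun x s hs => (hB x s (hVU hs)).trans (le_max_left _ _)
  · exact fun x a ha b hb => hVconv.norm_image_sub_le_of_norm_deriv_le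
      (fun s hs => (hgU x s (hVU hs)).differentiableAt) (hder x) hb ha
  · exact fun x s hs => (hgU x s (hQU hs)).differentiableAt.differentiableWithinAt
  · exact fun x s hs => (hB x s (hQU hs)).trans (le_max_left _ _)
  · intro x s hs
    rw [hgr x s hs, heatFlow_eq_heatAvg hd _ x hs, ← sourceDeriv_zero]
    exact (norm_heatAvg_le hd (hT.bound 0) x s).trans (le_max_right _ _)
  · intro x
    refine ((hT.continuous_heatAvg_right hd 0 x).continuousOn (s := Ioi 0)).congr fun s hs => ?_
    simp only
    rw [hgr x s hs, heatFlow_eq_heatAvg hd _ x hs, ← sourceDeriv_zero]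

/-- The integrand of the particular solution in the complexified time `s`. -/
def flowIntegrand (g : ℝ → ℂ → ℂ) (ε ω₀ x μ : ℝ) (s : ℂ) : ℂ := g x s * phase ε (cz ω₀ μ) s

lemma re_phase_exponent (ω₀ μ : ℝ) (s : ℂ) :
    (2 * cz ω₀ μ * s - s ^ 2).re = 2 * (μ * s.re - ω₀ * s.im) - s.re ^ 2 + s.im ^ 2 := by
  simp [cz, sq]
  ring

/-- Along a segment that is steeper than the diagonal the height `Re (2 z s - s²)` is convex. -/
lemma re_phase_exponent_segment_le {ω₀ μ K t : ℝ} {a b : ℂ} (ht : 0 ≤ t) (ht1 : t ≤ 1)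
    (hab : (b.re - a.re) ^ 2 ≤ (b.im - a.im) ^ 2)
    (ha : (2 * cz ω₀ μ * a - a ^ 2).re ≤ K) (hb : (2 * cz ω₀ μ * b - b ^ 2).re ≤ K) :
    (2 * cz ω₀ μ * (a + t * (b - a)) - (a + t * (b - a)) ^ 2).re ≤ K := by
  rw [re_phase_exponent] at *
  have hre : (a + (t : ℂ) * (b - a)).re = a.re + t * (b.re - a.re) := by simp
  have him : (a + (t : ℂ) * (b - a)).im = a.im + t * (b.im - a.im) := by simp
  rw [hre, him]
  nlinarith [mul_le_mul_of_nonneg_left ha (sub_nonneg.2 ht1), mul_le_mul_of_nonneg_left hb ht,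
    mul_le_mul_of_nonneg_left hab (mul_nonneg ht (sub_nonneg.2 ht1))]

lemma norm_flowIntegrand_le {g : ℝ → ℂ → ℂ} {ε ω₀ x μ B K : ℝ} {s : ℂ} (hε : 0 < ε) (hB : ‖g x s‖ ≤ B)
    (hK : (2 * cz ω₀ μ * s - s ^ 2).re ≤ K) :
    ‖flowIntegrand g ε ω₀ x μ s‖ ≤ B * Real.exp (K / (2 * ε)) := by
  rw [flowIntegrand, norm_mul, norm_phase]
  have := (norm_nonneg _).trans hB
  gcongr

lemma le_norm_cz {ω₀ : ℝ} (hω₀ : 0 < ω₀) (μ : ℝ) : ω₀ ≤ ‖cz ω₀ μ‖ := by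
  have := Complex.abs_im_le_norm (cz ω₀ μ)
  have h : (cz ω₀ μ).im = ω₀ := by simp [cz]
  rwa [h, abs_of_pos hω₀] at this

lemma Ap_eq_segInt {ω₀ μ₀ ε : ℝ} {d : ℂ} {Ia : ℝ → ℝ} {g : ℝ → ℂ → ℂ} (hε : 0 < ε)
    (hgr : ∀ x s : ℝ, 0 < s → g x (s : ℂ) = heatFlow d (fun y => (Ia y : ℂ)) x s) (x : ℝ) {μ : ℝ}
    (hμ : μ₀ ≤ μ) :
    Ap ε ω₀ d Ia μ₀ x μ =
      1 / (Real.sqrt ε : ℂ) * segInt (flowIntegrand g ε ω₀ x μ) 0 ((μ - μ₀ : ℝ) : ℂ) := by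
  have hε' : (ε : ℂ) ≠ 0 := by exact_mod_cast hε.ne'
  rw [← Complex.ofReal_zero, segInt_ofReal]
  unfold Ap Bp
  rw [mul_assoc]
  congr 1
  have h := intervalIntegral.integral_comp_sub_left (a := μ₀) (b := μ)
    (fun s : ℝ => flowIntegrand g ε ω₀ x μ s) μ
  rw [sub_self] at h
  rw [← h, ← intervalIntegral.integral_mul_const]
  refine intervalIntegral.integral_congr_ae ?_
  filter_upwards [Measure.ae_ne volume μ] with m hm hmem
  rw [uIoc_of_le hμ] at hmem
  have hpos : 0 < μ - m := sub_pos.2 (lt_of_le_of_ne hmem.2 hm)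
  rw [flowIntegrand, hgr x _ hpos, mul_assoc, ← Complex.exp_add, phase]
  congr 2
  simp only [cz]
  push_cast
  field_simp
  ring

/-- The quasi-steady state in terms of the coefficients of the Laplace expansion. -/
lemma qss_eq {ω₀ ε : ℝ} (hω₀ : 0 < ω₀) (hε : 0 < ε) (d : ℂ) (Ia : ℝ → ℝ) (x μ : ℝ) :
    qss ε ω₀ d Ia x μ = 1 / (Real.sqrt ε : ℂ) *
      (-(ε * sourceDeriv Ia 0 x / cz ω₀ μ) + ε ^ 2 * (sourceDeriv Ia 0 x / cz ω₀ μ ^ 3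
        + d * sourceDeriv Ia 2 x / cz ω₀ μ ^ 2)) := by
  have hz : cz ω₀ μ ≠ 0 := norm_pos_iff.1 (hω₀.trans_le (le_norm_cz hω₀ μ))
  have hr := Real.sqrt_pos.2 hε
  have hr' : (Real.sqrt ε : ℂ) ≠ 0 := by exact_mod_cast hr.ne'
  have hss : (ε : ℂ) = (Real.sqrt ε : ℂ) ^ 2 := by
    rw [← Complex.ofReal_pow, Real.sq_sqrt hε.le]
  have h32 : ε ^ (3 / 2 : ℝ) = Real.sqrt ε ^ 3 := by
    rw [Real.sqrt_eq_rpow, ← Real.rpow_natCast, ← Real.rpow_mul hε.le]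
    norm_num
  have h0 : sourceDeriv Ia 0 x = (Ia x : ℂ) := by simp [sourceDeriv]
  rw [qss, h32, hss, h0, sourceDeriv]
  push_cast
  field_simp

lemma norm_inv_sqrt_mul_le {ε K : ℝ} {D : ℂ} (hε : 0 < ε) (hD : ‖D‖ ≤ K * ε ^ 3) :
    ‖1 / (Real.sqrt ε : ℂ) * D‖ ≤ K * ε ^ (5 / 2 : ℝ) := by
  have hr := Real.sqrt_pos.2 hε
  rw [norm_mul, norm_div, norm_one, Complex.norm_real, Real.norm_eq_abs, abs_of_pos hr]
  have h : ε ^ 3 = ε ^ (5 / 2 : ℝ) * Real.sqrt ε := by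
    rw [Real.sqrt_eq_rpow, ← Real.rpow_add hε, ← Real.rpow_natCast]
    norm_num
  rw [h] at hD
  calc 1 / Real.sqrt ε * ‖D‖ ≤ 1 / Real.sqrt ε * (K * (ε ^ (5 / 2 : ℝ) * Real.sqrt ε)) := by gcongr
    _ = _ := by field_simp

section Contour

variable {ω₀ δ : ℝ} {g : ℝ → ℂ → ℂ} {V : Set ℂ} {η Λ B : ℝ}

namespace IsTrackingNhd

lemma differentiableOn_flowIntegrand (hV : IsTrackingNhd ω₀ δ g V η Λ B) (ε x μ : ℝ) :
    DifferentiableOn ℂ (flowIntegrand g ε ω₀ x μ) V :=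
  (hV.differentiableOn x).mul (differentiable_phase _ _).differentiableOn

lemma differentiableOn_flowIntegrand_region (hV : IsTrackingNhd ω₀ δ g V η Λ B) (ε x μ : ℝ) :
    DifferentiableOn ℂ (flowIntegrand g ε ω₀ x μ) (trackingRegion ω₀ δ) :=
  (hV.differentiableOn_region x).mul (differentiable_phase _ _).differentiableOn

lemma exists_bound_flowIntegrand_region (hV : IsTrackingNhd ω₀ δ g V η Λ B) (hω₀ : 0 < ω₀)
    (hδ : 0 < δ) (ε x μ : ℝ) :
    ∃ K, ∀ s ∈ trackingRegion ω₀ δ, ‖flowIntegrand g ε ω₀ x μ s‖ ≤ K := by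
  obtain ⟨K, hK⟩ := (isCompact_closedBall (0 : ℂ) (2 * ω₀)).exists_bound_of_continuousOn
    (continuous_phase ε (cz ω₀ μ)).continuousOn
  refine ⟨B * K, fun s hs => ?_⟩
  have h1 := hV.bound_region x s hs
  have h2 := hK s (by simpa using norm_le_of_mem_trackingRegion hω₀ hδ hs)
  have := hV.B_nonneg
  rw [flowIntegrand, norm_mul]
  gcongr

/-- Splitting of the integral along the positive axis. -/
lemma segInt_ofReal_add (hV : IsTrackingNhd ω₀ δ g V η Λ B) (ε x μ : ℝ) {a b : ℝ} (ha : 0 < a)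
    (hb : 0 < b) :
    segInt (flowIntegrand g ε ω₀ x μ) 0 b =
      segInt (flowIntegrand g ε ω₀ x μ) 0 a + segInt (flowIntegrand g ε ω₀ x μ) a b := by
  have hint : ∀ c : ℝ, 0 < c →
      IntervalIntegrable (fun s : ℝ => flowIntegrand g ε ω₀ x μ s) volume 0 c := by
    intro c hc
    have hp : Continuous fun s : ℝ => phase ε (cz ω₀ μ) s :=
      (continuous_phase ε (cz ω₀ μ)).comp Complex.continuous_ofReal
    obtain ⟨K, hK⟩ := (isCompact_Icc (a := 0) (b := c)).exists_bound_of_continuousOn hp.continuousOn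
    refine intervalIntegrable_of_continuousOn_Ioc (K := B * K) hc.le
      (((hV.continuousOn_ofReal x).mono Ioc_subset_Ioi_self).mul hp.continuousOn) fun s hs => ?_
    have h1 := hV.bound_ofReal x s hs.1
    have h2 := hK s (Ioc_subset_Icc_self hs)
    have := hV.B_nonneg
    rw [flowIntegrand, norm_mul]
    gcongr
  rw [← Complex.ofReal_zero, segInt_ofReal, segInt_ofReal, segInt_ofReal,
    intervalIntegral.integral_add_adjacent_intervals (hint a ha)
      ((hint a ha).symm.trans (hint b hb))]

end IsTrackingNhd

end Contour

/-! ### The regimes without a Stokes term -/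

/-- The quasi-steady state multiplied by `√ε`, as it arises from the Laplace expansion. -/
def scaledQss (ε ω₀ : ℝ) (d : ℂ) (Ia : ℝ → ℝ) (x μ : ℝ) : ℂ :=
  -(ε * sourceDeriv Ia 0 x / cz ω₀ μ) + ε ^ 2 * (sourceDeriv Ia 0 x / cz ω₀ μ ^ 3
    + d * sourceDeriv Ia 2 x / cz ω₀ μ ^ 2)

section Regimes

variable {ω₀ δ μ₀ : ℝ} {d : ℂ} {Ia : ℝ → ℝ} {g : ℝ → ℂ → ℂ} {V : Set ℂ} {η Λ B : ℝ}

lemma norm_Ap_sub_qss_le (hω₀ : 0 < ω₀) (hg : IsHeatContinuation ω₀ δ d Ia g) {ε x μ K : ℝ}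
    (hε : 0 < ε) (hμ : μ₀ ≤ μ)
    (h : ‖segInt (flowIntegrand g ε ω₀ x μ) 0 ((μ - μ₀ : ℝ) : ℂ) - scaledQss ε ω₀ d Ia x μ‖
      ≤ K * ε ^ 3) :
    ‖Ap ε ω₀ d Ia μ₀ x μ - qss ε ω₀ d Ia x μ‖ ≤ K * ε ^ (5 / 2 : ℝ) := by
  rw [Ap_eq_segInt hε hg.1 x hμ, qss_eq hω₀ hε, ← mul_sub]
  exact norm_inv_sqrt_mul_le hε h

/-- Near the attracting quasi-steady state the positive axis itself is a path of decay. -/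
lemma exists_attracting_bound (hω₀ : 0 < ω₀) (hδ : 0 < δ) (hd : 0 < d.re)
    (hIa : HasBoundedDerivs Ia) (hg : IsHeatContinuation ω₀ δ d Ia g) {m : ℝ} (hm : μ₀ < m) :
    ∃ K : ℝ, 0 ≤ K ∧ ∀ ε x μ : ℝ, 0 < ε → ε ≤ 1 → m ≤ μ → μ ≤ -δ →
      ‖Ap ε ω₀ d Ia μ₀ x μ - qss ε ω₀ d Ia x μ‖ ≤ K * ε ^ (5 / 2 : ℝ) := by
  obtain ⟨V, η, Λ, B, hV⟩ := hg.exists_isTrackingNhd hω₀ hδ hd hIa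
  obtain ⟨M, hT⟩ := hIa.exists_isDerivTower
  set a := m - μ₀ with ha
  have ha0 : 0 < a := sub_pos.2 hm
  have hκ : 0 < 2 * δ * a := by positivity
  set N := max (M 0) (‖d‖ * M 2) with hN
  have hN0 : 0 ≤ N := le_max_of_le_left (hT.nonneg 0)
  set C := kernelMass d * M 4 * (‖d‖ * a) ^ 2 with hC
  have hC0 : 0 ≤ C := by
    have := hT.nonneg 4
    have := kernelMass_nonneg (d := d)
    positivity
  obtain ⟨K, hK0, hK⟩ := exists_ray_expansion (a : ℂ) hκ hN0 hC0 hω₀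
  have hB0 := hV.B_nonneg
  refine ⟨K + |μ₀| * (B * (6 * (2 / (2 * δ * a)) ^ 3)), by positivity, ?_⟩
  intro ε x μ hε hε1 hmμ hμδ
  have hμ : μ₀ ≤ μ := hm.le.trans hmμ
  refine norm_Ap_sub_qss_le hω₀ hg hε hμ ?_
  have hL : 0 < μ - μ₀ := by linarith
  rw [hV.segInt_ofReal_add ε x μ ha0 hL]
  have h1 := hK ε (cz ω₀ μ) (g x) (sourceDeriv Ia 0 x) (d * sourceDeriv Ia 2 x) hε hε1
    (le_norm_cz hω₀ μ) ?_ ?_ ((hT.bound 0 x).trans (le_max_left _ _)) ?_ ?_ ?_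
  · have h2 : ‖segInt (flowIntegrand g ε ω₀ x μ) a ((μ - μ₀ : ℝ) : ℂ)‖
        ≤ |μ₀| * (B * (6 * (2 / (2 * δ * a)) ^ 3)) * ε ^ 3 := by
      have h3 : ‖segInt (flowIntegrand g ε ω₀ x μ) a ((μ - μ₀ : ℝ) : ℂ)‖
          ≤ ‖((μ - μ₀ : ℝ) : ℂ) - a‖ * (B * Real.exp (-(2 * δ * a) / (2 * ε))) := by
        refine norm_segInt_le fun t ht ht1 => ?_
        have e : (a : ℂ) + t * (((μ - μ₀ : ℝ) : ℂ) - a) = ((a + t * (μ - m) : ℝ) : ℂ) := by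
          rw [ha]; push_cast; ring
        rw [e]
        have hs : a ≤ a + t * (μ - m) := by
          have : 0 ≤ t * (μ - m) := mul_nonneg ht.le (by linarith)
          linarith
        refine norm_flowIntegrand_le hε (hV.bound_ofReal x _ (ha0.trans_le hs)) ?_
        rw [re_phase_exponent, Complex.ofReal_re, Complex.ofReal_im]
        set s := a + t * (μ - m)
        nlinarith [sq_nonneg s, mul_le_mul_of_nonneg_left hs hδ.le]
      have h4 : ‖((μ - μ₀ : ℝ) : ℂ) - a‖ ≤ |μ₀| := by
        rw [← Complex.ofReal_sub, Complex.norm_real, Real.norm_eq_abs, ha, abs_of_nonneg (by linarith)]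
        have := neg_abs_le μ₀
        linarith
      calc _ ≤ |μ₀| * (B * (6 * (2 / (2 * δ * a)) ^ 3 * ε ^ 3)) := by
            refine h3.trans ?_
            gcongr
            exact exp_neg_div_le hκ hε
        _ = _ := by ring
    calc _ = ‖(segInt (flowIntegrand g ε ω₀ x μ) 0 a - scaledQss ε ω₀ d Ia x μ)
            + segInt (flowIntegrand g ε ω₀ x μ) a ((μ - μ₀ : ℝ) : ℂ)‖ := by congr 1; ring
      _ ≤ K * ε ^ 3 + |μ₀| * (B * (6 * (2 / (2 * δ * a)) ^ 3)) * ε ^ 3 :=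
          (norm_add_le _ _).trans (add_le_add h1 h2)
      _ = _ := by ring
  · have : (2 * cz ω₀ μ * (a : ℂ)).re = 2 * μ * a := by simp [cz]
    rw [this]
    nlinarith
  · intro t ht ht1
    rw [← Complex.ofReal_mul, re_phase_exponent, Complex.ofReal_re, Complex.ofReal_im]
    nlinarith [sq_nonneg (t * a), mul_pos ht ha0]
  · rw [norm_mul]
    refine le_max_of_le_right ?_
    gcongr
    exact hT.bound 2 x
  · refine ((hV.continuousOn_ofReal x).comp (by fun_prop : ContinuousOn (fun t : ℝ => t * a) _)
      fun t ht => mul_pos ht.1 ha0).congr fun t _ => ?_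
    simp
  · intro t ht ht1
    have hta : 0 < t * a := mul_pos ht ha0
    have := hT.heatAvg_taylor hd 2 0 x hta.le
    rw [← Complex.ofReal_mul, hg.1 x _ hta, heatFlow_eq_heatAvg hd _ x hta, ← sourceDeriv_zero]
    rw [Finset.sum_range_succ, Finset.sum_range_one] at this
    simp only [pow_zero, Nat.factorial_zero, Nat.cast_one, div_one, one_mul, mul_zero, add_zero,
      pow_one, Nat.factorial_one, mul_one, zero_add] at this
    rw [show d * sourceDeriv Ia 2 x * ((t * a : ℝ) : ℂ) = d * ((t * a : ℝ) : ℂ) * sourceDeriv Ia 2 x by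
      ring]
    refine this.trans (le_of_eq ?_)
    rw [hC]; ring

/-- An interior point of the tracking region; its ray points into the common valley of the
exponentials for all `μ ≤ ω₀`. -/
def cornerPoint (ω₀ δ : ℝ) : ℂ := ⟨(δ + ω₀) / 4, ω₀ / 2⟩

lemma cornerPoint_mem (hω₀ : 0 < ω₀) (hδ : 0 < δ) (hδω₀ : δ < ω₀) :
    cornerPoint ω₀ δ ∈ trackingRegion ω₀ δ := by
  refine ⟨fun h => ?_, ?_, ?_, ?_, ?_⟩
  · have := congrArg Complex.im h
    simp [cornerPoint] at this
    linarith
  · simp only [cornerPoint]; linarith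
  · simp only [cornerPoint]; linarith
  · simp only [cornerPoint]; nlinarith
  · simp only [cornerPoint]; linarith

/-- The expansion at the corner along the ray through `cornerPoint`, valid for all `μ ≤ ω₀`. -/
lemma exists_corner_bound (hω₀ : 0 < ω₀) (hδ : 0 < δ) (hδω₀ : δ < ω₀) (hd : 0 < d.re)
    (hIa : HasBoundedDerivs Ia) (hg : IsHeatContinuation ω₀ δ d Ia g) :
    ∃ K : ℝ, 0 ≤ K ∧ ∀ ε x μ : ℝ, 0 < ε → ε ≤ 1 → μ ≤ ω₀ →
      ‖segInt (flowIntegrand g ε ω₀ x μ) 0 (cornerPoint ω₀ δ) - scaledQss ε ω₀ d Ia x μ‖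
        ≤ K * ε ^ 3 := by
  obtain ⟨V, η, Λ, B, hV⟩ := hg.exists_isTrackingNhd hω₀ hδ hd hIa
  obtain ⟨M, hT⟩ := hIa.exists_isDerivTower
  set p := cornerPoint ω₀ δ with hp
  have hpmem := cornerPoint_mem hω₀ hδ hδω₀
  have hre : p.re = (δ + ω₀) / 4 := rfl
  have him : p.im = ω₀ / 2 := rfl
  have hray : ∀ t : ℝ, 0 < t → t ≤ 1 → (t : ℂ) * p ∈ trackingRegion ω₀ δ := fun t ht ht1 =>
    smul_mem_trackingRegion hω₀ hδ hpmem ht ht1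
  obtain ⟨C, hC0, hC⟩ := hg.exists_taylor_on_ray hω₀ hδ hd hIa (p := p) (by rw [him]; linarith)
    (by rw [hre, him]; nlinarith) hray
  set N := max (M 0) (‖d‖ * M 2) with hN
  have hN0 : 0 ≤ N := le_max_of_le_left (hT.nonneg 0)
  have hκ : 0 < (ω₀ - δ) ^ 2 / 4 := by have := sub_pos.2 hδω₀; positivity
  obtain ⟨K, hK0, hK⟩ := exists_ray_expansion p hκ hN0 hC0 hω₀
  refine ⟨K, hK0, fun ε x μ hε hε1 hμ => ?_⟩
  refine hK ε (cz ω₀ μ) (g x) (sourceDeriv Ia 0 x) (d * sourceDeriv Ia 2 x) hε hε1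
    (le_norm_cz hω₀ μ) ?_ ?_ ((hT.bound 0 x).trans (le_max_left _ _)) ?_ ?_
    (fun t ht ht1 => hC x t ht ht1)
  · have : (2 * cz ω₀ μ * p).re = 2 * (μ * p.re - ω₀ * p.im) := by simp [cz]; ring
    rw [this, hre, him]
    nlinarith [mul_le_mul_of_nonneg_right hμ (by linarith : 0 ≤ δ + ω₀)]
  · intro t ht ht1
    have hre' : ((t : ℂ) * p).re = t * ((δ + ω₀) / 4) := by simp [hre]
    have him' : ((t : ℂ) * p).im = t * (ω₀ / 2) := by simp [him]
    rw [re_phase_exponent, hre', him']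
    have h1 : μ * (t * ((δ + ω₀) / 4)) ≤ ω₀ * (t * ((δ + ω₀) / 4)) := by
      have : 0 ≤ t * ((δ + ω₀) / 4) := by positivity
      gcongr
    have h2 : t ^ 2 * ((ω₀ - δ) * (3 * ω₀ + δ)) ≤ t * ((ω₀ - δ) * (3 * ω₀ + δ)) := by
      have : 0 ≤ (ω₀ - δ) * (3 * ω₀ + δ) := mul_nonneg (by linarith) (by linarith)
      have : t ^ 2 ≤ t := by nlinarith
      gcongr
    nlinarith [mul_pos ht (mul_pos (sub_pos.2 hδω₀) (by linarith : 0 < ω₀ + 3 * δ))]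
  · rw [norm_mul]
    refine le_max_of_le_right ?_
    gcongr
    exact hT.bound 2 x
  · exact (hV.differentiableOn_region x).continuousOn.comp (by fun_prop) fun t ht =>
      hray t ht.1 ht.2

/-- From `cornerPoint` the path climbs to height `ω₀`, at or left of `δ + i ω₀`; the phase stays
exponentially small on the way because the segment is steeper than the diagonal. -/
lemma norm_cornerPoint_segment_le (hV : IsTrackingNhd ω₀ δ g V η Λ B) (hω₀ : 0 < ω₀) (hδ : 0 < δ)
    (hδω₀ : δ < ω₀) {c : ℝ} (hc0 : 0 ≤ c) (hc : c ≤ δ) (hcV : (⟨c, ω₀⟩ : ℂ) ∈ V) {ε x μ : ℝ}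
    (hε : 0 < ε) (hμ : μ ≤ ω₀) :
    ‖segInt (flowIntegrand g ε ω₀ x μ) (cornerPoint ω₀ δ) ⟨c, ω₀⟩‖
      ≤ ω₀ * (B * Real.exp (-((ω₀ - δ) ^ 2 / 4) / (2 * ε))) := by
  set p := cornerPoint ω₀ δ with hp
  set q : ℂ := ⟨c, ω₀⟩ with hq
  have hre : p.re = (δ + ω₀) / 4 := rfl
  have him : p.im = ω₀ / 2 := rfl
  have hqre : q.re = c := rfl
  have hqim : q.im = ω₀ := rfl
  have hpV : p ∈ V := by
    have := hV.near p (cornerPoint_mem hω₀ hδ hδω₀) (by rw [hre]; linarith) 0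
      (by simpa using hV.η_pos.le)
    simpa using this
  have hB0 := hV.B_nonneg
  have hlen : ‖q - p‖ ≤ ω₀ := by
    refine (Complex.norm_le_abs_re_add_abs_im _).trans ?_
    rw [Complex.sub_re, Complex.sub_im, hre, him, hqre, hqim, abs_of_nonneg (by linarith : 0 ≤ ω₀ - ω₀ / 2)]
    have : |c - (δ + ω₀) / 4| ≤ ω₀ / 2 := abs_le.2 ⟨by linarith, by linarith⟩
    linarith
  refine (norm_segInt_le (K := B * Real.exp (-((ω₀ - δ) ^ 2 / 4) / (2 * ε)))
    fun t ht ht1 => ?_).trans (by gcongr)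
  have hmem : p + (t : ℂ) * (q - p) ∈ V := by
    have := hV.convex.add_smul_sub_mem hpV hcV ⟨ht.le, ht1⟩
    simpa using this
  refine norm_flowIntegrand_le hε (hV.bound x _ hmem)
    (re_phase_exponent_segment_le ht.le ht1 ?_ ?_ ?_)
  · rw [hre, him, hqre, hqim]
    nlinarith
  · rw [re_phase_exponent, hre, him]
    nlinarith [mul_le_mul_of_nonneg_right hμ (by linarith : 0 ≤ δ + ω₀)]
  · rw [re_phase_exponent, hqre, hqim]
    nlinarith [mul_le_mul_of_nonneg_right hμ hc0]

/-- Between the two regimes the path runs from the corner over `δ + i ω₀` to `δ + ω₀`; no saddle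
point contributes. -/
lemma exists_middle_bound (hω₀ : 0 < ω₀) (hμ₀ : μ₀ ≤ -ω₀) (hδ : 0 < δ) (hδω₀ : δ < ω₀)
    (hd : 0 < d.re) (hIa : HasBoundedDerivs Ia) (hg : IsHeatContinuation ω₀ δ d Ia g) :
    ∃ K : ℝ, 0 ≤ K ∧ ∀ ε x μ : ℝ, 0 < ε → ε ≤ 1 → -δ ≤ μ → μ ≤ δ →
      ‖Ap ε ω₀ d Ia μ₀ x μ - qss ε ω₀ d Ia x μ‖ ≤ K * ε ^ (5 / 2 : ℝ) := by
  obtain ⟨V, η, Λ, B, hV⟩ := hg.exists_isTrackingNhd hω₀ hδ hd hIa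
  obtain ⟨K, hK0, hK⟩ := exists_corner_bound hω₀ hδ hδω₀ hd hIa hg
  have hB0 := hV.B_nonneg
  set κ := (ω₀ - δ) ^ 2 / 4 with hκdef
  have hκ : 0 < κ := by have := sub_pos.2 hδω₀; positivity
  set S := 6 * (2 / κ) ^ 3 with hS
  have hlen0 : 0 ≤ 2 * δ + ω₀ + |μ₀| := by positivity
  refine ⟨K + ω₀ * (B * S) + 2 * ω₀ * (B * S) + (2 * δ + ω₀ + |μ₀|) * (B * S), by positivity, ?_⟩
  intro ε x μ hε hε1 hμl hμr
  have hμω₀ : μ ≤ ω₀ := hμr.trans hδω₀.le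
  refine norm_Ap_sub_qss_le hω₀ hg hε (by linarith) ?_
  set F := flowIntegrand g ε ω₀ x μ with hF
  set p := cornerPoint ω₀ δ with hp
  have hpmem := cornerPoint_mem hω₀ hδ hδω₀
  set q : ℂ := ⟨δ, ω₀⟩ with hq
  have hqmem : q ∈ trackingRegion ω₀ δ :=
    ⟨fun h => hω₀.ne' (congrArg Complex.im h), hω₀.le, le_rfl, le_of_eq (mul_comm δ ω₀),
      show δ + ω₀ ≤ 2 * ω₀ by linarith⟩
  have hqV : q ∈ V := by
    have := hV.near q hqmem (by change δ / 2 ≤ δ; linarith) 0 (by simpa using hV.η_pos.le)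
    simpa using this
  set e : ℝ := δ + ω₀ with he
  have he0 : 0 < e := by positivity
  have hemem : (e : ℂ) ∈ trackingRegion ω₀ δ := by
    refine ⟨by exact_mod_cast he0.ne', by simp, by simpa using hω₀.le, ?_, ?_⟩
    · rw [Complex.ofReal_re, Complex.ofReal_im, mul_zero]; positivity
    · rw [Complex.ofReal_re, Complex.ofReal_im, he]; linarith
  have hL : 0 < μ - μ₀ := by linarith
  obtain ⟨KF, hKF⟩ := hV.exists_bound_flowIntegrand_region hω₀ hδ ε x μ
  have hFd := hV.differentiableOn_flowIntegrand_region ε x μ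
  obtain ⟨P, hP⟩ := exists_primitive_segInt (convex_trackingRegion hω₀ hδ) hFd
  have hsplit : segInt F 0 ((μ - μ₀ : ℝ) : ℂ) =
      segInt F 0 p + segInt F p q + segInt F q e + segInt F e ((μ - μ₀ : ℝ) : ℂ) := by
    rw [hV.segInt_ofReal_add ε x μ he0 hL, segInt_zero_add hω₀ hδ hFd hKF hpmem hemem,
      hP _ hpmem _ hemem, hP _ hpmem _ hqmem, hP _ hqmem _ hemem]
    ring
  set X := B * Real.exp (-κ / (2 * ε)) with hX
  have hXle : X ≤ B * S * ε ^ 3 := by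
    rw [hX, mul_assoc]
    gcongr
    exact exp_neg_div_le hκ hε
  have hX0 : 0 ≤ X := by positivity
  have h1 := hK ε x μ hε hε1 hμω₀
  have h2 : ‖segInt F p q‖ ≤ ω₀ * X :=
    norm_cornerPoint_segment_le hV hω₀ hδ hδω₀ hδ.le le_rfl hqV hε hμω₀
  have h3 : ‖segInt F q e‖ ≤ 2 * ω₀ * X := by
    have hlen : ‖(e : ℂ) - q‖ ≤ 2 * ω₀ := by
      refine (Complex.norm_le_abs_re_add_abs_im _).trans ?_
      simp only [Complex.sub_re, Complex.sub_im, Complex.ofReal_re, Complex.ofReal_im, hq, he]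
      rw [zero_sub, abs_neg, add_sub_cancel_left, abs_of_pos hω₀]
      linarith
    refine (norm_segInt_le (K := X) fun t ht ht1 => ?_).trans (by gcongr)
    have hmem : q + (t : ℂ) * ((e : ℂ) - q) ∈ trackingRegion ω₀ δ := by
      have := (convex_trackingRegion hω₀ hδ).add_smul_sub_mem hqmem hemem ⟨ht.le, ht1⟩
      simpa using this
    refine norm_flowIntegrand_le hε (hV.bound_region x _ hmem) ?_
    have hre : (q + (t : ℂ) * ((e : ℂ) - q)).re = δ + t * ω₀ := by simp [hq, he]
    have him : (q + (t : ℂ) * ((e : ℂ) - q)).im = ω₀ - t * ω₀ := by simp [hq]; ring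
    rw [re_phase_exponent, hre, him]
    nlinarith [mul_nonneg (mul_nonneg ht.le hω₀.le) (sub_nonneg.2 hμr),
      mul_le_mul_of_nonneg_left hμr hδ.le]
  have h4 : ‖segInt F e ((μ - μ₀ : ℝ) : ℂ)‖ ≤ (2 * δ + ω₀ + |μ₀|) * X := by
    have hlen : ‖((μ - μ₀ : ℝ) : ℂ) - e‖ ≤ 2 * δ + ω₀ + |μ₀| := by
      rw [← Complex.ofReal_sub, Complex.norm_real, Real.norm_eq_abs, he, abs_le]
      have := neg_abs_le μ₀
      have := le_abs_self μ₀
      constructor <;> linarith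
    refine (norm_segInt_le (K := X) fun t ht ht1 => ?_).trans (by gcongr)
    have es : (e : ℂ) + t * (((μ - μ₀ : ℝ) : ℂ) - e) = ((e + t * (μ - μ₀ - e) : ℝ) : ℂ) := by
      push_cast; ring
    rw [es]
    have hs : μ + ω₀ ≤ e + t * (μ - μ₀ - e) := by
      have a1 : 0 ≤ (1 - t) * (e - (μ + ω₀)) := mul_nonneg (by linarith) (by rw [he]; linarith)
      have a2 : 0 ≤ t * (μ - μ₀ - (μ + ω₀)) := mul_nonneg ht.le (by linarith)
      nlinarith
    refine norm_flowIntegrand_le hε (hV.bound_ofReal x _ (by linarith)) ?_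
    rw [re_phase_exponent, Complex.ofReal_re, Complex.ofReal_im]
    set s := e + t * (μ - μ₀ - e)
    have b1 : ω₀ ^ 2 ≤ (s - μ) ^ 2 := by nlinarith
    have b2 : μ ^ 2 ≤ δ ^ 2 := by nlinarith
    nlinarith
  rw [hsplit]
  calc _ = ‖(segInt F 0 p - scaledQss ε ω₀ d Ia x μ) + segInt F p q + segInt F q e
          + segInt F e ((μ - μ₀ : ℝ) : ℂ)‖ := by congr 1; ring
    _ ≤ K * ε ^ 3 + ω₀ * X + 2 * ω₀ * X + (2 * δ + ω₀ + |μ₀|) * X :=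
        (norm_add_le _ _).trans (add_le_add ((norm_add_le _ _).trans (add_le_add
          ((norm_add_le _ _).trans (add_le_add h1 h2)) h3)) h4)
    _ ≤ K * ε ^ 3 + ω₀ * (B * S * ε ^ 3) + 2 * ω₀ * (B * S * ε ^ 3)
          + (2 * δ + ω₀ + |μ₀|) * (B * S * ε ^ 3) := by gcongr
    _ = _ := by ring

end Regimes

/-! ### The saddle point and the Stokes term -/

section Gauss

lemma integrable_abs_mul_exp_neg_mul_sq {b : ℝ} (hb : 0 < b) :
    Integrable fun w : ℝ => |w| * Real.exp (-b * w ^ 2) := by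
  have h := (integrable_mul_exp_neg_mul_sq hb).norm
  refine h.congr (ae_of_all _ fun w => ?_)
  simp only [norm_mul, Real.norm_eq_abs, abs_of_pos (Real.exp_pos _)]

lemma integral_abs_mul_exp_neg_mul_sq {b : ℝ} (hb : 0 < b) :
    ∫ w : ℝ, |w| * Real.exp (-b * w ^ 2) = 1 / b := by
  have h1 := integral_comp_abs (f := fun w : ℝ => w * Real.exp (-b * w ^ 2))
  simp only [sq_abs] at h1
  have h2 := integral_mul_cexp_neg_mul_sq (b := (b : ℂ)) (by simpa using hb)
  have h3 : ∫ r in Ioi (0 : ℝ), r * Real.exp (-b * r ^ 2) = (2 * b)⁻¹ := by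
    have h4 : ((∫ r in Ioi (0 : ℝ), r * Real.exp (-b * r ^ 2) : ℝ) : ℂ) = (((2 * b)⁻¹ : ℝ) : ℂ) := by
      rw [← integral_complex_ofReal]
      push_cast
      rw [← h2]
    exact_mod_cast h4
  rw [h1, h3]
  field_simp

/-- Laplace's method at an interior maximum: the part of the Gaussian outside the interval of
integration is dominated by `|w| / η`, in the same way as the variation of `f` inside. -/
lemma norm_gauss_integral_sub_le {f : ℝ → ℂ} {a η Λ B ε : ℝ} (hε : 0 < ε) (hη : 0 < η) (hηa : η ≤ a)
    (hΛ : 0 ≤ Λ) (hf : ContinuousOn f (Icc (-a) η))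
    (hlip : ∀ w ∈ Icc (-a) η, ‖f w - f 0‖ ≤ Λ * |w|) (hB : ‖f 0‖ ≤ B) :
    ‖(∫ w in (-a)..η, f w * Real.exp (-(1 / (2 * ε)) * w ^ 2))
      - (Real.sqrt (2 * Real.pi) * Real.sqrt ε : ℝ) * f 0‖ ≤ (Λ + B / η) * (2 * ε) := by
  have hb : 0 < 1 / (2 * ε) := by positivity
  set b := 1 / (2 * ε) with hbdef
  have hB0 : 0 ≤ B := (norm_nonneg _).trans hB
  have hgauss : ∫ w : ℝ, ((Real.exp (-b * w ^ 2) : ℝ) : ℂ) * f 0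
      = (Real.sqrt (2 * Real.pi) * Real.sqrt ε : ℝ) * f 0 := by
    rw [integral_mul_const, integral_complex_ofReal, integral_gaussian, ← Real.sqrt_mul (by positivity)]
    congr 3
    rw [hbdef]; field_simp
  have hset : MeasurableSet (Ioc (-a) η) := measurableSet_Ioc
  have hcont : ContinuousOn (fun w => f w * ((Real.exp (-b * w ^ 2) : ℝ) : ℂ)) (Icc (-a) η) :=
    hf.mul (by fun_prop : Continuous fun w : ℝ => ((Real.exp (-b * w ^ 2) : ℝ) : ℂ)).continuousOn
  have hint1 : Integrable ((Ioc (-a) η).indicator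
      fun w => f w * ((Real.exp (-b * w ^ 2) : ℝ) : ℂ)) := by
    rw [integrable_indicator_iff hset]
    exact (hcont.integrableOn_compact isCompact_Icc).mono_set Ioc_subset_Icc_self
  have hint2 : Integrable fun w : ℝ => ((Real.exp (-b * w ^ 2) : ℝ) : ℂ) * f 0 :=
    ((integrable_exp_neg_mul_sq hb).ofReal).mul_const _
  rw [intervalIntegral.integral_of_le (by linarith), ← integral_indicator hset, ← hgauss,
    ← integral_sub hint1 hint2]
  have hbound : ∀ w : ℝ, ‖(Ioc (-a) η).indicator
      (fun w => f w * ((Real.exp (-b * w ^ 2) : ℝ) : ℂ)) w - ((Real.exp (-b * w ^ 2) : ℝ) : ℂ) * f 0‖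
      ≤ (Λ + B / η) * (|w| * Real.exp (-b * w ^ 2)) := by
    intro w
    have hBη : 0 ≤ B / η * |w| := by positivity
    have hΛw : 0 ≤ Λ * |w| := by positivity
    by_cases hw : w ∈ Ioc (-a) η
    · rw [indicator_of_mem hw, mul_comm (f w), ← mul_sub, norm_mul, Complex.norm_real,
        Real.norm_eq_abs, abs_of_pos (Real.exp_pos _)]
      have := hlip w (Ioc_subset_Icc_self hw)
      calc _ ≤ Real.exp (-b * w ^ 2) * ((Λ + B / η) * |w|) := by
            gcongr
            linarith
        _ = _ := by ring
    · rw [indicator_of_notMem hw, zero_sub, norm_neg, norm_mul, Complex.norm_real,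
        Real.norm_eq_abs, abs_of_pos (Real.exp_pos _)]
      have hwη : η ≤ |w| := by
        by_contra hcon
        push Not at hcon
        have := abs_lt.1 hcon
        exact hw ⟨by linarith, this.2.le⟩
      have h1 : B ≤ B / η * |w| := by
        rw [div_mul_eq_mul_div, le_div_iff₀ hη]
        gcongr
      calc _ ≤ Real.exp (-b * w ^ 2) * ((Λ + B / η) * |w|) := by
            gcongr
            linarith
        _ = _ := by ring
  refine (norm_integral_le_of_norm_le ((integrable_abs_mul_exp_neg_mul_sq hb).const_mul (Λ + B / η))
    (ae_of_all _ hbound)).trans (le_of_eq ?_)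
  rw [integral_const_mul, integral_abs_mul_exp_neg_mul_sq hb, hbdef]
  field_simp

end Gauss

section Stokes

variable {ω₀ δ μ₀ : ℝ} {d : ℂ} {Ia : ℝ → ℝ} {g : ℝ → ℂ → ℂ} {V : Set ℂ} {η Λ B : ℝ}

/-- The integrand of the particular solution relative to its value of the exponential at the saddle
point `z = μ + i ω₀`. -/
def saddleIntegrand (g : ℝ → ℂ → ℂ) (ε ω₀ x μ : ℝ) (s : ℂ) : ℂ :=
  g x s * Complex.exp (-(1 / (2 * (ε : ℂ))) * (s - cz ω₀ μ) ^ 2)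

lemma flowIntegrand_eq (g : ℝ → ℂ → ℂ) (ε ω₀ x μ : ℝ) (s : ℂ) :
    flowIntegrand g ε ω₀ x μ s = weight ε ω₀ μ * saddleIntegrand g ε ω₀ x μ s := by
  rw [flowIntegrand, saddleIntegrand, mul_left_comm, weight, ← Complex.exp_add, phase]
  congr 2
  ring

lemma segInt_flowIntegrand (g : ℝ → ℂ → ℂ) (ε ω₀ x μ : ℝ) (a b : ℂ) :
    segInt (flowIntegrand g ε ω₀ x μ) a b
      = weight ε ω₀ μ * segInt (saddleIntegrand g ε ω₀ x μ) a b := by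
  simp only [segInt, flowIntegrand_eq, intervalIntegral.integral_const_mul]
  ring

lemma norm_saddleIntegrand_le {ε x μ K : ℝ} {s : ℂ} (hε : 0 < ε) (hB : ‖g x s‖ ≤ B)
    (hK : (s.im - ω₀) ^ 2 - (s.re - μ) ^ 2 ≤ K) :
    ‖saddleIntegrand g ε ω₀ x μ s‖ ≤ B * Real.exp (K / (2 * ε)) := by
  have h := (norm_nonneg _).trans hB
  rw [saddleIntegrand, norm_mul, Complex.norm_exp]
  have e : (-(1 / (2 * (ε : ℂ))) * (s - cz ω₀ μ) ^ 2).re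
      = ((s.im - ω₀) ^ 2 - (s.re - μ) ^ 2) / (2 * ε) := by
    rw [show -(1 / (2 * (ε : ℂ))) * (s - cz ω₀ μ) ^ 2
      = ((1 / (2 * ε) : ℝ) : ℂ) * (-(s - cz ω₀ μ) ^ 2) by push_cast; ring, Complex.re_ofReal_mul]
    simp [cz, sq]
    ring
  rw [e]
  gcongr

lemma segInt_add_left (F : ℂ → ℂ) (z a b : ℂ) :
    segInt F (z + a) (z + b) = segInt (fun w => F (z + w)) a b := by
  simp only [segInt, add_sub_add_left_eq_sub, add_assoc]

/-- The horizontal path through the saddle point. -/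
lemma norm_saddle_leg_sub_le (hV : IsTrackingNhd ω₀ δ g V η Λ B) (hω₀ : 0 < ω₀) (hδ : 0 < δ)
    {ε x μ : ℝ} (hε : 0 < ε) (hμ : δ ≤ μ) (hμω₀ : μ ≤ ω₀) :
    ‖segInt (saddleIntegrand g ε ω₀ x μ) ⟨δ - η, ω₀⟩ (cz ω₀ μ + η)
      - (Real.sqrt (2 * Real.pi) * Real.sqrt ε : ℝ) * g x (cz ω₀ μ)‖ ≤ (Λ + B / η) * (2 * ε) := by
  have hη := hV.η_pos
  set z := cz ω₀ μ with hz
  set a := μ - δ + η with ha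
  have hstart : (⟨δ - η, ω₀⟩ : ℂ) = z + ((-a : ℝ) : ℂ) := by
    apply Complex.ext <;> simp [hz, cz, ha]
    ring
  have hmem : ∀ w ∈ Icc (-a) η, z + (w : ℂ) ∈ V := by
    intro w hw
    -- the nearest point of the upper edge of the tracking region
    set c := max (μ + w) δ with hc
    by_cases hwμ : 0 ≤ w
    · refine hV.near z ?_ ?_ w (abs_le.2 ⟨by linarith, hw.2⟩)
      · refine ⟨fun h => ?_, ?_, ?_, ?_, ?_⟩
        · have := congrArg Complex.im h
          simp [hz, cz] at this
          linarith
        all_goals simp only [hz, cz, Complex.add_re, Complex.add_im, Complex.ofReal_re,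
          Complex.ofReal_im, Complex.mul_re, Complex.mul_im, Complex.I_re, Complex.I_im]
        all_goals nlinarith
      · simp [hz, cz]; linarith
    · push Not at hwμ
      have hc1 : δ ≤ c := le_max_right _ _
      have hc2 : c ≤ μ := max_le (by linarith) hμ
      have hc3 : μ + w ≤ c := le_max_left _ _
      have hc4 : c ≤ μ + w + η := max_le (by linarith) (by have := hw.1; rw [ha] at this; linarith)
      have e : z + (w : ℂ) = (⟨c, ω₀⟩ : ℂ) + ((μ + w - c : ℝ) : ℂ) := by
        apply Complex.ext <;> simp [hz, cz]
      rw [e]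
      refine hV.near _ ⟨fun h => hω₀.ne' (congrArg Complex.im h), hω₀.le, le_rfl, ?_, ?_⟩ ?_ _
        (abs_le.2 ⟨by linarith, by linarith⟩)
      · change δ * ω₀ ≤ ω₀ * c
        nlinarith
      · change c + ω₀ ≤ 2 * ω₀
        linarith
      · change δ / 2 ≤ c
        linarith
  have h0mem : z ∈ V := by simpa using hmem 0 ⟨by rw [ha]; linarith, hη.le⟩
  rw [hstart, segInt_add_left, segInt_ofReal]
  have key := norm_gauss_integral_sub_le (f := fun w : ℝ => g x (z + w)) (a := a) (η := η) (Λ := Λ)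
    (B := B) (ε := ε) hε hη (by rw [ha]; linarith) hV.Λ_nonneg ?_ ?_ ?_
  · simp only [Complex.ofReal_zero, add_zero] at key
    have hcongr : ∫ w in (-a)..η, saddleIntegrand g ε ω₀ x μ (z + w)
        = ∫ w in (-a)..η, g x (z + w) * Real.exp (-(1 / (2 * ε)) * w ^ 2) := by
      refine intervalIntegral.integral_congr fun w _ => ?_
      simp only [saddleIntegrand]
      rw [← hz, add_sub_cancel_left]
      push_cast
      rfl
    rw [hcongr]
    exact key
  · exact (hV.differentiableOn x).continuousOn.comp (by fun_prop) hmem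
  · intro w hw
    have := hV.lipschitz x _ (hmem w hw) _ h0mem
    simpa using this
  · simpa using hV.bound x z h0mem

/-- The path from the saddle point region down to the axis, on which the exponential decays away
from the endpoint `μ + ω₀`. -/
lemma norm_descent_leg_le (hV : IsTrackingNhd ω₀ δ g V η Λ B) (hω₀ : 0 < ω₀)
    (hδω₀ : δ < ω₀) {ε x μ : ℝ} (hε : 0 < ε) (hzV : cz ω₀ μ + η ∈ V)
    (heV : ((μ + ω₀ : ℝ) : ℂ) ∈ V) :
    ‖segInt (saddleIntegrand g ε ω₀ x μ) ((μ + ω₀ : ℝ) : ℂ) (cz ω₀ μ + η)‖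
      ≤ 2 * ω₀ * (B * (2 * ε / η ^ 2)) := by
  have hη := hV.η_pos
  have hηδ := hV.η_le
  have hB0 := hV.B_nonneg
  set e : ℂ := ((μ + ω₀ : ℝ) : ℂ) with he
  set b : ℂ := cz ω₀ μ + η with hb
  have hre : (b - e).re = η - ω₀ := by simp [hb, he, cz]
  have him : (b - e).im = ω₀ := by simp [hb, he, cz]
  have hlen : ‖b - e‖ ≤ 2 * ω₀ := by
    refine (Complex.norm_le_abs_re_add_abs_im _).trans ?_
    rw [hre, him, abs_of_pos hω₀, abs_of_nonpos (by linarith)]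
    linarith
  have h := norm_segInt_le_of_exp (F := saddleIntegrand g ε ω₀ x μ) (a := e) (b := b) (K := B)
    (c := η ^ 2 / (2 * ε)) hB0 (by positivity) (fun t ht ht1 => ?_)
  · refine h.trans ?_
    have e1 : B / (η ^ 2 / (2 * ε)) = B * (2 * ε / η ^ 2) := by field_simp
    rw [e1]
    gcongr
  · have hmem : e + (t : ℂ) * (b - e) ∈ V := by
      have := hV.convex.add_smul_sub_mem heV hzV ⟨ht.le, ht1⟩
      simpa using this
    have hre' : (e + (t : ℂ) * (b - e)).re = μ + ω₀ + t * (η - ω₀) := by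
      rw [Complex.add_re, Complex.re_ofReal_mul, hre, he, Complex.ofReal_re]
    have him' : (e + (t : ℂ) * (b - e)).im = t * ω₀ := by
      rw [Complex.add_im, Complex.im_ofReal_mul, him, he, Complex.ofReal_im, zero_add]
    have := norm_saddleIntegrand_le (ω₀ := ω₀) (μ := μ) (K := -(η ^ 2 * t)) hε
      (hV.bound x _ hmem) (by
        rw [hre', him']
        have h1 : 0 ≤ t * (1 - t) * η * (2 * ω₀ - η) :=
          mul_nonneg (mul_nonneg (mul_nonneg ht.le (by linarith)) hη.le) (by linarith)
        nlinarith)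
    refine this.trans (le_of_eq ?_)
    congr 2
    field_simp

/-- The remaining part of the positive axis, beyond `μ + ω₀`. -/
lemma norm_tail_leg_le (hV : IsTrackingNhd ω₀ δ g V η Λ B) (hω₀ : 0 < ω₀) {ε x μ L : ℝ} (hε : 0 < ε)
    (hμ : 0 < μ) (hL : μ + ω₀ ≤ L) :
    ‖segInt (saddleIntegrand g ε ω₀ x μ) ((μ + ω₀ : ℝ) : ℂ) (L : ℂ)‖ ≤ B * (ε / ω₀) := by
  have hB0 := hV.B_nonneg
  have hnorm : ‖(L : ℂ) - ((μ + ω₀ : ℝ) : ℂ)‖ = L - (μ + ω₀) := by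
    rw [← Complex.ofReal_sub, Complex.norm_real, Real.norm_eq_abs, abs_of_nonneg (by linarith)]
  rcases hL.lt_or_eq with hlt | heq
  · set ℓ := L - (μ + ω₀) with hℓ
    have hℓ0 : 0 < ℓ := by linarith
    have h := norm_segInt_le_of_exp (F := saddleIntegrand g ε ω₀ x μ) (a := ((μ + ω₀ : ℝ) : ℂ))
      (b := (L : ℂ)) (K := B) (c := ω₀ * ℓ / ε) hB0 (by positivity) (fun t ht ht1 => ?_)
    · rw [hnorm] at h
      refine h.trans (le_of_eq ?_)
      field_simp
    · have es : ((μ + ω₀ : ℝ) : ℂ) + t * ((L : ℂ) - ((μ + ω₀ : ℝ) : ℂ))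
          = ((μ + ω₀ + t * ℓ : ℝ) : ℂ) := by rw [hℓ]; push_cast; ring
      rw [es]
      have htℓ : 0 < t * ℓ := mul_pos ht hℓ0
      have := norm_saddleIntegrand_le (ω₀ := ω₀) (μ := μ) (K := -(2 * ω₀ * (t * ℓ))) hε
        (hV.bound_ofReal x (μ + ω₀ + t * ℓ) (by linarith)) (by
          rw [Complex.ofReal_re, Complex.ofReal_im]
          nlinarith [sq_nonneg (t * ℓ)])
      refine this.trans (le_of_eq ?_)
      congr 2
      field_simp
  · rw [← heq]
    simp only [segInt, sub_self, zero_mul, norm_zero]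
    positivity

/-- Passage through the saddle point: for `δ ≤ μ ≤ ω₀` the particular solution is the sum of the
contribution of the endpoint `0`, which gives the quasi-steady state, and of the saddle point
`μ + i ω₀`, which gives the Stokes term. -/
lemma exists_stokes_decomposition (hω₀ : 0 < ω₀) (hμ₀ : μ₀ ≤ -ω₀) (hδ : 0 < δ) (hδω₀ : δ < ω₀)
    (hd : 0 < d.re) (hIa : HasBoundedDerivs Ia) (hg : IsHeatContinuation ω₀ δ d Ia g) :
    ∃ K : ℝ, 0 ≤ K ∧ ∀ ε x μ : ℝ, ∃ r₁ r₂ : ℂ, 0 < ε → ε ≤ 1 → δ ≤ μ → μ ≤ ω₀ →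
      Ap ε ω₀ d Ia μ₀ x μ = qss ε ω₀ d Ia x μ + r₁ +
        ((Real.sqrt (2 * Real.pi) : ℂ) * g x (cz ω₀ μ) + r₂) * weight ε ω₀ μ ∧
      ‖r₁‖ ≤ K * ε ^ (5 / 2 : ℝ) ∧ ‖r₂‖ ≤ K * Real.sqrt ε ∧
      ‖(Real.sqrt (2 * Real.pi) : ℂ) * g x (cz ω₀ μ) + r₂‖ ≤ K := by
  obtain ⟨V, η, Λ, B, hV⟩ := hg.exists_isTrackingNhd hω₀ hδ hd hIa
  obtain ⟨K, hK0, hK⟩ := exists_corner_bound hω₀ hδ hδω₀ hd hIa hg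
  have hB0 := hV.B_nonneg
  have hΛ0 := hV.Λ_nonneg
  have hη := hV.η_pos
  have hηδ := hV.η_le
  set κ := (ω₀ - δ) ^ 2 / 4 with hκdef
  have hκ : 0 < κ := by have := sub_pos.2 hδω₀; positivity
  set S := 6 * (2 / κ) ^ 3 with hS
  set K₁ := K + ω₀ * (B * S) with hK₁
  set K₂ := (Λ + B / η) * 2 + 2 * ω₀ * (B * (2 / η ^ 2)) + B / ω₀ with hK₂
  set K₃ := Real.sqrt (2 * Real.pi) * B + K₂ with hK₃
  have hK₁0 : 0 ≤ K₁ := by positivity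
  have hK₂0 : 0 ≤ K₂ := by positivity
  have hK₃0 : 0 ≤ K₃ := by positivity
  refine ⟨K₁ + K₃, by positivity, fun ε x μ => ?_⟩
  by_cases hcond : 0 < ε ∧ ε ≤ 1 ∧ δ ≤ μ ∧ μ ≤ ω₀
  swap
  · exact ⟨0, 0, fun h1 h2 h3 h4 => absurd ⟨h1, h2, h3, h4⟩ hcond⟩
  obtain ⟨hε, hε1, hμ, hμω₀⟩ := hcond
  set F := flowIntegrand g ε ω₀ x μ with hF
  set F' := saddleIntegrand g ε ω₀ x μ with hF'
  set z := cz ω₀ μ with hz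
  set w := weight ε ω₀ μ with hw
  set p := cornerPoint ω₀ δ with hp
  set q : ℂ := ⟨δ - η, ω₀⟩ with hq
  set b : ℂ := z + η with hb
  set e : ℝ := μ + ω₀ with he
  set L : ℝ := μ - μ₀ with hL
  have hμ0 : 0 < μ := by linarith
  have he0 : 0 < e := by positivity
  have hL0 : 0 < L := by rw [hL]; linarith
  -- the corners of the path lie in the regions of holomorphy
  have hpmem := cornerPoint_mem hω₀ hδ hδω₀
  have hpV : p ∈ V := by
    have := hV.near p hpmem (by change δ / 2 ≤ (δ + ω₀) / 4; linarith) 0 (by simpa using hη.le)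
    simpa using this
  have htop : ∀ c, δ ≤ c → c ≤ ω₀ → (⟨c, ω₀⟩ : ℂ) ∈ trackingRegion ω₀ δ := fun c h1 h2 =>
    ⟨fun h => hω₀.ne' (congrArg Complex.im h), hω₀.le, le_rfl,
      (by change δ * ω₀ ≤ ω₀ * c; nlinarith), (by change c + ω₀ ≤ 2 * ω₀; linarith)⟩
  have hqV : q ∈ V := by
    have := hV.near ⟨δ, ω₀⟩ (htop δ le_rfl hδω₀.le) (by change δ / 2 ≤ δ; linarith) (-η)
      (by rw [abs_neg, abs_of_pos hη])
    convert! this using 1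
    apply Complex.ext <;> simp [hq, sub_eq_add_neg]
  have hzeq : z = ⟨μ, ω₀⟩ := by apply Complex.ext <;> simp [hz, cz]
  have hzmem : z ∈ trackingRegion ω₀ δ := hzeq ▸ htop μ hμ hμω₀
  have hbV : b ∈ V := hV.near z hzmem (by rw [hzeq]; change δ / 2 ≤ μ; linarith) η
    (abs_of_pos hη).le
  have hemem : (e : ℂ) ∈ trackingRegion ω₀ δ := by
    refine ⟨by exact_mod_cast he0.ne', by simp, by simpa using hω₀.le, ?_, ?_⟩
    · rw [Complex.ofReal_re, Complex.ofReal_im, mul_zero]; positivity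
    · rw [Complex.ofReal_re, Complex.ofReal_im, he]; linarith
  have heV : (e : ℂ) ∈ V := by
    have := hV.near e hemem (by rw [Complex.ofReal_re, he]; linarith) 0 (by simpa using hη.le)
    simpa using this
  obtain ⟨KF, hKF⟩ := hV.exists_bound_flowIntegrand_region hω₀ hδ ε x μ
  have hFd := hV.differentiableOn_flowIntegrand_region ε x μ
  obtain ⟨P, hP⟩ := exists_primitive_segInt hV.convex (hV.differentiableOn_flowIntegrand ε x μ)
  have hsplit : segInt F 0 (L : ℂ) = segInt F 0 p + segInt F p q +
      (segInt F q b - segInt F e b + segInt F e L) := by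
    rw [hV.segInt_ofReal_add ε x μ he0 hL0, segInt_zero_add hω₀ hδ hFd hKF hpmem hemem,
      hP _ hpV _ heV, hP _ hpV _ hqV, hP _ hqV _ hbV, hP _ heV _ hbV]
    ring
  set J := segInt F' q b - segInt F' e b + segInt F' e L with hJ
  have hsplit' : segInt F 0 (L : ℂ) = segInt F 0 p + segInt F p q + w * J := by
    rw [hsplit, hJ, hF, segInt_flowIntegrand g ε ω₀ x μ q, segInt_flowIntegrand g ε ω₀ x μ e,
      segInt_flowIntegrand g ε ω₀ x μ e]
    ring
  have hr := Real.sqrt_pos.2 hε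
  have hr' : (Real.sqrt ε : ℂ) ≠ 0 := by exact_mod_cast hr.ne'
  refine ⟨1 / (Real.sqrt ε : ℂ) * (segInt F 0 p + segInt F p q - scaledQss ε ω₀ d Ia x μ),
    1 / (Real.sqrt ε : ℂ) * J - (Real.sqrt (2 * Real.pi) : ℂ) * g x z, fun _ _ _ _ => ?_⟩
  have hr₂ : ‖1 / (Real.sqrt ε : ℂ) * J - (Real.sqrt (2 * Real.pi) : ℂ) * g x z‖
      ≤ K₂ * Real.sqrt ε := by
    have h1 := norm_saddle_leg_sub_le (x := x) hV hω₀ hδ hε hμ hμω₀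
    have h2 := norm_descent_leg_le (x := x) hV hω₀ hδω₀ hε hbV heV
    have h3 := norm_tail_leg_le (x := x) hV hω₀ hε hμ0 (show μ + ω₀ ≤ L by rw [hL]; linarith)
    have hJn : ‖J - (Real.sqrt (2 * Real.pi) * Real.sqrt ε : ℝ) * g x z‖ ≤ K₂ * ε := by
      have e1 : J - (Real.sqrt (2 * Real.pi) * Real.sqrt ε : ℝ) * g x z =
          (segInt F' q b - (Real.sqrt (2 * Real.pi) * Real.sqrt ε : ℝ) * g x z)
            - segInt F' e b + segInt F' e L := by rw [hJ]; ring
      rw [e1]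
      calc _ ≤ (Λ + B / η) * (2 * ε) + 2 * ω₀ * (B * (2 * ε / η ^ 2)) + B * (ε / ω₀) :=
            (norm_add_le _ _).trans (add_le_add ((norm_sub_le _ _).trans (add_le_add h1 h2)) h3)
        _ = _ := by rw [hK₂]; ring
    have e2 : 1 / (Real.sqrt ε : ℂ) * J - (Real.sqrt (2 * Real.pi) : ℂ) * g x z =
        1 / (Real.sqrt ε : ℂ) * (J - (Real.sqrt (2 * Real.pi) * Real.sqrt ε : ℝ) * g x z) := by
      push_cast
      field_simp
    rw [e2, norm_mul, norm_div, norm_one, Complex.norm_real, Real.norm_eq_abs, abs_of_pos hr]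
    calc _ ≤ 1 / Real.sqrt ε * (K₂ * ε) := by gcongr
      _ = 1 / Real.sqrt ε * (K₂ * (Real.sqrt ε * Real.sqrt ε)) := by rw [Real.mul_self_sqrt hε.le]
      _ = _ := by field_simp
  refine ⟨?_, ?_, hr₂.trans ?_, ?_⟩
  · rw [Ap_eq_segInt hε hg.1 x (by linarith : μ₀ ≤ μ), qss_eq hω₀ hε]
    change 1 / (Real.sqrt ε : ℂ) * segInt F 0 (L : ℂ) = _
    rw [hsplit', scaledQss]
    ring
  · refine norm_inv_sqrt_mul_le hε ?_
    have h1 := hK ε x μ hε hε1 hμω₀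
    have h2 : ‖segInt F p q‖ ≤ ω₀ * (B * Real.exp (-κ / (2 * ε))) :=
      norm_cornerPoint_segment_le hV hω₀ hδ hδω₀ (by linarith) (by linarith) hqV hε hμω₀
    have h3 := exp_neg_div_le hκ hε
    rw [add_sub_right_comm]
    calc _ ≤ K * ε ^ 3 + ω₀ * (B * Real.exp (-κ / (2 * ε))) :=
          (norm_add_le _ _).trans (add_le_add h1 h2)
      _ ≤ K * ε ^ 3 + ω₀ * (B * (S * ε ^ 3)) := by gcongr
      _ = K₁ * ε ^ 3 := by rw [hK₁]; ring
      _ ≤ _ := by gcongr; linarith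
  · gcongr
    rw [hK₃]
    have : 0 ≤ Real.sqrt (2 * Real.pi) * B := by positivity
    linarith
  · have h1 : ‖(Real.sqrt (2 * Real.pi) : ℂ) * g x z‖ ≤ Real.sqrt (2 * Real.pi) * B := by
      rw [norm_mul, Complex.norm_real, Real.norm_eq_abs, abs_of_nonneg (Real.sqrt_nonneg _)]
      gcongr
      exact hV.bound_region x z hzmem
    have h2 : K₂ * Real.sqrt ε ≤ K₂ := mul_le_of_le_one_right hK₂0 (Real.sqrt_le_one.2 hε1)
    refine (norm_add_le _ _).trans ?_
    rw [hK₃]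
    linarith

end Stokes

/-! ### Exponential estimates and the homogeneous solution -/

section Tracking

variable {ω₀ δ μ₀ : ℝ} {d : ℂ} {Ia : ℝ → ℝ} {g : ℝ → ℂ → ℂ}

lemma norm_weight (ε ω₀ μ : ℝ) :
    ‖weight ε ω₀ μ‖ = Real.exp (-(ω₀ ^ 2 - μ ^ 2) / (2 * ε)) := by
  rw [weight, Complex.norm_exp]
  congr 1
  rw [show (cz ω₀ μ) ^ 2 / (2 * (ε : ℂ)) = (cz ω₀ μ) ^ 2 / ((2 * ε : ℝ) : ℂ) by push_cast; rfl,
    Complex.div_ofReal_re]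
  simp [cz, sq]

lemma norm_cz_le (hω₀ : 0 < ω₀) (μ : ℝ) : ‖cz ω₀ μ‖ ≤ |μ| + ω₀ := by
  refine (Complex.norm_le_abs_re_add_abs_im _).trans (le_of_eq ?_)
  simp [cz, abs_of_pos hω₀]

/-- On bounded `μ`-intervals the factor `1 / ‖μ + i ω₀‖ ^ 5` is bounded from below. -/
lemma mul_rpow_le_mul_div_norm_cz (hω₀ : 0 < ω₀) {ε μ K R : ℝ} (hK : 0 ≤ K) (hε : 0 ≤ ε)
    (hR : |μ| + ω₀ ≤ R) :
    K * ε ^ (5 / 2 : ℝ) ≤ K * R ^ 5 * (ε ^ (5 / 2 : ℝ) / ‖cz ω₀ μ‖ ^ 5) := by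
  have hpos : 0 < ‖cz ω₀ μ‖ := hω₀.trans_le (le_norm_cz hω₀ μ)
  have hle : ‖cz ω₀ μ‖ ≤ R := (norm_cz_le hω₀ μ).trans hR
  have h0 : 0 ≤ ε ^ (5 / 2 : ℝ) := Real.rpow_nonneg hε _
  rw [mul_assoc, mul_div_assoc']
  gcongr
  rw [le_div_iff₀ (by positivity), mul_comm]
  gcongr

/-- At distance `K ε ^ r` from `ω₀` the exponent of the Stokes term is of order
`ε ^ (r - 1)`. -/
lemma neg_sq_sub_sq_div_le (hω₀ : 0 < ω₀) {ε μ K r : ℝ} (hε : 0 < ε) (hμ : 0 ≤ μ) (hK : 0 < K)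
    (hμK : μ ≤ ω₀ - K * ε ^ r) :
    -(ω₀ ^ 2 - μ ^ 2) / (2 * ε) ≤ -(K * ω₀ / 2) / ε ^ (1 - r) := by
  have hr : 0 < ε ^ r := Real.rpow_pos_of_pos hε r
  have h1 : K * ε ^ r * ω₀ ≤ ω₀ ^ 2 - μ ^ 2 := by
    have h2 : K * ε ^ r ≤ ω₀ - μ := by linarith
    have h3 : 0 < K * ε ^ r := by positivity
    nlinarith
  rw [Real.rpow_sub hε, Real.rpow_one]
  have h2 : -(K * ω₀ / 2) / (ε / ε ^ r) = -(K * ε ^ r * ω₀) / (2 * ε) := by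
    field_simp
  rw [h2]
  gcongr

/-- Exponential smallness in a negative power of `ε` beats the order of the remainder. -/
lemma exists_exp_neg_div_rpow_le {c p : ℝ} (hc : 0 < c) (hp : 0 < p) :
    ∃ C : ℝ, 0 ≤ C ∧ ∀ ε : ℝ, 0 < ε → ε ≤ 1 →
      Real.exp (-c / ε ^ p) ≤ C * ε ^ (5 / 2 : ℝ) := by
  obtain ⟨n, hn⟩ := exists_nat_ge ((5 / 2 : ℝ) / p)
  refine ⟨n.factorial / c ^ n, by positivity, fun ε hε hε1 => ?_⟩
  have hεp : 0 < ε ^ p := Real.rpow_pos_of_pos hε p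
  have h1 := Real.pow_div_factorial_le_exp (c / ε ^ p) (by positivity) n
  have hfac : (0 : ℝ) < n.factorial := by exact_mod_cast n.factorial_pos
  rw [neg_div, Real.exp_neg]
  calc (Real.exp (c / ε ^ p))⁻¹ ≤ ((c / ε ^ p) ^ n / n.factorial)⁻¹ :=
        inv_anti₀ (by positivity) h1
    _ = n.factorial / c ^ n * (ε ^ p) ^ n := by rw [div_pow]; field_simp
    _ = n.factorial / c ^ n * ε ^ (p * n) := by rw [Real.rpow_mul_natCast hε.le]
    _ ≤ _ := mul_le_mul_of_nonneg_left
        (Real.rpow_le_rpow_of_exponent_ge hε hε1 ((div_le_iff₀' hp).1 hn)) (by positivity)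

/-- The homogeneous solution, contracted by `exp (-(μ₀² - μ²) / (2 ε))`, stays negligible up to
`ω₀`, because `|μ₀| ≥ ω₀`. -/
lemma exists_norm_Ah_le (hω₀ : 0 < ω₀) (hμ₀ : μ₀ ≤ -ω₀) (hd : 0 < d.re) {m K r : ℝ} (M : ℝ)
    (hm : μ₀ < m) (hK : 0 < K) (hr1 : r < 1) :
    ∃ C : ℝ, ∀ (ε : ℝ) (A₀ : ℝ → ℂ), 0 < ε → ε ≤ 1 → (∀ x, ‖A₀ x‖ ≤ M) →
      ∀ x μ : ℝ, m ≤ μ → μ ≤ ω₀ - K * ε ^ r →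
        ‖Ah ε ω₀ d A₀ μ₀ x μ‖ ≤ C * ε ^ (5 / 2 : ℝ) := by
  obtain ⟨C₁, hC₁, h₁⟩ := exists_exp_neg_div_rpow_le (show 0 < K * ω₀ / 2 by positivity)
    (sub_pos.2 hr1)
  obtain ⟨C₂, hC₂, h₂⟩ : ∃ C : ℝ, 0 ≤ C ∧ ∀ ε μ : ℝ, 0 < ε → ε ≤ 1 → m ≤ μ → μ < 0 →
      Real.exp (-(μ₀ ^ 2 - μ ^ 2) / (2 * ε)) ≤ C * ε ^ (5 / 2 : ℝ) := by
    by_cases hm0 : m < 0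
    · have hκ : 0 < μ₀ ^ 2 - m ^ 2 := by nlinarith
      obtain ⟨C, hC, h⟩ := exists_exp_neg_div_rpow_le (half_pos hκ) one_pos
      refine ⟨C, hC, fun ε μ hε hε1 hmμ hμ0 => (Real.exp_le_exp.2 ?_).trans (h ε hε hε1)⟩
      rw [Real.rpow_one, show -((μ₀ ^ 2 - m ^ 2) / 2) / ε = -(μ₀ ^ 2 - m ^ 2) / (2 * ε) by
        field_simp]
      gcongr ?_ / _
      nlinarith
    · exact ⟨0, le_rfl, fun ε μ _ _ h3 h4 => absurd (h3.trans_lt h4) hm0⟩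
  refine ⟨kernelMass d * M * (C₁ + C₂), fun ε A₀ hε hε1 hM x μ hmμ hμK => ?_⟩
  have hM0 : 0 ≤ M := (norm_nonneg _).trans (hM 0)
  have hmass := kernelMass_nonneg (d := d)
  have hpow : 0 ≤ ε ^ (5 / 2 : ℝ) := Real.rpow_nonneg hε.le _
  have hweight : ‖(weight ε ω₀ μ₀)⁻¹‖ * ‖weight ε ω₀ μ‖
      = Real.exp (-(μ₀ ^ 2 - μ ^ 2) / (2 * ε)) := by
    rw [norm_inv, norm_weight, norm_weight, ← Real.exp_neg, ← Real.exp_add]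
    congr 1
    ring
  have hexp : Real.exp (-(μ₀ ^ 2 - μ ^ 2) / (2 * ε)) ≤ (C₁ + C₂) * ε ^ (5 / 2 : ℝ) := by
    rw [add_mul]
    rcases lt_or_ge μ 0 with hμ | hμ
    · have := h₂ ε μ hε hε1 hmμ hμ
      have : 0 ≤ C₁ * ε ^ (5 / 2 : ℝ) := by positivity
      linarith
    · have h3 : Real.exp (-(μ₀ ^ 2 - μ ^ 2) / (2 * ε)) ≤ Real.exp (-(ω₀ ^ 2 - μ ^ 2) / (2 * ε)) := by
        gcongr Real.exp (?_ / _)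
        nlinarith
      have h4 := Real.exp_le_exp.2 (neg_sq_sub_sq_div_le hω₀ hε hμ hK hμK)
      have h5 := h₁ ε hε hε1
      have : 0 ≤ C₂ * ε ^ (5 / 2 : ℝ) := by positivity
      linarith
  rw [Ah_eq_heatAvg hd ε ω₀ A₀ x (hm.trans_le hmμ), norm_mul, norm_mul, mul_right_comm, hweight]
  calc _ ≤ (C₁ + C₂) * ε ^ (5 / 2 : ℝ) * (kernelMass d * M) := by
        gcongr
        exact norm_heatAvg_le hd hM x _
    _ = _ := by ring

end Tracking

end LinCGL

open LinCGL

theorem mainTheorem1 (ω₀ μ₀ δ : ℝ) (d : ℂ) (Ia : ℝ → ℝ) (g : ℝ → ℂ → ℂ)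
    (hω₀ : 0 < ω₀) (hμ₀ : μ₀ ≤ -ω₀) (hδ : 0 < δ) (hδω₀ : δ < ω₀) (hd : 0 < d.re)
    (hIa : LinCGL.HasBoundedDerivs Ia) (hg : LinCGL.IsHeatContinuation ω₀ δ d Ia g) :
    -- `A_p` solves the equation with zero data, `A_h + A_p` solves it with data `A₀`
    (∀ ε : ℝ, 0 < ε →
      LinCGL.IsSolution ε ω₀ d Ia μ₀ (fun _ => 0) (LinCGL.Ap ε ω₀ d Ia μ₀) ∧
      ∀ A₀ : ℝ → ℂ, Continuous A₀ → (∃ M : ℝ, ∀ x : ℝ, ‖A₀ x‖ ≤ M) →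
        LinCGL.IsSolution ε ω₀ d Ia μ₀ A₀
          (fun x μ => LinCGL.Ah ε ω₀ d A₀ μ₀ x μ + LinCGL.Ap ε ω₀ d Ia μ₀ x μ)) ∧
    -- expansion near the attracting quasi-steady state
    (∀ m : ℝ, μ₀ < m → ∃ C ε₀ : ℝ, 0 < ε₀ ∧
      ∀ ε x μ : ℝ, 0 < ε → ε ≤ ε₀ → m ≤ μ → μ ≤ -δ →
        ‖LinCGL.Ap ε ω₀ d Ia μ₀ x μ - LinCGL.qss ε ω₀ d Ia x μ‖
          ≤ C * (ε ^ (5 / 2 : ℝ) / ‖LinCGL.cz ω₀ μ‖ ^ 5)) ∧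
    -- expansion near the repelling quasi-steady state, with the Stokes term
    (∃ R₁ R₂ : ℝ → ℝ → ℝ → ℂ, ∃ C ε₀ : ℝ, 0 < ε₀ ∧
      (∀ ε x μ : ℝ, 0 < ε → ε ≤ ε₀ → δ ≤ μ → μ ≤ ω₀ →
        LinCGL.Ap ε ω₀ d Ia μ₀ x μ =
          LinCGL.qss ε ω₀ d Ia x μ + R₁ ε x μ +
            ((Real.sqrt (2 * Real.pi) : ℂ) * g x (LinCGL.cz ω₀ μ) + R₂ ε x μ) *
              Complex.exp ((LinCGL.cz ω₀ μ) ^ 2 / (2 * (ε : ℂ))) ∧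
        ‖R₁ ε x μ‖ ≤ C * (ε ^ (5 / 2 : ℝ) / ‖LinCGL.cz ω₀ μ‖ ^ 5) ∧
        ‖R₂ ε x μ‖ ≤ C * Real.sqrt ε ∧
        ‖((Real.sqrt (2 * Real.pi) : ℂ) * g x (LinCGL.cz ω₀ μ) + R₂ ε x μ) *
            Complex.exp ((LinCGL.cz ω₀ μ) ^ 2 / (2 * (ε : ℂ)))‖
          ≤ C * Real.exp (-(ω₀ ^ 2 - μ ^ 2) / (2 * ε))) ∧
      -- the Stokes term is exponentially small up to distance `K ε ^ r` from `ω₀`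
      (∀ K r : ℝ, 0 < K → 0 < r → r < 1 → ∃ c C' ε₁ : ℝ, 0 < c ∧ 0 < ε₁ ∧
        ∀ ε x μ : ℝ, 0 < ε → ε ≤ ε₁ → δ ≤ μ → μ ≤ ω₀ - K * ε ^ r →
          ‖((Real.sqrt (2 * Real.pi) : ℂ) * g x (LinCGL.cz ω₀ μ) + R₂ ε x μ) *
              Complex.exp ((LinCGL.cz ω₀ μ) ^ 2 / (2 * (ε : ℂ)))‖
            ≤ C' * Real.exp (-c / ε ^ (1 - r)))) ∧
    -- all solutions with bounded data at `μ₀` stay near the quasi-steady states until `ω₀`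
    (∀ m K r M : ℝ, μ₀ < m → 0 < K → 0 < r → r < 1 → ∃ C ε₀ : ℝ, 0 < ε₀ ∧
      ∀ (ε : ℝ) (A₀ : ℝ → ℂ), 0 < ε → ε ≤ ε₀ → Continuous A₀ → (∀ x : ℝ, ‖A₀ x‖ ≤ M) →
        ∀ x μ : ℝ, m ≤ μ → μ ≤ ω₀ - K * ε ^ r →
          ‖LinCGL.Ah ε ω₀ d A₀ μ₀ x μ + LinCGL.Ap ε ω₀ d Ia μ₀ x μ - LinCGL.qss ε ω₀ d Ia x μ‖
            ≤ C * ε ^ (5 / 2 : ℝ)) := by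
  obtain ⟨K₂, hK₂, hmiddle⟩ := exists_middle_bound hω₀ hμ₀ hδ hδω₀ hd hIa hg
  obtain ⟨K₃, hK₃, hstokes⟩ := exists_stokes_decomposition hω₀ hμ₀ hδ hδω₀ hd hIa hg
  choose R₁ R₂ hR using hstokes
  have hterm : ∀ ε x μ : ℝ, 0 < ε → ε ≤ 1 → δ ≤ μ → μ ≤ ω₀ →
      ‖((Real.sqrt (2 * Real.pi) : ℂ) * g x (cz ω₀ μ) + R₂ ε x μ) * weight ε ω₀ μ‖
        ≤ K₃ * Real.exp (-(ω₀ ^ 2 - μ ^ 2) / (2 * ε)) := by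
    intro ε x μ hε hε1 hμ hμω₀
    rw [norm_mul, norm_weight]
    gcongr
    exact (hR ε x μ hε hε1 hμ hμω₀).2.2.2
  have hsmall : ∀ K r ε x μ : ℝ, 0 < K → 0 < ε → ε ≤ 1 → δ ≤ μ → μ ≤ ω₀ - K * ε ^ r →
      ‖((Real.sqrt (2 * Real.pi) : ℂ) * g x (cz ω₀ μ) + R₂ ε x μ) * weight ε ω₀ μ‖
        ≤ K₃ * Real.exp (-(K * ω₀ / 2) / ε ^ (1 - r)) := by
    intro K r ε x μ hK hε hε1 hμ hμK
    have hpos : 0 < K * ε ^ r := by positivity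
    refine (hterm ε x μ hε hε1 hμ (by linarith)).trans ?_
    gcongr K₃ * Real.exp ?_
    exact neg_sq_sub_sq_div_le hω₀ hε (hδ.le.trans hμ) hK hμK
  refine ⟨fun ε hε => ⟨isSolution_Ap hε hd hIa, ?_⟩, fun m hm => ?_, ?_, ?_⟩
  · rintro A₀ hA₀ ⟨M, hM⟩
    have := (isSolution_Ah (ω₀ := ω₀) (μ₀ := μ₀) hε hd hA₀ hM).add (isSolution_Ap hε hd hIa)
    simpa only [zero_add, add_zero] using this
  · obtain ⟨K₁, hK₁, hattr⟩ := exists_attracting_bound hω₀ hδ hd hIa hg hm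
    refine ⟨K₁ * (|m| + ω₀) ^ 5, 1, one_pos, fun ε x μ hε hε1 hmμ hμ => ?_⟩
    have habs : |μ| ≤ |m| := by
      rw [abs_of_neg (by linarith : μ < 0), abs_of_neg (by linarith : m < 0)]
      linarith
    exact (hattr ε x μ hε hε1 hmμ hμ).trans
      (mul_rpow_le_mul_div_norm_cz hω₀ hK₁ hε.le (by linarith))
  · refine ⟨R₁, R₂, K₃ * (2 * ω₀) ^ 5 + K₃, 1, one_pos, fun ε x μ hε hε1 hμ hμω₀ => ?_,
      fun K r hK _ _ => ⟨K * ω₀ / 2, K₃, 1, by positivity, one_pos,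
        fun ε x μ hε hε1 hμ hμK => hsmall K r ε x μ hK hε hε1 hμ hμK⟩⟩
    obtain ⟨h1, h2, h3, -⟩ := hR ε x μ hε hε1 hμ hμω₀
    have hC : 0 ≤ K₃ * (2 * ω₀) ^ 5 := by positivity
    refine ⟨h1, h2.trans ((mul_rpow_le_mul_div_norm_cz (μ := μ) (R := 2 * ω₀) hω₀ hK₃ hε.le ?_).trans
      ?_), h3.trans ?_, (hterm ε x μ hε hε1 hμ hμω₀).trans ?_⟩
    · rw [abs_of_pos (hδ.trans_le hμ)]
      linarith
    all_goals gcongr; linarith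
  · intro m K r M hm hK _ hr1
    -- the three regimes `μ ≤ -δ`, `|μ| ≤ δ` and `δ ≤ μ`; in the last one the Stokes term is absorbed
    obtain ⟨K₁, hK₁, hattr⟩ := exists_attracting_bound hω₀ hδ hd hIa hg hm
    obtain ⟨CA, hA⟩ := exists_norm_Ah_le hω₀ hμ₀ hd M hm hK hr1
    obtain ⟨CS, hCS, hS⟩ := exists_exp_neg_div_rpow_le (show 0 < K * ω₀ / 2 by positivity)
      (sub_pos.2 hr1)
    refine ⟨CA + (K₁ + K₂ + (K₃ + K₃ * CS)), 1, one_pos, fun ε A₀ hε hε1 _ hM x μ hmμ hμK => ?_⟩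
    have hpos : 0 < K * ε ^ r := by positivity
    have hpow : 0 ≤ ε ^ (5 / 2 : ℝ) := Real.rpow_nonneg hε.le _
    have hAp : ‖Ap ε ω₀ d Ia μ₀ x μ - qss ε ω₀ d Ia x μ‖
        ≤ (K₁ + K₂ + (K₃ + K₃ * CS)) * ε ^ (5 / 2 : ℝ) := by
      rcases le_total μ (-δ) with h1 | h1
      · refine (hattr ε x μ hε hε1 hmμ h1).trans ?_
        gcongr
        have : 0 ≤ K₃ * CS := by positivity
        linarith
      rcases le_total μ δ with h2 | h2
      · refine (hmiddle ε x μ hε hε1 h1 h2).trans ?_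
        gcongr
        have : 0 ≤ K₃ * CS := by positivity
        linarith
      obtain ⟨h3, h4, -⟩ := hR ε x μ hε hε1 h2 (by linarith)
      have h5 := hsmall K r ε x μ hK hε hε1 h2 hμK
      have h6 := mul_le_mul_of_nonneg_left (hS ε hε hε1) hK₃
      rw [h3, add_assoc, add_sub_cancel_left]
      calc _ ≤ K₃ * ε ^ (5 / 2 : ℝ) + K₃ * (CS * ε ^ (5 / 2 : ℝ)) :=
            (norm_add_le _ _).trans (add_le_add h4 (h5.trans h6))
        _ = (K₃ + K₃ * CS) * ε ^ (5 / 2 : ℝ) := by ring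
        _ ≤ _ := mul_le_mul_of_nonneg_right (by linarith) hpow
    rw [add_sub_assoc, add_mul]
    exact (norm_add_le _ _).trans (add_le_add (hA ε A₀ hε hε1 hM x μ hmμ hμK) hAp)
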